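/- Let $p$ be an odd prime and let $F$ be a finite extension of $\mathbb{Q}_p$, with ring of integers $\mathcal{O}$, maximal ideal $\mathfrak{p}$, residue field $\mathbb{K}=\mathcal{O}/\mathfrak{p}$, $q=|\mathbb{K}|$, and a fixed generator $\varpi$ of $\mathfrak{p}$. Characters are continuous homomorphisms to $\mathbb{C}^*$. For a non-trivial character $\psi$ of $F$ and $a\in F^*$ write $\psi_a(x)=\psi(ax)$, and let $e(\psi)$ be the least $n\in\mathbb{Z}$ with $\psi(\mathfrak{p}^n)=1$. A character $\chi$ of $F^*$ is unramified if it is trivial on $\mathcal{O}^*$, and then $e(\chi)=0$; otherwise $\chi$ is ramified and $e(\chi)$ is the least $m\ge 1$ with $\chi(1+\mathfrak{p}^m)=1$. Put $\tau(\chi,\psi)=1$ if $\chi$ is unramified, and $$\tau(\chi,\psi)=q^{-e(\chi)/2}\sum_{a\in\mathcal{O}^*/(1+\mathfrak{p}^{e(\chi)})}\chi(a)\,\psi\bigl(\varpi^{e(\psi)-e(\chi)}a\bigr)$$ if $\chi$ is ramified. Let $\eta_{\mathbb{K}}$ be the non-trivial quadratic character of $\mathbb{K}^*$ and let $G_\psi(\mathbb{K})=\sum_{x\in\mathbb{K}}\psi'(x^2)$,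 where $\psi'$ is the character of $\mathbb{K}$ induced by $x\mapsto\psi(x\varpi^{e(\psi)-1})$ on $\mathcal{O}$. Let $\psi_o=\psi_{\varpi^{e(\psi)}}$, so that $e(\psi_o)=0$. If $m=e(\chi)\ge 2$ and $k=\lfloor m/2\rfloor$, let $c_{\chi,\psi_o}$ be the unique element of $\mathcal{O}^*/(1+\mathfrak{p}^k)$ such that $\psi_o\bigl(c_{\chi,\psi_o}\varpi^{-m}(x-1)\bigr)=\chi^{-1}(x)$ for all $x\in 1+\mathfrak{p}^{m-k}$; $\eta_{\mathbb{K}}(c_{\chi,\psi_o})$ denotes the value of $\eta_{\mathbb{K}}$ at its image in $\mathbb{K}^*$. Let $d\ge 1$ be an integer prime to $p$ such that $F$ contains the group $\mu_d$ of all $d$-th roots of unity. Let $J$ be a group of characters of $F^*$, trivial on $F^{*d}$, such that restriction to $\mathcal{O}^*$ is an isomorphism from $J$ onto the group of characters of $\mathbb{K}^*/\mathbb{K}^{*d}$ (pulled back to $\mathcal{O}^*$). Let $\psi$ be a non-trivial character of $F$ and let $\chi$ be a character of $F^*$ such that $\chi^d$ is ramified. 1. If $d$ is odd, then $$\prod_{\eta\in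 J}\tau(\eta\chi,\psi)=\tau(\chi^d,\psi_d).$$ 2. If $d$ is even, then $$\prod_{\eta\in J}\tau(\chi\eta,\psi)=\tau(\chi^d,\psi_d)\cdot\begin{cases}\eta_{\mathbb{K}}(c_{\chi,\psi_o}) & \text{if } e(\chi)\text{ is even},\\ \eta_{\mathbb{K}}(2d)\,q^{-1/2}\,G_\psi(\mathbb{K}) & \text{if } e(\chi)\text{ is odd}.\end{cases}$$ -/

import Mathlib

open scoped ValuativeRel

namespace PadicHD

noncomputable section

/-! ### Groups attached to a `p`-adic field `F`

`𝒪[F]`, `𝓂[F]`, `𝓀[F]` are the ring of integers, its maximal ideal `𝔭` and the residue field. -/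

/-- The inclusion `𝒪ˣ → Fˣ`. -/
def unitIncl (F : Type*) [Field F] [ValuativeRel F] : 𝒪[F]ˣ →* Fˣ :=
  Units.map (𝒪[F].subtype : 𝒪[F] →* F)

/-- The reduction map `𝒪ˣ → 𝓀ˣ`. -/
def unitRed (F : Type*) [Field F] [ValuativeRel F] : 𝒪[F]ˣ →* 𝓀[F]ˣ :=
  Units.map (IsLocalRing.residue 𝒪[F] : 𝒪[F] →* 𝓀[F])

/-- The group `1 + 𝔭 ^ n` inside `𝒪ˣ`; for `n = 0` it is all of `𝒪ˣ`. -/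
def principalUnits (F : Type*) [Field F] [ValuativeRel F] (n : ℕ) : Subgroup 𝒪[F]ˣ :=
  (Units.map (Ideal.Quotient.mk (𝓂[F] ^ n) : 𝒪[F] →* 𝒪[F] ⧸ 𝓂[F] ^ n)).ker

/-- The fractional ideal `𝔭 ^ n = ϖ ^ n 𝒪`, for `n : ℤ` and a uniformizer `ϖ`, as a subset
of `F`. -/
def fracIdeal {F : Type*} [Field F] [ValuativeRel F] (ϖ : 𝒪[F]) (n : ℤ) : Set F :=
  {x | ∃ y : 𝒪[F], x = (ϖ : F) ^ n * (y : F)}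

/-- The cardinality `q` of the residue field. -/
def resCard (F : Type*) [Field F] [ValuativeRel F] : ℕ := Nat.card 𝓀[F]

/-! ### Conductors

A character `χ` of `Fˣ` is a continuous homomorphism `Fˣ →ₜ* ℂˣ`; an additive character `ψ` of `F`
is an `AddChar F ℂ` (it takes values in `ℂˣ`), with continuity a separate hypothesis.
`ψ.mulShift a` is the character `ψ_a : x ↦ ψ (a x)`. -/

/-- The conductor `e(ψ)`: the least `n : ℤ` such that `ψ` is trivial on `𝔭 ^ n`. -/
def addCond {F : Type*} [Field F] [ValuativeRel F] (ϖ : 𝒪[F]) (ψ : AddChar F ℂ) : ℤ :=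
  sInf {n : ℤ | ∀ x ∈ fracIdeal ϖ n, ψ x = 1}

/-- `χ` is unramified if it is trivial on `𝒪ˣ`. -/
def IsUnramified {F : Type*} [Field F] [ValuativeRel F] [TopologicalSpace F]
    (χ : Fˣ →ₜ* ℂˣ) : Prop :=
  ∀ u : 𝒪[F]ˣ, χ (unitIncl F u) = 1

open Classical in
/-- The conductor `e(χ)`: `0` if `χ` is unramified, otherwise the least `m ≥ 1` such that
`χ` is trivial on `1 + 𝔭 ^ m`. -/
def mulCond {F : Type*} [Field F] [ValuativeRel F] [TopologicalSpace F]
    (χ : Fˣ →ₜ* ℂˣ) : ℕ :=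
  if IsUnramified χ then 0
  else sInf {m : ℕ | 1 ≤ m ∧ ∀ u ∈ principalUnits F m, χ (unitIncl F u) = 1}

/-! ### The normalized Gauss sum -/

open Classical in
/-- `τ(χ, ψ)`, which is `1` for unramified `χ`, and otherwise
`q ^ (-e(χ)/2) * ∑ χ(a) ψ(ϖ ^ (e(ψ) - e(χ)) a)` over the finite group `𝒪ˣ / (1 + 𝔭 ^ e(χ))`.
The summand does not depend on the representative of the class. -/
def tau {F : Type*} [Field F] [ValuativeRel F] [TopologicalSpace F]
    (ϖ : 𝒪[F]) (χ : Fˣ →ₜ* ℂˣ) (ψ : AddChar F ℂ) : ℂ :=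
  (((resCard F : ℝ) ^ (-(mulCond χ : ℝ) / 2) : ℝ) : ℂ) *
    if IsUnramified χ then 1
    else ∑ᶠ a : 𝒪[F]ˣ ⧸ principalUnits F (mulCond χ),
      ((χ (unitIncl F a.out) : ℂˣ) : ℂ) *
        ψ ((ϖ : F) ^ (addCond ϖ ψ - (mulCond χ : ℤ)) * ((unitIncl F a.out : Fˣ) : F))

/-! ### Residue field data -/

/-- The quadratic character `η_𝓀` of the residue field, with complex values. -/
def etaK (F : Type*) [Field F] [ValuativeRel F] [Finite 𝓀[F]] (x : 𝓀[F]) : ℂ :=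
  letI : Fintype 𝓀[F] := Fintype.ofFinite _
  letI : DecidableEq 𝓀[F] := Classical.decEq _
  ((quadraticChar 𝓀[F] x : ℤ) : ℂ)

/-- The restriction `ψ'` of `ψ` to the residue field, induced by `x ↦ ψ (x ϖ ^ (e(ψ) - 1))` on
`𝒪`. The value does not depend on the lift of `x` to `𝒪`. -/
def resAddChar {F : Type*} [Field F] [ValuativeRel F]
    (ϖ : 𝒪[F]) (ψ : AddChar F ℂ) (x : 𝓀[F]) : ℂ :=
  ψ (((Function.surjInv (IsLocalRing.residue_surjective (R := 𝒪[F])) x : 𝒪[F]) : F) *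
    (ϖ : F) ^ (addCond ϖ ψ - 1))

/-- The quadratic Gauss sum `G_ψ(𝓀) = ∑ ψ'(x ^ 2)`, over the finite field `𝓀`. -/
def quadGauss {F : Type*} [Field F] [ValuativeRel F]
    (ϖ : 𝒪[F]) (ψ : AddChar F ℂ) : ℂ :=
  ∑ᶠ x : 𝓀[F], resAddChar ϖ ψ (x ^ 2)

/-! ### Lifts of the characters of `𝓀ˣ / 𝓀ˣ ^ d` -/

/-- The group of characters of `𝓀ˣ / 𝓀ˣ ^ d`, i.e. the characters of `𝓀ˣ` trivial on `d`-th
powers. -/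
def resPowChars (F : Type*) [Field F] [ValuativeRel F] (d : ℕ) : Subgroup (𝓀[F]ˣ →* ℂˣ) where
  carrier := {θ | ∀ x : 𝓀[F]ˣ, θ (x ^ d) = 1}
  one_mem' := fun _ => rfl
  mul_mem' := fun {a b} ha hb x => by
    rw [MonoidHom.mul_apply, ha x, hb x, one_mul]
  inv_mem' := fun {a} ha x => by
    rw [MonoidHom.inv_apply, ha x, inv_one]

/-- `J` is a lift of the group of characters of `𝓀ˣ / 𝓀ˣ ^ d`: it is a group of characters of
`Fˣ / Fˣ ^ d` which restriction to `𝒪ˣ` maps isomorphically onto (the pull-back to `𝒪ˣ` of) the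
group of characters of `𝓀ˣ / 𝓀ˣ ^ d`. -/
def IsLift {F : Type*} [Field F] [ValuativeRel F] [TopologicalSpace F]
    (d : ℕ) (J : Subgroup (Fˣ →ₜ* ℂˣ)) : Prop :=
  (∀ η ∈ J, ∀ x : Fˣ, η (x ^ d) = 1) ∧
  ∃ r : J ≃* resPowChars F d, ∀ (η : J) (u : 𝒪[F]ˣ),
    (η : Fˣ →ₜ* ℂˣ) (unitIncl F u) = (r η : 𝓀[F]ˣ →* ℂˣ) (unitRed F u)

/-! ### The element `c_{χ,ψ}` -/

/-- With `m = e(χ)` and `k = ⌊m/2⌋`, the class `c` in `𝒪ˣ / (1 + 𝔭 ^ k)` satisfies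
`ψ (c ϖ ^ (-m) (x - 1)) = χ⁻¹ x` for all `x` in `1 + 𝔭 ^ (m - k)`. -/
def IsCElt {F : Type*} [Field F] [ValuativeRel F] [TopologicalSpace F]
    (ϖ : 𝒪[F]) (χ : Fˣ →ₜ* ℂˣ) (ψ : AddChar F ℂ)
    (c : 𝒪[F]ˣ ⧸ principalUnits F (mulCond χ / 2)) : Prop :=
  ∀ a : 𝒪[F]ˣ, (QuotientGroup.mk a : 𝒪[F]ˣ ⧸ principalUnits F (mulCond χ / 2)) = c →
    ∀ x ∈ principalUnits F (mulCond χ - mulCond χ / 2),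
      ψ (((unitIncl F a : Fˣ) : F) * ((ϖ : F) ^ (-(mulCond χ : ℤ)) *
        (((unitIncl F x : Fˣ) : F) - 1))) = ((χ⁻¹ (unitIncl F x) : ℂˣ) : ℂ)

open Classical in
/-- The class `c_{χ,ψ}` in `𝒪ˣ / (1 + 𝔭 ^ k)`, `k = ⌊e(χ)/2⌋`: the unique class with the property
`IsCElt`. It is used for `ψ` with `e(ψ) = 0` and `e(χ) ≥ 2`. -/
def cElt {F : Type*} [Field F] [ValuativeRel F] [TopologicalSpace F]
    (ϖ : 𝒪[F]) (χ : Fˣ →ₜ* ℂˣ) (ψ : AddChar F ℂ) :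
    𝒪[F]ˣ ⧸ principalUnits F (mulCond χ / 2) :=
  if h : ∃! c, IsCElt ϖ χ ψ c then h.choose else 1

/-- `η_𝓀(c)` for a class `c` in `𝒪ˣ / (1 + 𝔭 ^ k)`. For `k ≥ 1` it does not depend on the
representative of the class. -/
def etaClass {F : Type*} [Field F] [ValuativeRel F] [Finite 𝓀[F]] {k : ℕ}
    (c : 𝒪[F]ˣ ⧸ principalUnits F k) : ℂ :=
  etaK F (unitRed F c.out : 𝓀[F]ˣ)

end

end PadicHD

/-! The members of `J` are trivial on `1 + 𝔭` and `d` is a unit of `𝒪`, so every `χη` and also `χ ^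
d` has the conductor `m` of `χ` (`mulCond_mul`, `mulCond_pow`). Each `τ` is then `q ^ (-m/2)` times
a Gauss sum over `S = 𝒪 / 𝔭 ^ m` (`tau_eq`), and `J` becomes the set `torsionChars` of the `d`
characters `η` of the residue field `K` with `η ^ d = 1`. What remains concerns the finite ring `S`,
abstracted as `IsTruncatedDVR`.

For `m = 1` it is the Hasse–Davenport product formula `prod_gaussSum_mul_torsionChars`, proved with
L-functions. Give a monic `f` the weight `χ ^ d` of the product of its roots times `φ` of the sum of
their `d`-th powers. The logarithmic derivative of the generating series has as `k`-th coefficient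
the sum of `χ ^ d (N y) φ (Tr y ^ d)` over the extension of degree `k`, which splits into the lifted
Gauss sums of the `χη`. The simpler weight `χ(product) φ(sum)` has L-function `1 + gT`, so these
lifts are `(-1) ^ (k-1) g(χη) ^ k`. By Newton's identities the coefficient of `T ^ d` is `∏ g(χη)`.
On the other hand the constant term `a` of `f` enters the `d`-th power sum only through `-d a`, so
that coefficient is a constant free of `χ` times the Gauss sum of `χ ^ d` and `φ_d`. Taking `χ = 1`
identifies the constant; pairing `η` with `η⁻¹` and using `d = ∏ (1 - ζ ^ i)` evaluates it.

For `m ≥ 2` stationary phase (`IsTruncatedDVR.gaussSum_eq`) gives each Gauss sum as `χ(c) θ(c) ∑ θ(c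
b² / 2)`, with `b` running over the multiples of `w ^ ⌊m/2⌋`. Twisting by `η` only inserts `η(c)`,
and `χ ^ d` has the same `c` relative to `θ_d`. If `m` is even, the inner sum has constant terms and
the ratio of the two sides is `∏ η(c)`, which is `1` or `η_K(c)` according to the parity of `d`. If
`m` is odd, the inner sum is a quadratic Gauss sum `G` over `K`, and the sides are compared through
`G² = η_K(-1) q` and the values of `η_K` at `-1` and `d`. -/

open Polynomial in
/-- The finite set of monic polynomials of degree `n` over a finite field. -/
noncomputable def monicsOfDegree (K : Type*) [Field K] [Fintype K] : ℕ → Finset K[X]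
  | 0 => {1}
  | n + 1 => by
    classical
    exact (monicsOfDegree K n ×ˢ (Finset.univ : Finset K)).image fun g => X * g.1 + C g.2

/-! ### Monic polynomials over a finite field and Euler products -/

section MonicSums

open Polynomial Finset

variable {K : Type*} [Field K] [Fintype K]

lemma mem_monicsOfDegree {n : ℕ} {f : K[X]} :
    f ∈ monicsOfDegree K n ↔ f.Monic ∧ f.natDegree = n := by
  classical
  induction n generalizing f with
  | zero =>
    simp only [monicsOfDegree, mem_singleton]
    constructor
    · rintro rfl; simp
    · rintro ⟨h1, h2⟩; exact h1.natDegree_eq_zero.mp h2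
  | succ n ih =>
    simp only [monicsOfDegree, mem_image, mem_product, mem_univ, and_true, Prod.exists, ih]
    constructor
    · rintro ⟨g, a, ⟨hg, hn⟩, rfl⟩
      have hX : (X * g).Monic := monic_X.mul hg
      have hd : (X * g).natDegree = n + 1 := by
        rw [monic_X.natDegree_mul hg, natDegree_X, hn, add_comm]
      have hlt : (C a).degree < (X * g).degree := by
        refine lt_of_le_of_lt degree_C_le ?_
        rw [degree_eq_natDegree hX.ne_zero, hd]
        exact_mod_cast Nat.succ_pos n
      exact ⟨hX.add_of_left hlt, by rw [natDegree_add_C, hd]⟩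
    · rintro ⟨h1, h2⟩
      refine ⟨f.divX, f.coeff 0, ⟨?_, ?_⟩, X_mul_divX_add f⟩
      · have : f.divX.leadingCoeff = f.leadingCoeff := by
          rw [leadingCoeff, leadingCoeff, natDegree_divX_eq_natDegree_tsub_one, coeff_divX, h2]
          simp
        rw [Monic, this, h1]
      · rw [natDegree_divX_eq_natDegree_tsub_one, h2]; simp

/-- Splits off the constant term. The product of the roots depends on it alone up to sign, so the
Gauss weights are later summed over `a` first. -/
lemma sum_monicsOfDegree_succ {M : Type*} [AddCommMonoid M] (n : ℕ) (F : K[X] → M) :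
    ∑ f ∈ monicsOfDegree K (n + 1), F f =
      ∑ g ∈ monicsOfDegree K n, ∑ a : K, F (X * g + C a) := by
  classical
  rw [monicsOfDegree, sum_image, sum_product]
  rintro ⟨g, a⟩ - ⟨g', a'⟩ - h
  have h0 : a = a' := by simpa using congrArg (fun f => coeff f 0) h
  subst h0
  simpa using h

/-- The finite set of monic irreducible polynomials of degree `n`. -/
noncomputable def irredsOfDegree (K : Type*) [Field K] [Fintype K] (n : ℕ) : Finset K[X] := by
  classical
  exact (monicsOfDegree K n).filter Irreducible

lemma mem_irredsOfDegree {n : ℕ} {f : K[X]} :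
    f ∈ irredsOfDegree K n ↔ f.Monic ∧ f.natDegree = n ∧ Irreducible f := by
  classical
  simp [irredsOfDegree, mem_monicsOfDegree, and_assoc]

open UniqueFactorizationMonoid Classical in
-- The number of `e ≥ 1` with `P ^ e ∣ f` is the multiplicity of `P` in `f`. In this form the sum
-- over `f` can be exchanged with the sum over prime powers.
lemma Polynomial.Monic.natDegree_eq_sum_irreds {n : ℕ} {f : K[X]} (hf : f ∈ monicsOfDegree K n) :
    n = ∑ m ∈ Icc 1 n, ∑ P ∈ irredsOfDegree K m, m * #{e ∈ Icc 1 n | P ^ e ∣ f} := by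
  obtain ⟨hm, hn⟩ := mem_monicsOfDegree.mp hf
  have hf0 := hm.ne_zero
  have hprod : (normalizedFactors f).prod = f := by
    rw [prod_normalizedFactors_eq hf0, hm.normalize_eq_self]
  have hmon : ∀ P ∈ normalizedFactors f, P.Monic := fun P hP => by
    have := normalize_normalized_factor P hP
    rw [← this]
    exact monic_normalize (ne_zero_of_mem_normalizedFactors hP)
  have h1 : n = ((normalizedFactors f).map natDegree).sum := by
    rw [← natDegree_multiset_prod_of_monic _ hmon, hprod, hn]
  have hcount : ∀ P : K[X], P.Monic → Irreducible P →
      #{e ∈ Icc 1 n | P ^ e ∣ f} = (normalizedFactors f).count P := by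
    intro P hPm hP
    have hem := emultiplicity_eq_count_normalizedFactors hP hf0
    rw [hPm.normalize_eq_self] at hem
    have hle : (normalizedFactors f).count P ≤ n := by
      have : P ^ (normalizedFactors f).count P ∣ f := by
        rw [pow_dvd_iff_le_emultiplicity, hem]
      have h2 := natDegree_le_of_dvd this hf0
      rw [hPm.natDegree_pow, hn] at h2
      exact le_trans (Nat.le_mul_of_pos_right _ hP.natDegree_pos) h2
    have : (Icc 1 n).filter (fun e => P ^ e ∣ f) = Icc 1 ((normalizedFactors f).count P) := by
      ext e
      simp only [mem_filter, mem_Icc, pow_dvd_iff_le_emultiplicity, hem, Nat.cast_le]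
      omega
    rw [this, Nat.card_Icc, Nat.add_sub_cancel]
  have h2 : ∀ m ∈ Icc 1 n, ∑ P ∈ irredsOfDegree K m, m * #{e ∈ Icc 1 n | P ^ e ∣ f} =
      ∑ P ∈ irredsOfDegree K m, (normalizedFactors f).count P * P.natDegree := by
    intro m _
    refine sum_congr rfl fun P hP => ?_
    obtain ⟨a, b, c⟩ := mem_irredsOfDegree.mp hP
    rw [hcount P a c, b, mul_comm]
  rw [sum_congr rfl h2, ← sum_biUnion]
  · conv_lhs => rw [h1, Finset.sum_multiset_map_count]
    simp only [smul_eq_mul]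
    refine sum_subset ?_ ?_
    · intro P hP
      rw [Multiset.mem_toFinset] at hP
      have hirr := irreducible_of_normalized_factor P hP
      have hdvd := dvd_of_mem_normalizedFactors hP
      have hle := natDegree_le_of_dvd hdvd hf0
      rw [hn] at hle
      exact mem_biUnion.mpr ⟨P.natDegree, mem_Icc.mpr ⟨hirr.natDegree_pos, hle⟩,
        mem_irredsOfDegree.mpr ⟨hmon P hP, rfl, hirr⟩⟩
    · intro P _ hP
      rw [Multiset.mem_toFinset] at hP
      rw [Multiset.count_eq_zero_of_notMem hP, zero_mul]
  · intro a _ b _ hab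
    refine disjoint_left.mpr fun P h1 h2 => hab ?_
    rw [← (mem_irredsOfDegree.mp h1).2.1, (mem_irredsOfDegree.mp h2).2.1]

/-- The sum of `w` over the monic polynomials of degree `n`. -/
noncomputable def monicSum (w : K[X] → ℂ) (n : ℕ) : ℂ := ∑ f ∈ monicsOfDegree K n, w f

/-- The sum of `w` over monic prime powers of degree `n`, each prime `P` having weight `deg P`. -/
noncomputable def primePowSum (w : K[X] → ℂ) (n : ℕ) : ℂ :=
  ∑ m ∈ Icc 1 n, ∑ P ∈ irredsOfDegree K m, if m ∣ n then (m : ℂ) * w P ^ (n / m) else 0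

/-- A function on monic polynomials is multiplicative. -/
structure IsMonicMul (w : K[X] → ℂ) : Prop where
  map_one : w 1 = 1
  map_mul : ∀ f g : K[X], f.Monic → g.Monic → w (f * g) = w f * w g

omit [Fintype K] in
lemma IsMonicMul.map_pow {w : K[X] → ℂ} (hw : IsMonicMul w) {f : K[X]} (hf : f.Monic) (n : ℕ) :
    w (f ^ n) = w f ^ n := by
  induction n with
  | zero => simp [hw.map_one]
  | succ n ih => rw [pow_succ, hw.map_mul _ _ (hf.pow n) hf, ih, pow_succ]

lemma IsMonicMul.sum_filter_dvd {w : K[X] → ℂ} (hw : IsMonicMul w) {P : K[X]} (hP : P.Monic)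
    (n : ℕ) [DecidablePred fun f => P ∣ f] :
    ∑ f ∈ monicsOfDegree K n with P ∣ f, w f =
      if P.natDegree ≤ n then w P * monicSum w (n - P.natDegree) else 0 := by
  classical
  split_ifs with h
  · rw [monicSum, mul_sum]
    symm
    refine sum_bij (fun g _ => P * g) ?_ ?_ ?_ ?_
    · intro g hg
      obtain ⟨h1, h2⟩ := mem_monicsOfDegree.mp hg
      refine mem_filter.mpr ⟨mem_monicsOfDegree.mpr ⟨hP.mul h1, ?_⟩, dvd_mul_right _ _⟩
      rw [hP.natDegree_mul h1, h2]; omega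
    · intro g _ g' _ h
      exact mul_left_cancel₀ hP.ne_zero h
    · intro f hf
      obtain ⟨hf, g, rfl⟩ := mem_filter.mp hf
      obtain ⟨h1, h2⟩ := mem_monicsOfDegree.mp hf
      have hg := hP.of_mul_monic_left h1
      rw [hP.natDegree_mul hg] at h2
      exact ⟨g, mem_monicsOfDegree.mpr ⟨hg, by omega⟩, rfl⟩
    · intro g hg
      rw [hw.map_mul _ _ hP (mem_monicsOfDegree.mp hg).1]
  · refine sum_eq_zero fun f hf => ?_
    obtain ⟨hf, hd⟩ := mem_filter.mp hf
    obtain ⟨h1, h2⟩ := mem_monicsOfDegree.mp hf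
    exact absurd (h2 ▸ natDegree_le_of_dvd hd h1.ne_zero) h

lemma sum_Icc_mul_le_eq_sum_dvd {M : Type*} [AddCommMonoid M] {m n : ℕ} (hm : 1 ≤ m)
    (F : ℕ → ℕ → M) :
    ∑ e ∈ Icc 1 n, (if e * m ≤ n then F (e * m) e else 0) =
      ∑ k ∈ Icc 1 n, if m ∣ k then F k (k / m) else 0 := by
  rw [← sum_filter, ← sum_filter]
  refine sum_bij (fun e _ => e * m) ?_ ?_ ?_ ?_
  · intro e he
    simp only [mem_filter, mem_Icc] at he ⊢
    exact ⟨⟨Nat.mul_pos he.1.1 hm, he.2⟩, dvd_mul_left _ _⟩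
  · intro a _ b _ h
    exact Nat.eq_of_mul_eq_mul_right hm h
  · intro k hk
    simp only [mem_filter, mem_Icc] at hk
    obtain ⟨⟨h1, h2⟩, e, rfl⟩ := hk
    refine ⟨e, ?_, mul_comm _ _⟩
    simp only [mem_filter, mem_Icc]
    refine ⟨⟨Nat.pos_of_ne_zero ?_, le_trans (Nat.le_mul_of_pos_left _ hm) h2⟩,
      by rwa [mul_comm]⟩
    rintro rfl; simp at h1
  · intro e _
    rw [Nat.mul_div_cancel _ hm]

/-- The logarithmic derivative of the Euler product, coefficientwise. -/
theorem IsMonicMul.mul_monicSum {w : K[X] → ℂ} (hw : IsMonicMul w) (n : ℕ) :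
    (n : ℂ) * monicSum w n = ∑ k ∈ Icc 1 n, primePowSum w k * monicSum w (n - k) := by
  classical
  have h1 : (n : ℂ) * monicSum w n = ∑ m ∈ Icc 1 n, ∑ P ∈ irredsOfDegree K m, ∑ e ∈ Icc 1 n,
      (m : ℂ) * ∑ f ∈ monicsOfDegree K n with P ^ e ∣ f, w f := by
    calc (n : ℂ) * monicSum w n
        = ∑ f ∈ monicsOfDegree K n, (n : ℂ) * w f := by rw [monicSum, mul_sum]
      _ = ∑ f ∈ monicsOfDegree K n, ∑ m ∈ Icc 1 n, ∑ P ∈ irredsOfDegree K m, ∑ e ∈ Icc 1 n,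
            if P ^ e ∣ f then (m : ℂ) * w f else 0 := by
          refine sum_congr rfl fun f hf => ?_
          -- The factor `n` is the degree of `f`, spread over the prime powers dividing `f`.
          conv_lhs => rw [Polynomial.Monic.natDegree_eq_sum_irreds hf]
          push_cast
          simp only [sum_mul]
          refine sum_congr rfl fun m _ => sum_congr rfl fun P _ => ?_
          rw [← sum_filter, sum_const, nsmul_eq_mul]; ring
      _ = _ := by
          rw [sum_comm]
          refine sum_congr rfl fun m _ => ?_
          rw [sum_comm]
          refine sum_congr rfl fun P _ => ?_
          rw [sum_comm]
          refine sum_congr rfl fun e _ => ?_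
          rw [← sum_filter, mul_sum]
  have h2 : ∀ m ∈ Icc 1 n, ∀ P ∈ irredsOfDegree K m, (∑ e ∈ Icc 1 n,
      (m : ℂ) * ∑ f ∈ monicsOfDegree K n with P ^ e ∣ f, w f) =
      ∑ k ∈ Icc 1 n, if m ∣ k then (m : ℂ) * w P ^ (k / m) * monicSum w (n - k) else 0 := by
    intro m hm P hP
    obtain ⟨a, b, c⟩ := mem_irredsOfDegree.mp hP
    rw [← sum_Icc_mul_le_eq_sum_dvd (mem_Icc.mp hm).1
      (fun k e => (m : ℂ) * w P ^ e * monicSum w (n - k))]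
    refine sum_congr rfl fun e _ => ?_
    rw [hw.sum_filter_dvd (a.pow e), natDegree_pow, b, hw.map_pow a]
    split_ifs <;> ring
  rw [h1, sum_congr rfl fun m hm => sum_congr rfl (h2 m hm)]
  have h3 : ∀ k ∈ Icc 1 n, primePowSum w k * monicSum w (n - k) =
      ∑ m ∈ Icc 1 n, ∑ P ∈ irredsOfDegree K m,
        if m ∣ k then (m : ℂ) * w P ^ (k / m) * monicSum w (n - k) else 0 := by
    intro k hk
    rw [primePowSum, sum_mul]
    rw [mem_Icc] at hk
    -- No `m > k` divides `k`, so the range of `m` can be made independent of `k` before the sums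
    -- are exchanged.
    rw [← sum_subset (Icc_subset_Icc_right hk.2)]
    · refine sum_congr rfl fun m _ => ?_
      rw [sum_mul]
      refine sum_congr rfl fun P _ => ?_
      rw [ite_mul, zero_mul]
    · intro m _ hm'
      refine sum_eq_zero fun P _ => if_neg fun hd => hm' ?_
      rw [mem_Icc]
      exact ⟨Nat.pos_of_dvd_of_pos hd hk.1, Nat.le_of_dvd hk.1 hd⟩
  rw [sum_congr rfl h3, sum_comm]
  refine sum_congr rfl fun m _ => ?_
  rw [sum_comm]

end MonicSums

/-! ### Prime power sums as sums over an extension field -/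

section ExtensionSums

open Polynomial Finset

variable {K : Type*} [Field K] [Fintype K] {L : Type*} [Field L] [Fintype L] [Algebra K L]

/-- `P` divides `X ^ (q ^ n) - X`, which splits in `L`; by separability it has `deg P` distinct
roots there, and these are the elements with minimal polynomial `P`. -/
lemma card_minpoly_fiber [DecidableEq K[X]] {P : K[X]} (hm : P.Monic) (hP : Irreducible P)
    (hd : P.natDegree ∣ Module.finrank K L) :
    #{x : L | minpoly K x = P} = P.natDegree := by
  have hdvd := hP.natDegree_dvd_iff_dvd_X_pow_card_pow_sub_X.mp hd
  have hs : IsSplittingField K L (X ^ (Nat.card K ^ Module.finrank K L) - X) := by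
    rw [← Module.natCard_eq_pow_finrank, Nat.card_eq_fintype_card]
    exact FiniteField.isSplittingField_sub L K
  have hk : Module.finrank K L ≠ 0 := Module.finrank_pos.ne'
  have hne : (X ^ (Nat.card K ^ Module.finrank K L) - X : K[X]) ≠ 0 := 
    (FiniteField.X_pow_card_pow_sub_X_ne_zero _ hk Finite.one_lt_card)
  have hsp : (P.map (algebraMap K L)).Splits :=
    Splits.of_dvd hs.splits (Polynomial.map_ne_zero hne) (Polynomial.map_dvd _ hdvd)
  have hsep : P.Separable := PerfectField.separable_of_irreducible hP
  have hcard := card_rootSet_eq_natDegree (K := L) hsep hsp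
  rw [← hcard, ← Fintype.card_subtype]
  refine Fintype.card_congr (Equiv.subtypeEquivRight fun x => ?_)
  rw [mem_rootSet]
  constructor
  · intro h
    exact ⟨hm.ne_zero, h ▸ minpoly.aeval K x⟩
  · rintro ⟨-, hx⟩
    exact (minpoly.eq_of_irreducible_of_monic hP hx hm).symm

lemma primePowSum_eq_sum_minpoly (w : K[X] → ℂ) :
    primePowSum w (Module.finrank K L) =
      ∑ x : L, w (minpoly K x) ^ (Module.finrank K L / (minpoly K x).natDegree) := by
  classical
  set n := Module.finrank K L
  have hn : 0 < n := Module.finrank_pos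
  have hint : ∀ x : L, IsIntegral K x := fun x => Algebra.IsIntegral.isIntegral x
  have hmem : ∀ x : L, (minpoly K x).natDegree ∈ Icc 1 n ∧ (minpoly K x).natDegree ∣ n := by
    intro x
    have hd : (minpoly K x).natDegree ∣ n := minpoly.degree_dvd (hint x)
    exact ⟨mem_Icc.mpr ⟨minpoly.natDegree_pos (hint x), Nat.le_of_dvd hn hd⟩, hd⟩
  rw [← sum_fiberwise_of_maps_to (s := univ) (t := Icc 1 n)
    (g := fun x : L => (minpoly K x).natDegree) (fun x _ => (hmem x).1)]
  refine sum_congr rfl fun m hm => ?_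
  rw [← sum_fiberwise_of_maps_to (t := irredsOfDegree K m) (g := fun x : L => minpoly K x)]
  · refine sum_congr rfl fun P hP => ?_
    obtain ⟨h1, h2, h3⟩ := mem_irredsOfDegree.mp hP
    rw [filter_filter]
    have : (univ.filter fun x : L => (minpoly K x).natDegree = m ∧ minpoly K x = P) =
        univ.filter fun x : L => minpoly K x = P := by
      refine filter_congr fun x _ => ⟨fun h => h.2, fun h => ⟨by rw [h, h2], h⟩⟩
    rw [this]
    split_ifs with hd
    · rw [sum_congr rfl (g := fun _ => w P ^ (n / m)), sum_const,
        card_minpoly_fiber h1 h3 (h2 ▸ hd), h2, nsmul_eq_mul]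
      intro x hx
      rw [(mem_filter.mp hx).2, h2]
    · symm
      refine sum_eq_zero fun x hx => absurd ?_ hd
      have := (mem_filter.mp hx).2
      rw [← h2, ← this]
      exact (hmem x).2
  · intro x hx
    exact mem_irredsOfDegree.mpr
      ⟨minpoly.monic (hint x), (mem_filter.mp hx).2, minpoly.irreducible (hint x)⟩

end ExtensionSums

/-! ### Power sums of roots, traces and norms -/

section PowerSums

open Polynomial

variable {K : Type*} [Field K]

/-- The power series `∑ pₙ Xⁿ` of power sums of the roots of `f`, which is minus the
`X`-logarithmic derivative of the reversed polynomial. -/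
noncomputable def rootPowerSeries (f : K[X]) : PowerSeries K :=
  -(PowerSeries.X * PowerSeries.derivative K (f.reverse : PowerSeries K) *
    (f.reverse : PowerSeries K)⁻¹)

/-- The sum of the `n`-th powers of the roots of `f`. -/
noncomputable def rootPowerSum (n : ℕ) (f : K[X]) : K := PowerSeries.coeff n (rootPowerSeries f)

lemma constantCoeff_reverse {f : K[X]} (hf : f.Monic) :
    PowerSeries.constantCoeff (f.reverse : PowerSeries K) = 1 := by
  rw [← PowerSeries.coeff_zero_eq_constantCoeff_apply, coeff_coe, coeff_zero_reverse, hf]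

lemma rootPowerSeries_eq {f : K[X]} (hf : f.Monic) {s : PowerSeries K}
    (h : s * (f.reverse : PowerSeries K) = -(PowerSeries.X * PowerSeries.derivative K (f.reverse : PowerSeries K))) :
    rootPowerSeries f = s := by
  have h0 : PowerSeries.constantCoeff (f.reverse : PowerSeries K) ≠ 0 := by
    rw [constantCoeff_reverse hf]; exact one_ne_zero
  rw [rootPowerSeries, ← neg_mul, ← h, mul_assoc, PowerSeries.mul_inv_cancel _ h0, mul_one]

lemma rootPowerSeries_mul_reverse {f : K[X]} (hf : f.Monic) :
    rootPowerSeries f * (f.reverse : PowerSeries K) =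
      -(PowerSeries.X * PowerSeries.derivative K (f.reverse : PowerSeries K)) := by
  have h0 : PowerSeries.constantCoeff (f.reverse : PowerSeries K) ≠ 0 := by
    rw [constantCoeff_reverse hf]; exact one_ne_zero
  rw [rootPowerSeries, ← neg_mul, mul_assoc, PowerSeries.inv_mul_cancel _ h0, mul_one]

/-- A logarithmic derivative turns products into sums. The reversed polynomial of a monic one is
invertible as a power series, so neither roots in `K` nor division by integers is needed. -/
lemma rootPowerSeries_mul {f g : K[X]} (hf : f.Monic) (hg : g.Monic) :
    rootPowerSeries (f * g) = rootPowerSeries f + rootPowerSeries g := by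
  refine rootPowerSeries_eq (hf.mul hg) ?_
  rw [reverse_mul_of_domain, coe_mul, Derivation.leibniz, smul_eq_mul, smul_eq_mul]
  linear_combination (g.reverse : PowerSeries K) * rootPowerSeries_mul_reverse hf +
    (f.reverse : PowerSeries K) * rootPowerSeries_mul_reverse hg

lemma rootPowerSum_mul (n : ℕ) {f g : K[X]} (hf : f.Monic) (hg : g.Monic) :
    rootPowerSum n (f * g) = rootPowerSum n f + rootPowerSum n g := by
  rw [rootPowerSum, rootPowerSeries_mul hf hg, map_add]; rfl

lemma rootPowerSum_one (n : ℕ) : rootPowerSum n (1 : K[X]) = 0 := by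
  have := rootPowerSum_mul n (monic_one (R := K)) monic_one
  simpa using this

/-- The series is the geometric series in `r` without its constant term, whence the condition `1 ≤
n`. -/
lemma rootPowerSum_X_sub_C {n : ℕ} (hn : 1 ≤ n) (r : K) : rootPowerSum n (X - C r) = r ^ n := by
  have hrev : ((X - C r).reverse : PowerSeries K) = 1 - PowerSeries.C r * PowerSeries.X := by
    have : (X - C r : K[X]).reverse = 1 - C r * X := by
      ext i
      rw [coeff_reverse, natDegree_X_sub_C]
      rcases i with _ | _ | i
      · simp [Polynomial.revAt_le]
      · simp [Polynomial.revAt_le, coeff_one]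
      · rw [Polynomial.revAt_eq_self_of_lt (by omega)]
        simp [coeff_X, coeff_one]
    rw [this]; simp
  have hs : rootPowerSeries (X - C r) = PowerSeries.mk (fun i => r ^ i) - 1 := by
    refine rootPowerSeries_eq (monic_X_sub_C r) ?_
    have h1 : PowerSeries.mk (fun i => r ^ i) * (1 - PowerSeries.C r * PowerSeries.X) = 1 := by
      ext i
      rw [mul_sub, mul_one, ← mul_assoc, map_sub]
      rcases i with _ | i
      · simp
      · rw [PowerSeries.coeff_succ_mul_X, PowerSeries.coeff_mul_C]
        simp [PowerSeries.coeff_one, pow_succ]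
    rw [hrev, sub_mul, h1]
    simp only [map_sub, Derivation.map_one_eq_zero, Derivation.leibniz, PowerSeries.derivative_C,
      PowerSeries.derivative_X, smul_eq_mul]
    ring
  rw [rootPowerSum, hs, map_sub, PowerSeries.coeff_mk, PowerSeries.coeff_one, if_neg (by omega),
    sub_zero]

lemma rootPowerSum_map {E : Type*} [Field E] (φ : K →+* E) (n : ℕ) {f : K[X]} (hf : f.Monic) :
    rootPowerSum n (f.map φ) = φ (rootPowerSum n f) := by
  have : rootPowerSeries (f.map φ) = PowerSeries.map φ (rootPowerSeries f) := by
    refine rootPowerSeries_eq (hf.map φ) ?_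
    have hrev : ((f.map φ).reverse : PowerSeries E) = PowerSeries.map φ f.reverse := by
      ext i
      simp [coeff_reverse, natDegree_map]
    have hd : ∀ s : PowerSeries K, PowerSeries.derivative E (PowerSeries.map φ s) =
        PowerSeries.map φ (PowerSeries.derivative K s) := by
      intro s; ext i; simp [PowerSeries.coeff_derivative]
    rw [hrev, ← map_mul, rootPowerSeries_mul_reverse hf, hd]
    simp
  rw [rootPowerSum, this, PowerSeries.coeff_map]; rfl

lemma rootPowerSum_multiset_prod {n : ℕ} (hn : 1 ≤ n) (s : Multiset K) :
    rootPowerSum n (s.map fun r => X - C r).prod = (s.map fun r => r ^ n).sum := by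
  induction s using Multiset.induction_on with
  | empty => simp [rootPowerSum_one]
  | cons a s ih =>
    rw [Multiset.map_cons, Multiset.prod_cons, rootPowerSum_mul n (monic_X_sub_C a)
      (monic_multiset_prod_of_monic _ _ fun r _ => monic_X_sub_C r), ih,
      rootPowerSum_X_sub_C hn, Multiset.map_cons, Multiset.sum_cons]

open IntermediateField in
-- Transitivity reduces to `K⟮x⟯`, where the trace is a sum over embeddings, that is, over the roots
-- of the minimal polynomial in an algebraic closure; `rootPowerSum_map` brings that sum back to
-- `K`.
lemma trace_pow_eq_rootPowerSum {L : Type*} [Field L] [Algebra K L] [FiniteDimensional K L]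
    [Algebra.IsSeparable K L] {n : ℕ} (hn : 1 ≤ n) (x : L) :
    Algebra.trace K L (x ^ n) =
      (Module.finrank K L / (minpoly K x).natDegree) • rootPowerSum n (minpoly K x) := by
  classical
  have hx : IsIntegral K x := Algebra.IsIntegral.isIntegral x
  have hfin : Module.finrank K⟮x⟯ L = Module.finrank K L / (minpoly K x).natDegree := by
    rw [← IntermediateField.adjoin.finrank hx, ← Module.finrank_mul_finrank K K⟮x⟯ L,
      Nat.mul_div_cancel_left _ Module.finrank_pos]
  have h1 : Algebra.trace K L (x ^ n) =
      Module.finrank K⟮x⟯ L • Algebra.trace K K⟮x⟯ (AdjoinSimple.gen K x ^ n) := by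
    rw [← Algebra.trace_trace (S := K⟮x⟯)]
    have : x ^ n = algebraMap K⟮x⟯ L (AdjoinSimple.gen K x ^ n) := by
      rw [map_pow, AdjoinSimple.algebraMap_gen]
    rw [this, Algebra.trace_algebraMap, map_nsmul]
  rw [h1, hfin]
  congr 1
  apply (algebraMap K (AlgebraicClosure K)).injective
  rw [trace_eq_sum_embeddings (AlgebraicClosure K), ← rootPowerSum_map _ _ (minpoly.monic hx)]
  have hsp : ((minpoly K x).map (algebraMap K (AlgebraicClosure K))).Splits :=
    IsAlgClosed.splits _
  have hprod := hsp.eq_prod_roots_of_monic ((minpoly.monic hx).map _)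
  conv_rhs => rw [hprod]
  rw [rootPowerSum_multiset_prod hn]
  let pb := adjoin.powerBasis hx
  have hgen : pb.gen = AdjoinSimple.gen K x := adjoin.powerBasis_gen hx
  have hmin : minpoly K pb.gen = minpoly K x := by rw [hgen, minpoly_gen]
  have hnodup : ((minpoly K pb.gen).aroots (AlgebraicClosure K)).Nodup := by
    rw [hmin]
    exact nodup_roots (Separable.map (Algebra.IsSeparable.isSeparable K x))
  have hsum : ∑ y : { y // y ∈ (minpoly K pb.gen).aroots (AlgebraicClosure K) },
      (y : AlgebraicClosure K) ^ n =
      (((minpoly K pb.gen).aroots (AlgebraicClosure K)).map fun r => r ^ n).sum := by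
    rw [Finset.sum_mem_multiset _ _ (fun y => (y : AlgebraicClosure K) ^ n) fun _ => rfl,
      Finset.sum_eq_multiset_sum, Multiset.toFinset_val, Multiset.dedup_eq_self.mpr hnodup]
  rw [← aroots_def, ← hmin, ← hsum]
  refine Fintype.sum_equiv pb.liftEquiv' _ _ fun σ => ?_
  rw [PowerBasis.liftEquiv'_apply_coe, hgen, map_pow]

open IntermediateField in
lemma trace_eq_nextCoeff_minpoly {L : Type*} [Field L] [Algebra K L] [FiniteDimensional K L]
    (x : L) : Algebra.trace K L x =
      (Module.finrank K L / (minpoly K x).natDegree) • -(minpoly K x).nextCoeff := by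
  have hx : IsIntegral K x := Algebra.IsIntegral.isIntegral x
  have hfin : Module.finrank K⟮x⟯ L = Module.finrank K L / (minpoly K x).natDegree := by
    rw [← IntermediateField.adjoin.finrank hx, ← Module.finrank_mul_finrank K K⟮x⟯ L,
      Nat.mul_div_cancel_left _ Module.finrank_pos]
  rw [trace_eq_trace_adjoin, trace_adjoinSimpleGen hx, hfin]

open IntermediateField in
lemma norm_eq_coeff_zero_minpoly {L : Type*} [Field L] [Algebra K L] [FiniteDimensional K L]
    (x : L) : Algebra.norm K x =
      ((-1) ^ (minpoly K x).natDegree * (minpoly K x).coeff 0) ^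
        (Module.finrank K L / (minpoly K x).natDegree) := by
  have hx : IsIntegral K x := Algebra.IsIntegral.isIntegral x
  have hfin : Module.finrank K⟮x⟯ L = Module.finrank K L / (minpoly K x).natDegree := by
    rw [← IntermediateField.adjoin.finrank hx, ← Module.finrank_mul_finrank K K⟮x⟯ L,
      Nat.mul_div_cancel_left _ Module.finrank_pos]
  have := Algebra.PowerBasis.norm_gen_eq_coeff_zero_minpoly (adjoin.powerBasis hx)
  rw [adjoin.powerBasis_gen, minpoly_gen, adjoin.powerBasis_dim] at this
  rw [Algebra.norm_eq_norm_adjoin, this, hfin]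

end PowerSums

/-! ### Characters of exponent `d` and the `d`-th power map -/

section TorsionCharacters

open Finset

variable {K : Type*} [Field K] [Fintype K]

/-- The multiplicative characters of exponent dividing `d`. -/
noncomputable def torsionChars (K : Type*) [Field K] [Fintype K] (d : ℕ) :
    Finset (MulChar K ℂ) :=
  (Set.toFinite {η : MulChar K ℂ | η ^ d = 1}).toFinset

lemma mem_torsionChars {d : ℕ} {η : MulChar K ℂ} : η ∈ torsionChars K d ↔ η ^ d = 1 := by
  simp [torsionChars]

lemma IsPrimitiveRoot.dvd_card_sub_one {d : ℕ} {ζ : K} (hζ : IsPrimitiveRoot ζ d) (hd : d ≠ 0) :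
    d ∣ Fintype.card K - 1 :=
  hζ.dvd_of_pow_eq_one _ (FiniteField.pow_card_sub_one_eq_one ζ (hζ.ne_zero hd))

lemma card_torsionChars {d : ℕ} {ζ : K} (hζ : IsPrimitiveRoot ζ d) (hd : d ≠ 0) :
    #(torsionChars K d) = d := by
  classical
  have : NeZero d := ⟨hd⟩
  obtain ⟨e⟩ := MulChar.mulEquiv_units K ℂ
  have h1 : #(torsionChars K d) = Nat.card {η : MulChar K ℂ // η ^ d = 1} := by
    rw [Nat.subtype_card (torsionChars K d) fun _ => mem_torsionChars]
  have h2 : Nat.card {η : MulChar K ℂ // η ^ d = 1} = Nat.card (rootsOfUnity d K) := by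
    refine Nat.card_congr (e.toEquiv.subtypeEquiv fun η => ?_)
    change η ^ d = 1 ↔ (e η) ∈ rootsOfUnity d K
    rw [mem_rootsOfUnity, ← map_pow, map_eq_one_iff e e.injective]
  rw [h1, h2]
  rw [hζ.card_rootsOfUnity]

/-- In the cyclic group `Kˣ` the `d`-th powers are the kernel of raising to the power `(q - 1) / d`.
-/
lemma exists_pow_eq_of_pow_card_div_eq_one {d : ℕ} (hd : d ∣ Fintype.card K - 1) {z : K}
    (hz : z ^ ((Fintype.card K - 1) / d) = 1) : ∃ y : K, y ^ d = z := by
  classical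
  have hc : 0 < Fintype.card K - 1 := Nat.sub_pos_of_lt Fintype.one_lt_card
  obtain ⟨m, hm⟩ := hd
  have hd0 : 0 < d := Nat.pos_of_ne_zero (by rintro rfl; simp at hm; omega)
  have hm0 : 0 < m := Nat.pos_of_ne_zero (by rintro rfl; simp at hm; omega)
  rw [hm, Nat.mul_div_cancel_left _ hd0] at hz
  have hz0 : z ≠ 0 := by
    rintro rfl
    rw [zero_pow hm0.ne'] at hz
    exact zero_ne_one hz
  obtain ⟨g, hg⟩ := IsCyclic.exists_generator (α := Kˣ)
  have hord : orderOf g = d * m := by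
    rw [orderOf_eq_card_of_forall_mem_zpowers hg, Nat.card_eq_fintype_card,
      Fintype.card_units, hm]
  obtain ⟨i, hi⟩ := (mem_powers_iff_mem_zpowers).mpr (hg (Units.mk0 z hz0))
  have hi : g ^ i = Units.mk0 z hz0 := hi
  have h1 : g ^ (i * m) = 1 := by
    rw [pow_mul, hi]
    ext; simpa using hz
  have h2 := orderOf_dvd_of_pow_eq_one h1
  rw [hord] at h2
  obtain ⟨j, rfl⟩ := Nat.dvd_of_mul_dvd_mul_right hm0 h2
  refine ⟨((g ^ j : Kˣ) : K), ?_⟩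
  have := congrArg Units.val hi
  rw [Units.val_mk0] at this
  rw [← this, mul_comm d j, pow_mul]
  simp

lemma sum_torsionChars_apply {d : ℕ} {ζ : K} (hζ : IsPrimitiveRoot ζ d) (hd : d ≠ 0) {z : K}
    (hz : z ≠ 0) [Decidable (∃ y : K, y ^ d = z)] :
    ∑ η ∈ torsionChars K d, η z = if ∃ y : K, y ^ d = z then (d : ℂ) else 0 := by
  classical
  have hdvd := hζ.dvd_card_sub_one hd
  split_ifs with h
  · obtain ⟨y, rfl⟩ := h
    have hy : y ≠ 0 := by rintro rfl; exact hz (zero_pow hd)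
    rw [sum_congr rfl (g := fun _ => (1 : ℂ)), sum_const, card_torsionChars hζ hd, nsmul_eq_mul,
      mul_one]
    intro η hη
    rw [map_pow, ← MulChar.pow_apply' η hd, mem_torsionChars.mp hη,
      MulChar.one_apply hy.isUnit]
  · have hne : z ^ ((Fintype.card K - 1) / d) ≠ 1 := fun h' =>
      h (exists_pow_eq_of_pow_card_div_eq_one hdvd h')
    -- A character separating `z ^ ((q - 1) / d)` from `1`, raised to the power `(q - 1) / d`, has
    -- exponent `d` and is nontrivial at `z`; translating by it forces the sum to vanish.
    obtain ⟨θ, hθ⟩ := MulChar.exists_apply_ne_one_of_hasEnoughRootsOfUnity K ℂ hne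
    have hN : (Fintype.card K - 1) / d ≠ 0 := by
      intro h0; rw [h0, pow_zero] at hne; exact hne rfl
    set ρ := θ ^ ((Fintype.card K - 1) / d) with hρ
    have hρz : ρ z ≠ 1 := by rwa [hρ, MulChar.pow_apply' _ hN, ← map_pow]
    have hρd : ρ ^ d = 1 := by
      rw [hρ, ← pow_mul, Nat.div_mul_cancel hdvd, ← Fintype.card_units, MulChar.pow_card_eq_one]
    have hsum : ρ z * ∑ η ∈ torsionChars K d, η z = ∑ η ∈ torsionChars K d, η z := by
      rw [mul_sum]
      refine sum_bij (fun η _ => ρ * η) ?_ ?_ ?_ ?_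
      · intro η hη
        rw [mem_torsionChars] at hη ⊢
        rw [mul_pow, hρd, hη, one_mul]
      · intro a _ b _ hab
        exact mul_left_cancel hab
      · intro η hη
        refine ⟨ρ⁻¹ * η, ?_, by simp⟩
        rw [mem_torsionChars] at hη ⊢
        rw [mul_pow, inv_pow, hρd, hη]; simp
      · intro η _
        rfl
    by_contra h0
    exact hρz (mul_right_cancel₀ h0 (by rw [hsum, one_mul]))

variable {L : Type*} [Field L] [Fintype L] [Algebra K L]

/-- The norm is the power map of exponent `(q ^ n - 1) / (q - 1)`, and `d ∣ q - 1`, so the power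
criterion for `x` in `L` follows from the one for its norm in `K`. -/
lemma exists_pow_eq_iff_exists_pow_eq_norm {d : ℕ} (hd : d ∣ Fintype.card K - 1) {x : L}
    (hx : x ≠ 0) : (∃ y : L, y ^ d = x) ↔ ∃ z : K, z ^ d = Algebra.norm K x := by
  constructor
  · rintro ⟨y, rfl⟩
    exact ⟨Algebra.norm K y, by rw [map_pow]⟩
  · rintro ⟨z, hz⟩
    have hz0 : z ≠ 0 := by
      rintro rfl
      have hd0 : d ≠ 0 := by
        rintro rfl
        have := Nat.sub_pos_of_lt (Fintype.one_lt_card (α := K))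
        rw [zero_dvd_iff] at hd; omega
      rw [zero_pow hd0] at hz
      exact hx (Algebra.norm_eq_zero_iff.mp hz.symm)
    set q := Fintype.card K
    set n := Module.finrank K L
    have hcard : Fintype.card L = q ^ n := Module.card_eq_pow_finrank
    have hgeom : (q - 1) ∣ q ^ n - 1 := Nat.sub_one_dvd_pow_sub_one q n
    have hnorm : algebraMap K L (Algebra.norm K x) = x ^ ((q ^ n - 1) / (q - 1)) := by
      have := FiniteField.algebraMap_norm_eq_pow (K := K) (K' := L) (x := x)
      rwa [Nat.card_eq_fintype_card, Nat.card_eq_fintype_card, hcard] at this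
    refine exists_pow_eq_of_pow_card_div_eq_one (by rw [hcard]; exact hd.trans hgeom) ?_
    have hexp : (q ^ n - 1) / d = (q ^ n - 1) / (q - 1) * ((q - 1) / d) := by
      rw [Nat.div_mul_div_comm hgeom hd, mul_comm (q - 1) d, Nat.mul_div_mul_right]
      exact Nat.sub_pos_of_lt Fintype.one_lt_card
    rw [hcard, hexp, pow_mul, ← hnorm, ← map_pow, ← hz, ← pow_mul, Nat.mul_div_cancel' hd,
      FiniteField.pow_card_sub_one_eq_one z hz0, map_one]

lemma card_pow_eq_eq_sum_torsionChars [DecidableEq L] {d : ℕ} {ζ : K} (hζ : IsPrimitiveRoot ζ d)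
    (hd : d ≠ 0) {x : L} (hx : x ≠ 0) :
    (#{y : L | y ^ d = x} : ℂ) = ∑ η ∈ torsionChars K d, η (Algebra.norm K x) := by
  classical
  have hn : Algebra.norm K x ≠ 0 := fun h => hx (Algebra.norm_eq_zero_iff.mp h)
  rw [sum_torsionChars_apply hζ hd hn]
  simp only [← exists_pow_eq_iff_exists_pow_eq_norm (hζ.dvd_card_sub_one hd) hx]
  split_ifs with h
  · have hζL : IsPrimitiveRoot (algebraMap K L ζ) d :=
      hζ.map_of_injective (algebraMap K L).injective
    have h1 := hζL.card_nthRoots x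
    rw [if_pos h] at h1
    have h2 := hζL.nthRoots_nodup hx
    have : (univ.filter fun y : L => y ^ d = x) = (Polynomial.nthRoots d x).toFinset := by
      ext y
      simp [Polynomial.mem_nthRoots (Nat.pos_of_ne_zero hd)]
    rw [this, Multiset.toFinset_card_of_nodup h2, h1]
  · rw [filter_false_of_mem fun y _ hy => h ⟨y, hy⟩]; simp

/-- Summing over `d`-torsion twists is the same as composing with the `d`-th power map. -/
lemma sum_pow_eq_sum_torsionChars {d : ℕ} {ζ : K} (hζ : IsPrimitiveRoot ζ d) (hd : d ≠ 0)
    (χ : MulChar K ℂ) (φ : AddChar K ℂ) :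
    ∑ y : L, (χ ^ d) (Algebra.norm K y) * φ (Algebra.trace K L (y ^ d)) =
      ∑ η ∈ torsionChars K d, ∑ x : L,
        (χ * η) (Algebra.norm K x) * φ (Algebra.trace K L x) := by
  classical
  calc ∑ y : L, (χ ^ d) (Algebra.norm K y) * φ (Algebra.trace K L (y ^ d))
      = ∑ y : L, χ (Algebra.norm K (y ^ d)) * φ (Algebra.trace K L (y ^ d)) := by
        refine sum_congr rfl fun y _ => ?_
        rw [MulChar.pow_apply' _ hd, map_pow (Algebra.norm K), map_pow χ]
    _ = ∑ x : L, ∑ y : L with y ^ d = x, χ (Algebra.norm K x) * φ (Algebra.trace K L x) := by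
        rw [← sum_fiberwise (s := univ) (g := fun y : L => y ^ d)]
        refine sum_congr rfl fun x _ => sum_congr rfl fun y hy => ?_
        rw [(mem_filter.mp hy).2]
    _ = ∑ x : L, ∑ η ∈ torsionChars K d,
          (χ * η) (Algebra.norm K x) * φ (Algebra.trace K L x) := by
        refine sum_congr rfl fun x _ => ?_
        rw [sum_const, nsmul_eq_mul]
        by_cases hx : x = 0
        · have h0 : ∀ θ : MulChar K ℂ, θ (Algebra.norm K x) = 0 := by
            intro θ
            rw [hx, Algebra.norm_zero, MulChar.map_zero]
          simp [h0]
        · rw [card_pow_eq_eq_sum_torsionChars hζ hd hx, sum_mul]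
          refine sum_congr rfl fun η _ => ?_
          rw [MulChar.mul_apply]; ring
    _ = _ := sum_comm

end TorsionCharacters

/-! ### Newton's identities -/

section Newton

open Finset MvPolynomial

/-- In characteristic zero Newton's recursion determines the elementary symmetric functions from the
power sums, so `A n` is the `n`-th one in the `G i`, and the top one is the product. -/
lemma eq_prod_of_newton_recursion {ι : Type*} [Fintype ι] (G : ι → ℂ) (A : ℕ → ℂ) (h0 : A 0 = 1)
    (h : ∀ n ≤ Fintype.card ι, (n : ℂ) * A n =
      ∑ k ∈ Icc 1 n, ((-1) ^ (k - 1) * ∑ i, G i ^ k) * A (n - k)) :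
    A (Fintype.card ι) = ∏ i, G i := by
  have hE : ∀ n ≤ Fintype.card ι, A n = aeval G (esymm ι ℂ n) := by
    intro n
    induction n using Nat.strong_induction_on with
    | _ n ih =>
      intro hn
      rcases Nat.eq_zero_or_pos n with rfl | hpos
      · simp [h0]
      have hn0 : (n : ℂ) ≠ 0 := by exact_mod_cast hpos.ne'
      apply mul_left_cancel₀ hn0
      have hN := congrArg (aeval G) (mul_esymm_eq_sum ι ℂ n)
      simp only [map_mul, map_natCast, map_pow, map_neg, map_one, map_sum] at hN
      rw [hN, h n hn, mul_sum]
      refine sum_bij (fun k _ => (n - k, k)) ?_ ?_ ?_ ?_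
      · intro k hk
        rw [mem_Icc] at hk
        simp only [mem_filter, HasAntidiagonal.mem_antidiagonal]
        omega
      · intro a _ b _ hab
        exact (Prod.ext_iff.mp hab).2
      · rintro ⟨a, b⟩ hab
        simp only [mem_filter, HasAntidiagonal.mem_antidiagonal] at hab
        exact ⟨b, mem_Icc.mpr (by omega), Prod.ext (by simp; omega) rfl⟩
      · intro k hk
        rw [mem_Icc] at hk
        rw [ih (n - k) (by omega) (by omega)]
        have hs : (-1 : ℂ) ^ (k - 1) = (-1) ^ (n + 1) * (-1) ^ (n - k) := by
          rw [← pow_add]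
          have : n + 1 + (n - k) = (k - 1) + 2 * (n - k + 1) := by omega
          rw [this, pow_add, pow_mul]; simp
        simp only [hs, psum, map_sum, map_pow, aeval_X]
        ring
  rw [hE _ le_rfl]
  simp [esymm, ← Finset.card_univ, Finset.powersetCard_self]

end Newton

/-! ### The Hasse–Davenport product formula -/

section HasseDavenport

open Polynomial Finset

variable {K : Type*} [Field K]

/-- The reversal of `X * g + C a` is that of `g` plus `a X ^ (n + 1)`, so the constant term first
affects the logarithmic derivative in degree `n + 1`, and there linearly. -/
lemma rootPowerSum_X_mul_add_C {g : K[X]} (hg : g.Monic) (n : ℕ) (hn : g.natDegree = n) (a : K) :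
    rootPowerSum (n + 1) (X * g + C a) = rootPowerSum (n + 1) g - (n + 1 : ℕ) * a := by
  have hXg : (X * g).Monic := monic_X.mul hg
  have hd : (X * g).natDegree = n + 1 := by
    rw [monic_X.natDegree_mul hg, natDegree_X, hn, add_comm]
  have hlt : (C a).degree < (X * g).degree := by
    refine lt_of_le_of_lt degree_C_le ?_
    rw [degree_eq_natDegree hXg.ne_zero, hd]
    exact_mod_cast Nat.succ_pos n
  have hf : (X * g + C a).Monic := hXg.add_of_left hlt
  have hfd : (X * g + C a).natDegree = n + 1 := by rw [natDegree_add_C, hd]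
  have hrev : (X * g + C a).reverse = g.reverse + C a * X ^ (n + 1) := by
    have h1 : (X * g).reverse = g.reverse := by
      rw [reverse_mul_of_domain]
      have : (X : K[X]).reverse = 1 := by
        simp [reverse]
      rw [this, one_mul]
    have h2 : reflect (n + 1) (C a : K[X]) = C a * X ^ (n + 1) := reflect_C a (n + 1)
    rw [reverse, hfd, reflect_add, h2, ← hd, ← reverse, h1, hd]
  have hs := rootPowerSeries_mul_reverse hf
  have hs0 := rootPowerSeries_mul_reverse hg
  rw [hrev] at hs
  simp only [Polynomial.coe_add, Polynomial.coe_mul, coe_C, Polynomial.coe_pow, coe_X, map_add, Derivation.leibniz,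
    PowerSeries.derivative_C, Derivation.leibniz_pow, PowerSeries.derivative_X, smul_eq_mul,
    Nat.add_sub_cancel, mul_one, mul_zero, add_zero, nsmul_eq_mul] at hs
  set r : PowerSeries K := (g.reverse : PowerSeries K)
  set s := rootPowerSeries (X * g + C a)
  set t := rootPowerSeries g
  have hr0 : PowerSeries.constantCoeff r = 1 := constantCoeff_reverse hg
  have ht0 : PowerSeries.constantCoeff t = 0 := by
    have := congrArg PowerSeries.constantCoeff hs0
    simpa [hr0] using this
  -- The difference of the equations defining `s` and `t`. As `t` has no constant term, only `-(n +
  -- 1) a` survives in degree `n + 1`.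
  have key : (s - t) * (r + PowerSeries.C a * PowerSeries.X ^ (n + 1)) =
      (-(((n + 1 : ℕ) : PowerSeries K) * PowerSeries.C a) - PowerSeries.C a * t) *
        PowerSeries.X ^ (n + 1) := by
    linear_combination hs - hs0
  have hu0 : PowerSeries.constantCoeff (r + PowerSeries.C a * PowerSeries.X ^ (n + 1)) = 1 := by
    simp [hr0]
  have key2 : s - t = ((-(((n + 1 : ℕ) : PowerSeries K) * PowerSeries.C a) -
      PowerSeries.C a * t) * (r + PowerSeries.C a * PowerSeries.X ^ (n + 1))⁻¹) *
        PowerSeries.X ^ (n + 1) := by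
    have h1 := PowerSeries.mul_inv_cancel (r + PowerSeries.C a * PowerSeries.X ^ (n + 1))
      (by rw [hu0]; exact one_ne_zero)
    linear_combination (r + PowerSeries.C a * PowerSeries.X ^ (n + 1))⁻¹ * key - (s - t) * h1
  have h3 := congrArg (PowerSeries.coeff (n + 1)) key2
  have h4 : PowerSeries.coeff (n + 1) (s - t) = -((n + 1 : ℕ) * a) := by
    rw [h3]
    have := PowerSeries.coeff_mul_X_pow ((-(((n + 1 : ℕ) : PowerSeries K) * PowerSeries.C a) -
      PowerSeries.C a * t) * (r + PowerSeries.C a * PowerSeries.X ^ (n + 1))⁻¹) (n + 1) 0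
    rw [zero_add] at this
    rw [this, PowerSeries.coeff_zero_eq_constantCoeff_apply, map_mul,
      PowerSeries.constantCoeff_inv, hu0]
    simp [ht0]
  rw [map_sub] at h4
  change PowerSeries.coeff (n + 1) s = PowerSeries.coeff (n + 1) t - _
  linear_combination h4

/-- The weight on monic polynomials given by `χ` of the product of the roots and `φ` of the sum
of the roots. -/
noncomputable def gaussWeight (χ : MulChar K ℂ) (φ : AddChar K ℂ) (f : K[X]) : ℂ :=
  χ ((-1) ^ f.natDegree * f.coeff 0) * φ (-f.nextCoeff)

/-- The weight on monic polynomials given by `χ` of the product of the roots and `φ` of the sum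
of the `n`-th powers of the roots. -/
noncomputable def gaussPowWeight (n : ℕ) (χ : MulChar K ℂ) (φ : AddChar K ℂ) (f : K[X]) : ℂ :=
  χ ((-1) ^ f.natDegree * f.coeff 0) * φ (rootPowerSum n f)

lemma map_normCoeff_mul (χ : MulChar K ℂ) {f g : K[X]} (hf : f.Monic) (hg : g.Monic) :
    χ ((-1) ^ (f * g).natDegree * (f * g).coeff 0) =
      χ ((-1) ^ f.natDegree * f.coeff 0) * χ ((-1) ^ g.natDegree * g.coeff 0) := by
  rw [← map_mul, hf.natDegree_mul hg, mul_coeff_zero]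
  congr 1; ring

lemma isMonicMul_gaussWeight (χ : MulChar K ℂ) (φ : AddChar K ℂ) :
    IsMonicMul (gaussWeight χ φ) where
  map_one := by simp [gaussWeight, nextCoeff]
  map_mul f g hf hg := by
    rw [gaussWeight, map_normCoeff_mul χ hf hg, hf.nextCoeff_mul hg, neg_add,
      AddChar.map_add_eq_mul, gaussWeight, gaussWeight]
    ring

lemma isMonicMul_gaussPowWeight (n : ℕ) (χ : MulChar K ℂ) (φ : AddChar K ℂ) :
    IsMonicMul (gaussPowWeight n χ φ) where
  map_one := by simp [gaussPowWeight, rootPowerSum_one]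
  map_mul f g hf hg := by
    rw [gaussPowWeight, map_normCoeff_mul χ hf hg, rootPowerSum_mul n hf hg,
      AddChar.map_add_eq_mul, gaussPowWeight, gaussPowWeight]
    ring

variable [Fintype K]

lemma monicSum_zero {w : K[X] → ℂ} (hw : IsMonicMul w) : monicSum w 0 = 1 := by
  simp [monicSum, monicsOfDegree, hw.map_one]

lemma monicSum_gaussWeight_one (χ : MulChar K ℂ) (φ : AddChar K ℂ) :
    monicSum (gaussWeight χ φ) 1 = gaussSum χ φ := by
  rw [monicSum, sum_monicsOfDegree_succ, monicsOfDegree, sum_singleton, gaussSum]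
  refine Fintype.sum_equiv (Equiv.neg K) _ _ fun a => ?_
  have h1 : (X * 1 + C a : K[X]).natDegree = 1 := by rw [mul_one, natDegree_X_add_C]
  rw [gaussWeight, h1, nextCoeff_of_natDegree_pos (by rw [h1]; exact one_pos), h1]
  simp

lemma coeff_X_mul_add_C_of_mem {n : ℕ} {g : K[X]} (hg : g ∈ monicsOfDegree K (n + 1)) (a : K) :
    (X * g + C a).nextCoeff = g.nextCoeff := by
  have h := (mem_monicsOfDegree.mp hg).2
  have h2 : (X * g + C a).natDegree = n + 2 := by
    rw [natDegree_add_C, monic_X.natDegree_mul (mem_monicsOfDegree.mp hg).1, natDegree_X, h]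
    omega
  rw [nextCoeff_of_natDegree_pos (by omega), nextCoeff_of_natDegree_pos (by omega), h, h2]
  simp

lemma sum_addChar_nextCoeff {φ : AddChar K ℂ} (hφ : φ ≠ 1) (n : ℕ) :
    ∑ g ∈ monicsOfDegree K (n + 1), φ (-g.nextCoeff) = 0 := by
  induction n with
  | zero =>
    rw [sum_monicsOfDegree_succ, monicsOfDegree, sum_singleton]
    have : ∑ a : K, φ a = 0 := AddChar.sum_eq_zero_of_ne_one hφ
    rw [← this]
    refine Fintype.sum_equiv (Equiv.neg K) _ _ fun a => ?_
    have h1 : (X * 1 + C a : K[X]).natDegree = 1 := by rw [mul_one, natDegree_X_add_C]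
    rw [nextCoeff_of_natDegree_pos (by rw [h1]; exact one_pos), h1]
    simp
  | succ n ih =>
    rw [sum_monicsOfDegree_succ, sum_congr rfl fun g hg => sum_congr rfl fun a _ => by
      rw [coeff_X_mul_add_C_of_mem hg a]]
    simp only [sum_const, ← smul_sum, ih, smul_zero]

/-- From degree two on, the constant term and the next coefficient are independent, and the sum of
`φ` over the latter vanishes. Hence the L-function is `1 + gT`. -/
lemma monicSum_gaussWeight_add_two (χ : MulChar K ℂ) {φ : AddChar K ℂ} (hφ : φ ≠ 1) (n : ℕ) :
    monicSum (gaussWeight χ φ) (n + 2) = 0 := by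
  rw [monicSum, sum_monicsOfDegree_succ]
  have : ∀ g ∈ monicsOfDegree K (n + 1), ∑ a : K, gaussWeight χ φ (X * g + C a) =
      (∑ a : K, χ ((-1) ^ (n + 2) * a)) * φ (-g.nextCoeff) := by
    intro g hg
    rw [sum_mul]
    refine sum_congr rfl fun a _ => ?_
    have h := (mem_monicsOfDegree.mp hg).2
    have h2 : (X * g + C a).natDegree = n + 2 := by
      rw [natDegree_add_C, monic_X.natDegree_mul (mem_monicsOfDegree.mp hg).1, natDegree_X, h]
      omega
    rw [gaussWeight, coeff_X_mul_add_C_of_mem hg, h2]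
    simp
  rw [sum_congr rfl this, ← mul_sum, sum_addChar_nextCoeff hφ, mul_zero]

/-- The Hasse–Davenport lifting relation, read off from the logarithmic derivative of `1 + gT`: each
coefficient is `-g` times the previous one. -/
lemma primePowSum_gaussWeight (χ : MulChar K ℂ) {φ : AddChar K ℂ} (hφ : φ ≠ 1) {k : ℕ}
    (hk : 1 ≤ k) :
    primePowSum (gaussWeight χ φ) k = (-1) ^ (k - 1) * gaussSum χ φ ^ k := by
  have hw := isMonicMul_gaussWeight χ φ
  have h0 := monicSum_zero hw
  induction k, hk using Nat.le_induction with
  | base =>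
    have := hw.mul_monicSum 1
    rw [monicSum_gaussWeight_one] at this
    simp [h0] at this
    simp [this]
  | succ k hk ih =>
    have := hw.mul_monicSum (k + 1)
    obtain ⟨j, rfl⟩ : ∃ j, k = j + 1 := ⟨k - 1, by omega⟩
    rw [monicSum_gaussWeight_add_two χ hφ, mul_zero, sum_Icc_succ_top (by omega),
      sum_Icc_succ_top (by omega), sum_eq_zero] at this
    · have e : j + 1 + 1 - (j + 1) = 1 := by omega
      rw [Nat.sub_self, h0, e, monicSum_gaussWeight_one, ih] at this
      have e2 : j + 1 - 1 = j := rfl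
      have e3 : j + 1 + 1 - 1 = j + 1 := rfl
      rw [e2] at this
      rw [e3]
      linear_combination -this
    · intro i hi
      rw [mem_Icc] at hi
      obtain ⟨l, hl⟩ : ∃ l, j + 1 + 1 - i = l + 2 := ⟨j - i, by omega⟩
      rw [hl, monicSum_gaussWeight_add_two χ hφ, mul_zero]

lemma monicSum_gaussPowWeight (χ : MulChar K ℂ) (φ : AddChar K ℂ) (n : ℕ) :
    monicSum (gaussPowWeight (n + 1) (χ ^ (n + 1)) φ) (n + 1) =
      (∑ g ∈ monicsOfDegree K n, φ (rootPowerSum (n + 1) g)) *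
        gaussSum (χ ^ (n + 1)) (φ.mulShift (n + 1 : ℕ)) := by
  rw [monicSum, sum_monicsOfDegree_succ, sum_mul]
  refine sum_congr rfl fun g hg => ?_
  obtain ⟨h1, h2⟩ := mem_monicsOfDegree.mp hg
  rw [gaussSum, mul_sum]
  refine Fintype.sum_equiv (Equiv.neg K) _ _ fun a => ?_
  have h3 : (X * g + C a).natDegree = n + 1 := by
    rw [natDegree_add_C, monic_X.natDegree_mul h1, natDegree_X, h2, add_comm]
  -- The two arguments differ by `(-1) ^ n`, whose power of exponent `n + 1` is `1` because `n (n +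
  -- 1)` is even.
  have hsign : (χ ^ (n + 1)) ((-1) ^ (n + 1) * a) = (χ ^ (n + 1)) (-a) := by
    have e : (-1) ^ (n + 1) * a = (-1) ^ n * -a := by ring
    rw [e, map_mul, MulChar.pow_apply' _ n.succ_ne_zero, ← map_pow, ← pow_mul,
      (Nat.even_mul_succ_self n).neg_one_pow, map_one, one_mul]
  rw [gaussPowWeight, rootPowerSum_X_mul_add_C h1 n h2, h3, sub_eq_add_neg,
    AddChar.map_add_eq_mul, AddChar.mulShift_apply]
  simp only [coeff_add, mul_coeff_zero, coeff_X_zero, zero_mul, coeff_C_zero, zero_add, hsign,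
    Equiv.neg_apply, mul_neg]
  ring

/-- Over the extension of degree `k` the weight becomes `χ ^ d (N y) φ (Tr y ^ d)`; substituting `x
= y ^ d` splits the sum over the torsion twists, each a lifted Gauss sum. -/
lemma primePowSum_gaussPowWeight {d : ℕ} {ζ : K} (hζ : IsPrimitiveRoot ζ d)
    (hd : d ≠ 0) (χ : MulChar K ℂ) {φ : AddChar K ℂ} (hφ : φ ≠ 1) {k : ℕ} (hk : 1 ≤ k) :
    primePowSum (gaussPowWeight d (χ ^ d) φ) k =
      (-1) ^ (k - 1) * ∑ η ∈ torsionChars K d, gaussSum (χ * η) φ ^ k := by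
  obtain ⟨p, hp⟩ := CharP.exists K
  have : Fact p.Prime := ⟨CharP.char_is_prime K p⟩
  have : NeZero k := ⟨by omega⟩
  let L := FiniteField.Extension K p k
  let : Fintype L := Fintype.ofFinite L
  have hk' : Module.finrank K L = k := FiniteField.finrank_extension K p k
  have hfin : FiniteDimensional K L := inferInstance
  have hpow : ∀ (θ : MulChar K ℂ) (x : L),
      θ ((-1) ^ (minpoly K x).natDegree * (minpoly K x).coeff 0) ^
        (Module.finrank K L / (minpoly K x).natDegree) = θ (Algebra.norm K x) := by
    intro θ x
    rw [norm_eq_coeff_zero_minpoly, map_pow]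
  have hnsmul : ∀ (m : ℕ) (t : K), φ t ^ m = φ (m • t) := fun m t =>
    (AddChar.map_nsmul_eq_pow φ m t).symm
  have h1 : primePowSum (gaussPowWeight d (χ ^ d) φ) k =
      ∑ y : L, (χ ^ d) (Algebra.norm K y) * φ (Algebra.trace K L (y ^ d)) := by
    refine (congrArg (primePowSum _) hk'.symm).trans
      ((primePowSum_eq_sum_minpoly (L := L) _).trans ?_)
    refine sum_congr rfl fun x _ => ?_
    rw [gaussPowWeight, mul_pow, hpow, hnsmul, trace_pow_eq_rootPowerSum (by omega)]
  have h2 : ∀ θ : MulChar K ℂ, primePowSum (gaussWeight θ φ) k =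
      ∑ x : L, θ (Algebra.norm K x) * φ (Algebra.trace K L x) := by
    intro θ
    refine (congrArg (primePowSum _) hk'.symm).trans
      ((primePowSum_eq_sum_minpoly (L := L) _).trans ?_)
    refine sum_congr rfl fun x _ => ?_
    rw [gaussWeight, mul_pow, hpow, hnsmul, trace_eq_nextCoeff_minpoly]
  rw [h1, sum_pow_eq_sum_torsionChars hζ hd, mul_sum]
  refine sum_congr rfl fun η _ => ?_
  rw [← h2, primePowSum_gaussWeight _ hφ hk]

/-- The degree `d` coefficient is computed twice: Newton's recursion gives the product, splitting
off the constant term gives the right-hand side, with `c` free of `χ`. -/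
lemma exists_prod_gaussSum_eq_mul {d : ℕ} {ζ : K} (hζ : IsPrimitiveRoot ζ d) (hd : d ≠ 0)
    {φ : AddChar K ℂ} (hφ : φ ≠ 1) :
    ∃ c : ℂ, ∀ χ : MulChar K ℂ, ∏ η ∈ torsionChars K d, gaussSum (χ * η) φ =
      c * gaussSum (χ ^ d) (φ.mulShift d) := by
  classical
  obtain ⟨n, rfl⟩ : ∃ n, d = n + 1 := ⟨d - 1, by omega⟩
  refine ⟨∑ g ∈ monicsOfDegree K n, φ (rootPowerSum (n + 1) g), fun χ => ?_⟩
  rw [← monicSum_gaussPowWeight]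
  have hw := isMonicMul_gaussPowWeight (n + 1) (χ ^ (n + 1)) φ
  have hcard : Fintype.card (torsionChars K (n + 1)) = n + 1 := by
    rw [Fintype.card_coe, card_torsionChars hζ hd]
  have := eq_prod_of_newton_recursion
    (fun η : torsionChars K (n + 1) => gaussSum (χ * (η : MulChar K ℂ)) φ)
    (monicSum (gaussPowWeight (n + 1) (χ ^ (n + 1)) φ)) (monicSum_zero hw) ?_
  · rw [hcard] at this
    rw [this, ← prod_coe_sort]
  · intro m _
    rw [hw.mul_monicSum]
    refine sum_congr rfl fun k hk => ?_
    rw [primePowSum_gaussPowWeight hζ hd χ hφ (mem_Icc.mp hk).1, ← sum_coe_sort]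

/-- The Hasse–Davenport product formula. -/
theorem prod_gaussSum_mul_torsionChars [DecidableEq (MulChar K ℂ)] {d : ℕ} {ζ : K}
    (hζ : IsPrimitiveRoot ζ d) (hd : (d : K) ≠ 0) {φ : AddChar K ℂ} (hφ : φ ≠ 1)
    (χ : MulChar K ℂ) :
    ∏ η ∈ torsionChars K d, gaussSum (χ * η) φ =
      (∏ η ∈ (torsionChars K d).erase 1, gaussSum η φ) *
        gaussSum (χ ^ d) (φ.mulShift d) := by
  have hd0 : d ≠ 0 := by rintro rfl; simp at hd
  obtain ⟨c, hc⟩ := exists_prod_gaussSum_eq_mul hζ hd0 hφ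
  have h1 := hc 1
  have hφd : φ.mulShift (d : K) ≠ 1 := by
    intro h
    apply hφ
    ext x
    have := DFunLike.congr_fun h ((d : K)⁻¹ * x)
    rwa [AddChar.mulShift_apply, mul_inv_cancel_left₀ hd, AddChar.one_apply] at this
  -- At `χ = 1` each side contains one Gauss sum of the trivial character, equal to `-1`; cancelling
  -- determines `c`.
  rw [one_pow, gaussSum_one_left hφd] at h1
  simp only [one_mul] at h1
  have hmem : (1 : MulChar K ℂ) ∈ torsionChars K d := mem_torsionChars.mpr (one_pow d)
  rw [← mul_prod_erase _ _ hmem, gaussSum_one_left hφ] at h1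
  have : c = ∏ η ∈ (torsionChars K d).erase 1, gaussSum η φ := by linear_combination h1
  rw [hc, this]

end HasseDavenport

/-! ### Pairing the factors of a product -/

section Pairing

open Finset

lemma prod_range_two_mul {M : Type*} [CommMonoid M] (F : ℕ → M) (m : ℕ) :
    ∏ i ∈ range (2 * m), F i = ∏ i ∈ range m, F i * F (2 * m - 1 - i) := by
  rw [two_mul, prod_range_add, prod_mul_distrib, ← prod_range_reflect (fun i => F (m + i))]
  congr 1
  refine prod_congr rfl fun i hi => ?_
  rw [mem_range] at hi
  congr 1; omega

lemma prod_range_two_mul_add_one {M : Type*} [CommMonoid M] (F : ℕ → M) (m : ℕ) :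
    ∏ i ∈ range (2 * m + 1), F i = F m * ∏ i ∈ range m, F i * F (2 * m - i) := by
  rw [show 2 * m + 1 = (m + 1) + m by ring, prod_range_add, prod_range_succ, prod_mul_distrib,
    ← prod_range_reflect (fun i => F (m + 1 + i))]
  have : ∏ i ∈ range m, F (m + 1 + (m - 1 - i)) = ∏ i ∈ range m, F (2 * m - i) := by
    refine prod_congr rfl fun i hi => ?_
    rw [mem_range] at hi
    congr 1; omega
  rw [this, mul_comm (∏ i ∈ range m, F i), mul_assoc]

/-- Both sides are the value at `1` of `1 + X + ⋯ + X ^ (d - 1)`. -/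
lemma IsPrimitiveRoot.prod_one_sub_pow {K : Type*} [Field K] {d : ℕ} {ζ : K}
    (hζ : IsPrimitiveRoot ζ d) (hd : 0 < d) :
    ∏ i ∈ range (d - 1), (1 - ζ ^ (i + 1)) = d := by
  have h1 := X_pow_sub_C_eq_prod hζ hd (a := 1) (α := 1) (one_pow d)
  rw [map_one] at h1
  obtain ⟨n, rfl⟩ : ∃ n, d = n + 1 := ⟨d - 1, by omega⟩
  rw [prod_range_succ'] at h1
  have h2 := mul_geom_sum (Polynomial.X : Polynomial K) (n + 1)
  have h3 : (Polynomial.X - 1 : Polynomial K) ≠ 0 := by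
    simpa using Polynomial.X_sub_C_ne_zero (1 : K)
  have h4 : ∑ i ∈ range (n + 1), (Polynomial.X : Polynomial K) ^ i =
      ∏ i ∈ range n, (Polynomial.X - Polynomial.C (ζ ^ (i + 1))) := by
    apply mul_left_cancel₀ h3
    rw [h2, h1]
    simp [mul_comm]
  have h5 := congrArg (Polynomial.eval 1) h4
  rw [Polynomial.eval_finsetSum, Polynomial.eval_prod] at h5
  simp at h5
  simp [h5]

end Pairing

/-! ### The quadratic character and products of torsion Gauss sums -/

section QuadraticCharacter

open Finset

variable {K : Type*} [Field K] [Fintype K] [DecidableEq K]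

/-- The quadratic character of a finite field with complex values. -/
noncomputable def quadraticCharC (K : Type*) [Field K] [Fintype K] [DecidableEq K] :
    MulChar K ℂ :=
  (quadraticChar K).ringHomComp (Int.castRingHom ℂ)

lemma quadraticCharC_apply (x : K) : quadraticCharC K x = ((quadraticChar K x : ℤ) : ℂ) := rfl

lemma quadraticCharC_isQuadratic : (quadraticCharC K).IsQuadratic :=
  MulChar.IsQuadratic.comp (quadraticChar_isQuadratic K) _

lemma quadraticCharC_ne_one (h2 : ringChar K ≠ 2) : quadraticCharC K ≠ 1 := by
  obtain ⟨a, ha⟩ := quadraticChar_exists_neg_one' h2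
  intro h
  have := DFunLike.congr_fun h (a : K)
  rw [quadraticCharC_apply, ha, MulChar.one_apply a.isUnit] at this
  norm_num at this

lemma quadraticCharC_sq {x : K} (hx : x ≠ 0) : quadraticCharC K x ^ 2 = 1 := by
  rw [quadraticCharC_apply]
  exact_mod_cast quadraticChar_sq_one hx

lemma quadraticCharC_mul_self {x : K} (hx : x ≠ 0) :
    quadraticCharC K x * quadraticCharC K x = 1 := by
  rw [← sq, quadraticCharC_sq hx]

lemma torsionChars_two (h2 : ringChar K ≠ 2) {η : MulChar K ℂ} (hη : η ^ 2 = 1) (h1 : η ≠ 1) :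
    η = quadraticCharC K := by
  classical
  have hζ : IsPrimitiveRoot (-1 : K) 2 := IsPrimitiveRoot.neg_one _ h2
  have hc := card_torsionChars hζ two_ne_zero
  have hq : quadraticCharC K ∈ torsionChars K 2 :=
    mem_torsionChars.mpr quadraticCharC_isQuadratic.sq_eq_one
  have hone : (1 : MulChar K ℂ) ∈ torsionChars K 2 := mem_torsionChars.mpr (one_pow 2)
  by_contra hne
  have hsub : ({1, quadraticCharC K, η} : Finset (MulChar K ℂ)) ⊆ torsionChars K 2 := by
    intro x hx
    simp only [mem_insert, mem_singleton] at hx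
    rcases hx with rfl | rfl | rfl
    · exact hone
    · exact hq
    · exact mem_torsionChars.mpr hη
  have := card_le_card hsub
  rw [hc, card_insert_of_notMem, card_insert_of_notMem] at this
  · simp at this
  · simpa using fun h => hne h.symm
  · simp only [mem_insert, mem_singleton, not_or]
    exact ⟨(quadraticCharC_ne_one h2).symm, h1.symm⟩

/-- An element `y` has `1 + η_K(y)` square roots, and the contribution of the `1` vanishes. -/
lemma sum_addChar_mul_sq (h2 : ringChar K ≠ 2) {φ : AddChar K ℂ} (hφ : φ ≠ 1) {a : K}
    (ha : a ≠ 0) :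
    ∑ x : K, φ (a * x ^ 2) = quadraticCharC K a * gaussSum (quadraticCharC K) φ := by
  have hs : ∑ x : K, φ (a * x ^ 2) = ∑ y : K, φ (a * y) * (quadraticCharC K y + 1) := by
    rw [← sum_fiberwise (s := univ) (g := fun x : K => x ^ 2)]
    refine sum_congr rfl fun y _ => ?_
    rw [sum_congr rfl (g := fun _ => φ (a * y)), sum_const, nsmul_eq_mul, mul_comm]
    · congr 1
      have := quadraticChar_card_sqrts h2 y
      rw [quadraticCharC_apply]
      have h3 : ({x : K | x ^ 2 = y} : Set K).toFinset = univ.filter fun x : K => x ^ 2 = y := by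
        ext; simp
      rw [h3] at this
      exact_mod_cast this
    · intro x hx
      rw [(mem_filter.mp hx).2]
  have hz : ∑ y : K, φ (a * y) = 0 := by
    have : ∑ y : K, φ y = 0 := AddChar.sum_eq_zero_of_ne_one hφ
    rw [← this]
    exact Fintype.sum_equiv (Equiv.mulLeft₀ a ha) _ _ fun _ => rfl
  simp only [mul_add, mul_one, sum_add_distrib, hz, add_zero] at hs
  rw [hs, gaussSum, mul_sum]
  refine Fintype.sum_equiv (Equiv.mulLeft₀ a ha) _ _ fun y => ?_
  simp only [Equiv.mulLeft₀_apply, map_mul]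
  have := quadraticCharC_mul_self ha
  linear_combination (-(quadraticCharC K y * φ (a * y))) * this

lemma gaussSum_quadraticCharC_sq (h2 : ringChar K ≠ 2) {φ : AddChar K ℂ} (hφ : φ ≠ 1) :
    gaussSum (quadraticCharC K) φ ^ 2 = quadraticCharC K (-1) * Fintype.card K :=
  gaussSum_sq (quadraticCharC_ne_one h2) quadraticCharC_isQuadratic
    (AddChar.IsPrimitive.of_ne_one hφ)

omit [DecidableEq K] in
lemma gaussSum_mul_gaussSum_inv {φ : AddChar K ℂ} (hφ : φ ≠ 1) {η : MulChar K ℂ} (hη : η ≠ 1) :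
    gaussSum η φ * gaussSum η⁻¹ φ = η (-1) * Fintype.card K := by
  rw [← mul_gaussSum_inv_eq_gaussSum η⁻¹, mul_left_comm,
    gaussSum_mul_gaussSum_eq_card hη (AddChar.IsPrimitive.of_ne_one hφ), MulChar.inv_apply',
    inv_neg_one]

/-! ### Enumerating the torsion characters -/

omit [DecidableEq K] in
lemma exists_orderOf_torsionChars {d : ℕ} {ζ : K} (hζ : IsPrimitiveRoot ζ d) (hd : d ≠ 0) :
    ∃ θ : MulChar K ℂ, orderOf θ = d :=
  MulChar.exists_mulChar_orderOf K (hζ.dvd_card_sub_one hd) (Complex.isPrimitiveRoot_exp d hd)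

omit [DecidableEq K] in
lemma torsionChars_erase_eq_image [DecidableEq (MulChar K ℂ)] {d : ℕ} {ζ : K}
    (hζ : IsPrimitiveRoot ζ d) (hd : d ≠ 0) {θ : MulChar K ℂ} (hθ : orderOf θ = d) :
    Set.InjOn (fun i => θ ^ (i + 1)) (range (d - 1) : Set ℕ) ∧
      (torsionChars K d).erase 1 = (range (d - 1)).image fun i => θ ^ (i + 1) := by
  have hinj : Set.InjOn (fun i => θ ^ (i + 1)) (range (d - 1) : Set ℕ) := by
    intro i hi j hj hij
    simp only [coe_range, Set.mem_Iio] at hi hj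
    have := pow_injOn_Iio_orderOf (x := θ) (show i + 1 ∈ Set.Iio (orderOf θ) by
      rw [hθ, Set.mem_Iio]; omega) (show j + 1 ∈ Set.Iio (orderOf θ) by
      rw [hθ, Set.mem_Iio]; omega) hij
    omega
  refine ⟨hinj, ?_⟩
  symm
  apply eq_of_subset_of_card_le
  · intro η hη
    obtain ⟨i, hi, rfl⟩ := mem_image.mp hη
    rw [mem_range] at hi
    refine mem_erase.mpr ⟨?_, mem_torsionChars.mpr ?_⟩
    · exact pow_ne_one_of_lt_orderOf (Nat.succ_ne_zero i) (by omega)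
    · rw [← pow_mul, mul_comm, pow_mul, ← hθ, pow_orderOf_eq_one, one_pow]
  · rw [card_image_of_injOn hinj, card_range,
      card_erase_of_mem (mem_torsionChars.mpr (one_pow d)), card_torsionChars hζ hd]

lemma pow_eq_inv_pow_of_add_eq {G : Type*} [Group G] {θ : G} {a b : ℕ}
    (h : θ ^ (a + b) = 1) : θ ^ b = (θ ^ a)⁻¹ := by
  rw [pow_add] at h
  exact eq_inv_of_mul_eq_one_right h

omit [DecidableEq K] in
lemma prod_torsionChars_odd [DecidableEq (MulChar K ℂ)] {m : ℕ} {ζ : K}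
    (hζ : IsPrimitiveRoot ζ (2 * m + 1)) {θ : MulChar K ℂ} (hθ : orderOf θ = 2 * m + 1)
    (f : MulChar K ℂ → ℂ) :
    ∏ η ∈ (torsionChars K (2 * m + 1)).erase 1, f η =
      ∏ i ∈ range m, f (θ ^ (i + 1)) * f (θ ^ (i + 1))⁻¹ := by
  obtain ⟨h1, h2⟩ := torsionChars_erase_eq_image hζ (by omega) hθ
  rw [h2, prod_image h1, Nat.add_sub_cancel, prod_range_two_mul]
  refine prod_congr rfl fun i hi => ?_
  rw [mem_range] at hi
  rw [pow_eq_inv_pow_of_add_eq (a := i + 1) (b := 2 * m - 1 - i + 1)]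
  rw [show i + 1 + (2 * m - 1 - i + 1) = 2 * m + 1 by omega, ← hθ, pow_orderOf_eq_one]

/-- The exponents `i` and `d - i` give inverse characters; the unpaired middle exponent gives the
only character of order two. -/
lemma prod_torsionChars_even [DecidableEq (MulChar K ℂ)] (hK : ringChar K ≠ 2) {m : ℕ} {ζ : K}
    (hζ : IsPrimitiveRoot ζ (2 * m + 2)) {θ : MulChar K ℂ} (hθ : orderOf θ = 2 * m + 2)
    (f : MulChar K ℂ → ℂ) :
    ∏ η ∈ (torsionChars K (2 * m + 2)).erase 1, f η =
      f (quadraticCharC K) * ∏ i ∈ range m, f (θ ^ (i + 1)) * f (θ ^ (i + 1))⁻¹ := by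
  obtain ⟨h1, h2⟩ := torsionChars_erase_eq_image hζ (by omega) hθ
  have h3 : θ ^ (m + 1) = quadraticCharC K := by
    refine torsionChars_two hK ?_ (pow_ne_one_of_lt_orderOf (Nat.succ_ne_zero m) (by omega))
    rw [← pow_mul, show (m + 1) * 2 = 2 * m + 2 by ring, ← hθ, pow_orderOf_eq_one]
  rw [h2, prod_image h1, show 2 * m + 2 - 1 = 2 * m + 1 by omega, prod_range_two_mul_add_one, h3]
  congr 1
  refine prod_congr rfl fun i hi => ?_
  rw [mem_range] at hi
  rw [pow_eq_inv_pow_of_add_eq (a := i + 1) (b := 2 * m - i + 1)]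
  rw [show i + 1 + (2 * m - i + 1) = 2 * m + 2 by omega, ← hθ, pow_orderOf_eq_one]

omit [DecidableEq K] in
lemma prod_torsionChars_apply_of_odd {d : ℕ} (hodd : Odd d) {ζ : K} (hζ : IsPrimitiveRoot ζ d)
    {c : K} (hc : c ≠ 0) : ∏ η ∈ torsionChars K d, η c = 1 := by
  classical
  obtain ⟨m, rfl⟩ := hodd
  obtain ⟨θ, hθ⟩ := exists_orderOf_torsionChars hζ (by omega)
  rw [← mul_prod_erase _ _ (mem_torsionChars.mpr (one_pow _) : (1 : MulChar K ℂ) ∈ _),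
    prod_torsionChars_odd hζ hθ fun η => η c, MulChar.one_apply hc.isUnit, one_mul]
  refine prod_eq_one fun i _ => ?_
  rw [← MulChar.mul_apply, mul_inv_cancel, MulChar.one_apply hc.isUnit]

lemma prod_torsionChars_apply_of_even (hK : ringChar K ≠ 2) {d : ℕ} (heven : Even d) (hd : d ≠ 0)
    {ζ : K} (hζ : IsPrimitiveRoot ζ d) {c : K} (hc : c ≠ 0) :
    ∏ η ∈ torsionChars K d, η c = quadraticCharC K c := by
  classical
  obtain ⟨m, rfl⟩ : ∃ m, d = 2 * m + 2 := by
    obtain ⟨n, rfl⟩ := heven; exact ⟨n - 1, by omega⟩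
  obtain ⟨θ, hθ⟩ := exists_orderOf_torsionChars hζ (by omega)
  rw [← mul_prod_erase _ _ (mem_torsionChars.mpr (one_pow _) : (1 : MulChar K ℂ) ∈ _),
    prod_torsionChars_even hK hζ hθ fun η => η c, MulChar.one_apply hc.isUnit, one_mul,
    prod_eq_one, mul_one]
  intro i _
  rw [← MulChar.mul_apply, mul_inv_cancel, MulChar.one_apply hc.isUnit]

/-! ### The quadratic character at the order of a root of unity -/

omit [Fintype K] [DecidableEq K] in
lemma one_sub_mul_one_sub_of_mul_eq_one {a b : K} (h : a * b = 1) :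
    (1 - a) * (1 - b) = -1 * b * (1 - a) ^ 2 := by
  linear_combination (1 - 2 + a) * h

lemma quadraticCharC_one_sub_pow_mul {d : ℕ} {ζ : K} (hζ : IsPrimitiveRoot ζ d) {a b : ℕ}
    (ha : a ≠ 0) (had : a < d) (hab : a + b = d) :
    quadraticCharC K ((1 - ζ ^ a) * (1 - ζ ^ b)) =
      quadraticCharC K (-1) * quadraticCharC K (ζ ^ a) := by
  have h1 : ζ ^ a * ζ ^ b = 1 := by rw [← pow_add, hab, hζ.pow_eq_one]
  have h2 : (1 - ζ ^ a) ≠ 0 := sub_ne_zero.mpr (hζ.pow_ne_one_of_pos_of_lt ha had).symm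
  have h3 : quadraticCharC K (ζ ^ a) * quadraticCharC K (ζ ^ b) = 1 := by
    rw [← map_mul, h1, map_one]
  have h4 : quadraticCharC K (ζ ^ a) ^ 2 = 1 := by
    refine quadraticCharC_sq (left_ne_zero_of_mul_eq_one h1)
  rw [one_sub_mul_one_sub_of_mul_eq_one h1, map_mul, map_mul, map_pow _ (1 - ζ ^ a),
    quadraticCharC_sq h2]
  linear_combination (quadraticCharC K (-1) * quadraticCharC K (ζ ^ a)) * h3 -
    quadraticCharC K (-1) * quadraticCharC K (ζ ^ b) * h4

/-- In `d = ∏ (1 - ζ ^ i)` the factors for `i` and `d - i` multiply to `-ζ ^ (-i)` times a square,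
and `ζ`, having odd order, is itself a square. -/
lemma quadraticCharC_natCast_of_odd {m : ℕ} {ζ : K} (hζ : IsPrimitiveRoot ζ (2 * m + 1)) :
    quadraticCharC K ((2 * m + 1 : ℕ) : K) = quadraticCharC K (-1) ^ m := by
  have h1 := hζ.prod_one_sub_pow (by omega)
  rw [Nat.add_sub_cancel, prod_range_two_mul] at h1
  have hζ0 : ζ ≠ 0 := hζ.ne_zero (by omega)
  have h2 : quadraticCharC K ζ = 1 := by
    have : ζ = (ζ ^ (m + 1)) ^ 2 := by
      rw [← pow_mul, show (m + 1) * 2 = (2 * m + 1) + 1 by ring, pow_succ, hζ.pow_eq_one, one_mul]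
    rw [this, map_pow, quadraticCharC_sq (pow_ne_zero _ hζ0)]
  rw [← h1, map_prod, prod_congr rfl (g := fun _ => quadraticCharC K (-1)), prod_const, card_range]
  intro i hi
  rw [mem_range] at hi
  rw [quadraticCharC_one_sub_pow_mul hζ (by omega) (by omega) (by omega), map_pow, h2, one_pow,
    mul_one]

omit [Fintype K] [DecidableEq K] in
lemma IsPrimitiveRoot.pow_half_eq_neg_one {m : ℕ} {ζ : K} (hζ : IsPrimitiveRoot ζ (2 * m + 2)) :
    ζ ^ (m + 1) = -1 := by
  have h := hζ.pow_eq_one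
  rw [show 2 * m + 2 = (m + 1) * 2 by ring, pow_mul] at h
  exact (sq_eq_one_iff.mp h).resolve_left
    (hζ.pow_ne_one_of_pos_of_lt (by omega) (by omega))

/-- Both sides are `(-1) ^ N` with `N = (q - 1) / d`: the left by Euler's criterion and `ζ ^ (d/2) =
-1`, the right because `-1` is a `d`-th power exactly when `N` is even. -/
lemma quadraticCharC_eq_apply_neg_one (hK : ringChar K ≠ 2) {m : ℕ} {ζ : K}
    (hζ : IsPrimitiveRoot ζ (2 * m + 2)) {θ : MulChar K ℂ} (hθ : orderOf θ = 2 * m + 2) :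
    quadraticCharC K ζ = θ (-1) := by
  classical
  have hd : 2 * m + 2 ≠ 0 := by omega
  have hζ0 : ζ ≠ 0 := hζ.ne_zero hd
  obtain ⟨N, hN⟩ := hζ.dvd_card_sub_one hd
  have hcard : Fintype.card K / 2 = (m + 1) * N := by
    have h1 : Fintype.card K = 2 * ((m + 1) * N) + 1 := by
      have := Fintype.one_lt_card (α := K)
      have e : 2 * ((m + 1) * N) = (2 * m + 2) * N := by ring
      omega
    omega
  have hneg : ζ ^ (m + 1) = -1 := hζ.pow_half_eq_neg_one
  have hq : ((quadraticChar K ζ : ℤ) : K) = (-1) ^ N := by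
    rw [quadraticChar_eq_pow_of_char_ne_two' hK, hcard, pow_mul, hneg]
  have hm1 : (-1 : K) ≠ 1 := Ring.neg_one_ne_one_of_char_ne_two hK
  have hdiv : (Fintype.card K - 1) / (2 * m + 2) = N := by
    rw [hN, Nat.mul_div_cancel_left _ (by omega)]
  have hθd : θ ^ (2 * m + 2) = 1 := by rw [← hθ, pow_orderOf_eq_one]
  rw [quadraticCharC_apply]
  rcases Nat.even_or_odd N with he | ho
  · rw [he.neg_one_pow] at hq
    have h1 : quadraticChar K ζ = 1 := by
      rcases quadraticChar_dichotomy hζ0 with h | h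
      · exact h
      · rw [h] at hq; simp at hq; exact absurd hq hm1
    obtain ⟨y, hy⟩ := exists_pow_eq_of_pow_card_div_eq_one (hζ.dvd_card_sub_one hd)
      (z := -1) (by rw [hdiv, he.neg_one_pow])
    have hy0 : y ≠ 0 := by rintro rfl; rw [zero_pow hd] at hy; simp at hy
    rw [h1, ← hy, map_pow, ← MulChar.pow_apply' _ hd, hθd, MulChar.one_apply hy0.isUnit]
    simp
  · rw [ho.neg_one_pow] at hq
    have h1 : quadraticChar K ζ = -1 := by
      rcases quadraticChar_dichotomy hζ0 with h | h
      · rw [h] at hq; simp at hq; exact absurd hq.symm hm1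
      · exact h
    have hno : ¬ ∃ y : K, y ^ (2 * m + 2) = -1 := by
      rintro ⟨y, hy⟩
      have hy0 : y ≠ 0 := by rintro rfl; rw [zero_pow hd] at hy; simp at hy
      have := FiniteField.pow_card_sub_one_eq_one y hy0
      rw [hN, pow_mul, hy, ho.neg_one_pow] at this
      exact hm1 this
    have hsum := sum_torsionChars_apply hζ hd (z := -1) (by simp)
    rw [if_neg hno] at hsum
    have hsq : θ (-1) ^ 2 = 1 := by rw [← map_pow]; simp
    rcases sq_eq_one_iff.mp hsq with h | h
    -- If `θ(-1) = 1`, every torsion character is `1` at `-1`, against orthogonality at an element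
    -- that is not a `d`-th power.
    · exfalso
      rw [← add_sum_erase _ _ (mem_torsionChars.mpr (one_pow _) : (1 : MulChar K ℂ) ∈ _)] at hsum
      obtain ⟨h3, h4⟩ := torsionChars_erase_eq_image hζ hd hθ
      rw [h4, sum_image h3, sum_congr rfl (g := fun _ => (1 : ℂ))] at hsum
      · rw [MulChar.one_apply (by simp)] at hsum
        simp at hsum
        norm_cast at hsum
      · intro i _
        rw [MulChar.pow_apply' _ (Nat.succ_ne_zero i), h, one_pow]
    · rw [h1, h]; simp

/-- Apply `η_K` to `d = ∏ (1 - ζ ^ i)`. The middle factor is `2`, and each pair gives `η_K(ζ) ^ (m +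
1) θ ^ i (-1)`; the powers of `η_K(ζ)` have total exponent `m (m + 1)`, which is even. -/
lemma prod_apply_neg_one_eq_quadraticCharC (hK : ringChar K ≠ 2) {m : ℕ} {ζ : K}
    (hζ : IsPrimitiveRoot ζ (2 * m + 2)) {θ : MulChar K ℂ} (hθ : orderOf θ = 2 * m + 2) :
    ∏ i ∈ range m, (θ ^ (i + 1)) (-1) = quadraticCharC K ((2 * (2 * m + 2) : ℕ) : K) := by
  have h1 := hζ.prod_one_sub_pow (by omega)
  rw [show 2 * m + 2 - 1 = 2 * m + 1 by omega, prod_range_two_mul_add_one] at h1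
  have hneg : ζ ^ (m + 1) = -1 := hζ.pow_half_eq_neg_one
  have h20 : (2 : K) ≠ 0 := Ring.two_ne_zero hK
  have hs := quadraticCharC_eq_apply_neg_one hK hζ hθ
  have hζ0 : ζ ≠ 0 := hζ.ne_zero (by omega)
  rw [Nat.cast_mul, ← h1, hneg, map_mul, map_mul]
  have e2 : quadraticCharC K ((2 : ℕ) : K) * quadraticCharC K (1 - -1) = 1 := by
    rw [Nat.cast_ofNat, show (1 - -1 : K) = 2 by norm_num]
    exact quadraticCharC_mul_self h20
  rw [← mul_assoc, e2, one_mul, map_prod]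
  have hterm : ∀ i ∈ range m, quadraticCharC K ((1 - ζ ^ (i + 1)) * (1 - ζ ^ (2 * m - i + 1))) =
      quadraticCharC K ζ ^ (m + 1) * (θ ^ (i + 1)) (-1) := by
    intro i hi
    rw [mem_range] at hi
    rw [quadraticCharC_one_sub_pow_mul hζ (by omega) (by omega) (by omega), ← hneg, map_pow,
      map_pow, hs, MulChar.pow_apply' _ (Nat.succ_ne_zero i), hneg]
  rw [prod_congr rfl hterm, prod_mul_distrib, prod_const, card_range, ← pow_mul]
  obtain ⟨r, hr⟩ := Nat.even_mul_succ_self m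
  rw [mul_comm (m + 1) m, hr, ← two_mul, pow_mul, quadraticCharC_sq hζ0, one_pow, one_mul]

/-! ### Products of Gauss sums of torsion characters -/

omit [DecidableEq K] in
lemma prod_gaussSum_torsionChars_odd {m : ℕ} {ζ : K} [DecidableEq (MulChar K ℂ)]
    (hζ : IsPrimitiveRoot ζ (2 * m + 1)) {φ : AddChar K ℂ} (hφ : φ ≠ 1) :
    ∏ η ∈ (torsionChars K (2 * m + 1)).erase 1, gaussSum η φ = (Fintype.card K : ℂ) ^ m := by
  obtain ⟨θ, hθ⟩ := exists_orderOf_torsionChars hζ (by omega)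
  rw [prod_torsionChars_odd hζ hθ fun η => gaussSum η φ,
    prod_congr rfl (g := fun _ => (Fintype.card K : ℂ)), prod_const, card_range]
  intro i hi
  rw [mem_range] at hi
  rw [gaussSum_mul_gaussSum_inv hφ
    (pow_ne_one_of_lt_orderOf (Nat.succ_ne_zero i) (by omega))]
  have h1 : θ (-1) = 1 := by
    have h2 : θ (-1) ^ 2 = 1 := by rw [← map_pow]; simp
    have h3 : θ (-1) ^ (2 * m + 1) = 1 := by
      rw [← MulChar.pow_apply' _ (by omega), ← hθ, pow_orderOf_eq_one, MulChar.one_apply (by simp)]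
    rwa [pow_succ, pow_mul, h2, one_pow, one_mul] at h3
  rw [MulChar.pow_apply' _ (Nat.succ_ne_zero i), h1, one_pow, one_mul]

lemma prod_gaussSum_torsionChars_even (hK : ringChar K ≠ 2) {m : ℕ} {ζ : K}
    [DecidableEq (MulChar K ℂ)] (hζ : IsPrimitiveRoot ζ (2 * m + 2)) {φ : AddChar K ℂ}
    (hφ : φ ≠ 1) :
    ∏ η ∈ (torsionChars K (2 * m + 2)).erase 1, gaussSum η φ =
      quadraticCharC K ((2 * (2 * m + 2) : ℕ) : K) * gaussSum (quadraticCharC K) φ *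
        (Fintype.card K : ℂ) ^ m := by
  obtain ⟨θ, hθ⟩ := exists_orderOf_torsionChars hζ (by omega)
  rw [prod_torsionChars_even hK hζ hθ fun η => gaussSum η φ,
    prod_congr rfl (g := fun i => (θ ^ (i + 1)) (-1) * (Fintype.card K : ℂ)), prod_mul_distrib,
    prod_const, card_range, prod_apply_neg_one_eq_quadraticCharC hK hζ hθ]
  · ring
  · intro i hi
    rw [mem_range] at hi
    exact gaussSum_mul_gaussSum_inv hφ
      (pow_ne_one_of_lt_orderOf (Nat.succ_ne_zero i) (by omega))

lemma gaussSum_quadraticCharC_pow_odd (hK : ringChar K ≠ 2) {m : ℕ} {ζ : K}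
    (hζ : IsPrimitiveRoot ζ (2 * m + 1)) {φ : AddChar K ℂ} (hφ : φ ≠ 1) :
    gaussSum (quadraticCharC K) φ ^ (2 * m) =
      quadraticCharC K ((2 * m + 1 : ℕ) : K) * (Fintype.card K : ℂ) ^ m := by
  rw [pow_mul, gaussSum_quadraticCharC_sq hK hφ, mul_pow, quadraticCharC_natCast_of_odd hζ]

lemma gaussSum_quadraticCharC_pow_even (hK : ringChar K ≠ 2) {m : ℕ} {ζ : K}
    (hζ : IsPrimitiveRoot ζ (2 * m + 2)) {φ : AddChar K ℂ} (hφ : φ ≠ 1) :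
    gaussSum (quadraticCharC K) φ ^ (2 * m) = (Fintype.card K : ℂ) ^ m := by
  have hζ0 : ζ ≠ 0 := hζ.ne_zero (by omega)
  have hneg : ζ ^ (m + 1) = -1 := hζ.pow_half_eq_neg_one
  have h1 : quadraticCharC K (-1) ^ m = 1 := by
    obtain ⟨r, hr⟩ := Nat.even_mul_succ_self m
    rw [← hneg, map_pow, ← pow_mul, mul_comm (m + 1) m, hr, ← two_mul, pow_mul,
      quadraticCharC_sq hζ0, one_pow]
  rw [pow_mul, gaussSum_quadraticCharC_sq hK hφ, mul_pow, h1, one_mul]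

end QuadraticCharacter

/-! ### Stationary phase over truncated discrete valuation rings -/

/-- `S` behaves like the quotient of a discrete valuation ring with uniformizer `w` and residue
field `K` by the `m`-th power of its maximal ideal. -/
structure IsTruncatedDVR {S K : Type*} [CommRing S] [Field K] (π : S →+* K) (w : S) (m : ℕ) :
    Prop where
  surjective : Function.Surjective π
  map_eq_zero_iff : ∀ x, π x = 0 ↔ w ∣ x
  pow_mul_eq_zero_iff : ∀ i ≤ m, ∀ x, w ^ i * x = 0 ↔ w ^ (m - i) ∣ x

section AddCharacters

lemma AddChar.exists_eq_mulShift {S : Type*} [CommRing S] [Fintype S] {θ : AddChar S ℂ}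
    (hθ : θ.IsPrimitive) (α : AddChar S ℂ) : ∃ s : S, α = θ.mulShift s := by
  have hinj : Function.Injective θ.mulShift := AddChar.to_mulShift_inj_of_isPrimitive hθ
  have hbij := (Fintype.bijective_iff_injective_and_card θ.mulShift).mpr
    ⟨hinj, (AddChar.card_eq).symm⟩
  obtain ⟨s, hs⟩ := hbij.2 α
  exact ⟨s, hs.symm⟩

lemma AddChar.IsPrimitive.eq_zero {S : Type*} [CommRing S] {θ : AddChar S ℂ}
    (hθ : θ.IsPrimitive) {s : S} (h : ∀ y, θ (s * y) = 1) : s = 0 := by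
  by_contra hs
  refine hθ hs ?_
  ext y
  simpa using h y

end AddCharacters

namespace IsTruncatedDVR

open Finset

variable {S K : Type*} [CommRing S] [Field K] {π : S →+* K} {w : S} {m : ℕ}

lemma pow_eq_zero (hS : IsTruncatedDVR π w m) {i : ℕ} (hi : m ≤ i) : w ^ i = 0 := by
  have : w ^ m = 0 := by
    have := (hS.pow_mul_eq_zero_iff m le_rfl 1).mpr (by simp)
    simpa using this
  rw [← Nat.sub_add_cancel hi, pow_add, this, mul_zero]

lemma mul_eq_zero_of_dvd (hS : IsTruncatedDVR π w m) {i j : ℕ} (hij : m ≤ i + j) {x y : S}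
    (hx : w ^ i ∣ x) (hy : w ^ j ∣ y) : x * y = 0 := by
  obtain ⟨a, rfl⟩ := hx
  obtain ⟨b, rfl⟩ := hy
  linear_combination (a * b) * hS.pow_eq_zero hij + (a * b) * (pow_add w i j).symm

lemma isUnit_one_add (hS : IsTruncatedDVR π w m) {x : S} (hx : w ∣ x) : IsUnit (1 + x) := by
  obtain ⟨a, rfl⟩ := hx
  refine IsNilpotent.isUnit_one_add ⟨m, ?_⟩
  rw [mul_pow, hS.pow_eq_zero le_rfl, zero_mul]

lemma isUnit_iff (hS : IsTruncatedDVR π w m) {x : S} : IsUnit x ↔ π x ≠ 0 := by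
  constructor
  · intro h
    exact (h.map π).ne_zero
  · intro h
    obtain ⟨y, hy⟩ := hS.surjective (π x)⁻¹
    have h1 : w ∣ x * y - 1 := by
      rw [← hS.map_eq_zero_iff, map_sub, map_mul, hy, mul_inv_cancel₀ h, map_one, sub_self]
    have h2 := hS.isUnit_one_add h1
    rw [add_sub_cancel] at h2
    exact isUnit_of_mul_isUnit_left h2

variable [Fintype S]

open Classical in
/-- The elements of `S` divisible by `w ^ i`. -/
noncomputable def multiples {S : Type*} [CommRing S] [Fintype S] (w : S) (i : ℕ) : Finset S :=
  {x | w ^ i ∣ x}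

omit [Field K] in
lemma mem_multiples {i : ℕ} {x : S} : x ∈ multiples w i ↔ w ^ i ∣ x := by
  simp [multiples]

/-- Multiplication by `w ^ i` maps the multiples of `w ^ j` onto those of `w ^ (i + j)`; its fibres
are cosets of the annihilator of `w ^ i`, the multiples of `w ^ (m - i)`. -/
lemma sum_multiples_pow_mul (hS : IsTruncatedDVR π w m) {i j : ℕ} (hij : i + j ≤ m)
    (F : S → ℂ) :
    ∑ x ∈ multiples w j, F (w ^ i * x) =
      #(multiples w (m - i)) * ∑ b ∈ multiples w (i + j), F b := by
  classical
  rw [← sum_fiberwise_of_maps_to (t := multiples w (i + j)) (g := fun x => w ^ i * x), mul_sum]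
  · refine sum_congr rfl fun b hb => ?_
    rw [mem_multiples] at hb
    obtain ⟨a, rfl⟩ := hb
    rw [sum_congr rfl (g := fun _ => F (w ^ (i + j) * a)), sum_const, nsmul_eq_mul]
    · congr 2
      refine card_bij (fun x _ => x - w ^ j * a) ?_ ?_ ?_
      · intro x hx
        rw [mem_filter] at hx
        rw [mem_multiples, ← hS.pow_mul_eq_zero_iff i (by omega), mul_sub, hx.2]
        ring
      · intro x _ y _ h
        exact sub_left_inj.mp h
      · intro z hz
        rw [mem_multiples] at hz
        refine ⟨z + w ^ j * a, ?_, by ring⟩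
        rw [mem_filter, mem_multiples]
        refine ⟨dvd_add ((pow_dvd_pow w (by omega)).trans hz) (dvd_mul_right _ _), ?_⟩
        rw [mul_add, (hS.pow_mul_eq_zero_iff i (by omega) z).mpr hz]
        ring
    · intro x hx
      rw [(mem_filter.mp hx).2]
  · intro x hx
    rw [mem_multiples] at hx ⊢
    rw [pow_add]
    exact mul_dvd_mul_left _ hx

lemma sum_comp_residue [Fintype K] (hS : IsTruncatedDVR π w m) (F : K → ℂ) :
    ∑ x : S, F (π x) = #(multiples w 1) * ∑ y : K, F y := by
  classical
  rw [← sum_fiberwise (s := univ) (g := fun x => π x), mul_sum]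
  refine sum_congr rfl fun y _ => ?_
  obtain ⟨a, rfl⟩ := hS.surjective y
  rw [sum_congr rfl (g := fun _ => F (π a)), sum_const, nsmul_eq_mul]
  · congr 2
    refine card_bij (fun x _ => x - a) ?_ ?_ ?_
    · intro x hx
      rw [mem_multiples, pow_one, ← hS.map_eq_zero_iff, map_sub, (mem_filter.mp hx).2, sub_self]
    · intro x _ y _ h
      exact sub_left_inj.mp h
    · intro z hz
      rw [mem_multiples, pow_one, ← hS.map_eq_zero_iff] at hz
      exact ⟨z + a, by simp [hz], by ring⟩
  · intro x hx
    rw [(mem_filter.mp hx).2]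

lemma card_multiples [Fintype K] (hS : IsTruncatedDVR π w m) {i : ℕ} (hi : i ≤ m) :
    #(multiples w i) = Fintype.card K ^ (m - i) := by
  classical
  have hpos : ∀ j, (#(multiples w j) : ℂ) ≠ 0 := fun j => by
    have : 0 < #(multiples w j) := card_pos.mpr ⟨0, mem_multiples.mpr (dvd_zero _)⟩
    exact_mod_cast this.ne'
  have hmul : ∀ i j, i + j ≤ m →
      (#(multiples w j) : ℂ) = #(multiples w (m - i)) * #(multiples w (i + j)) := by
    intro i j hij
    have := hS.sum_multiples_pow_mul hij fun _ => 1
    simpa using this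
  have huniv : (multiples w 0 : Finset S) = univ := by
    ext; simp [mem_multiples]
  have hres : (#(multiples w 0) : ℂ) = #(multiples w 1) * Fintype.card K := by
    have := hS.sum_comp_residue fun _ => 1
    simpa [huniv] using this
  -- Comparing multiplication by `w ^ i` on `S` and on `wS` carries the index `q` of `wS` in `S` to
  -- every level.
  have hstep : ∀ i, i + 1 ≤ m → #(multiples w i) = #(multiples w (i + 1)) * Fintype.card K := by
    intro i hi
    have h1 := hmul i 0 (by omega)
    have h2 := hmul i 1 hi
    rw [hres, h2, add_zero, mul_assoc] at h1
    exact_mod_cast (mul_left_cancel₀ (hpos _) h1).symm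
  induction hj : m - i generalizing i with
  | zero =>
    have : i = m := by omega
    subst this
    rw [pow_zero, card_eq_one]
    refine ⟨0, ?_⟩
    ext x
    rw [mem_multiples, hS.pow_eq_zero le_rfl, zero_dvd_iff, mem_singleton]
  | succ j ih => rw [hstep i (by omega), ih (by omega) (by omega), pow_succ]

variable {θ : AddChar S ℂ} {h : S}

omit [Fintype S] in
-- With `h = 1/2` this is a truncated exponential, additive because terms of order three vanish. The
-- quadratic term is needed for odd `m`, where `k = ⌊m/2⌋` has `2k < m`.
lemma exp_mul_exp (hS : IsTruncatedDVR π w m) (hh : 2 * h = 1) {k : ℕ} (hk : m ≤ 3 * k) {a b : S}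
    (ha : w ^ k ∣ a) (hb : w ^ k ∣ b) :
    (1 + a + h * a ^ 2) * (1 + b + h * b ^ 2) = 1 + (a + b) + h * (a + b) ^ 2 := by
  have h1 : a ^ 2 * b = 0 := by
    refine hS.mul_eq_zero_of_dvd (i := k * 2) (j := k) (by omega) ?_ hb
    rw [pow_mul]; exact pow_dvd_pow_of_dvd ha 2
  have h2 : b ^ 2 * a = 0 := by
    refine hS.mul_eq_zero_of_dvd (i := k * 2) (j := k) (by omega) ?_ ha
    rw [pow_mul]; exact pow_dvd_pow_of_dvd hb 2
  linear_combination (h + h ^ 2 * b) * h1 + h * h2 - a * b * hh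

/-- The element representing `χ` near `1`. -/
lemma exists_isUnit_apply_exp_eq (hS : IsTruncatedDVR π w m) (hm : 2 ≤ m)
    (hθ : θ.IsPrimitive) (hh : 2 * h = 1) {χ : MulChar S ℂ}
    (hχ : ∃ z, χ (1 + w ^ (m - 1) * z) ≠ 1) :
    ∃ c : S, IsUnit c ∧ ∀ b, w ^ (m / 2) ∣ b → χ (1 + b + h * b ^ 2) = θ (-(c * b)) := by
  set k := m / 2
  let α : AddChar S ℂ :=
    { toFun := fun y => χ (1 + w ^ k * y + h * (w ^ k * y) ^ 2)
      map_zero_eq_one' := by simp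
      map_add_eq_mul' := fun x y => by
        rw [← map_mul, hS.exp_mul_exp hh (k := k) (by omega) (dvd_mul_right _ _)
          (dvd_mul_right _ _), mul_add] }
  have hα : ∀ y, α y = χ (1 + w ^ k * y + h * (w ^ k * y) ^ 2) := fun _ => rfl
  obtain ⟨s, hs⟩ := AddChar.exists_eq_mulShift hθ α
  have hs' : ∀ y, χ (1 + w ^ k * y + h * (w ^ k * y) ^ 2) = θ (s * y) := fun y => by
    rw [← hα, hs, AddChar.mulShift_apply]
  -- `α` depends only on `w ^ k * y`, so it is trivial on `w ^ (m - k) S`; primitivity then makes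
  -- `s` a multiple of `w ^ k`.
  have hs0 : w ^ (m - k) * s = 0 := by
    refine hθ.eq_zero fun y => ?_
    have h1 := hs' (w ^ (m - k) * y)
    have h2 : w ^ k * (w ^ (m - k) * y) = 0 :=
      (hS.pow_mul_eq_zero_iff k (by omega) _).mpr (dvd_mul_right _ _)
    rw [h2] at h1
    simp only [add_zero, ne_eq, OfNat.ofNat_ne_zero, not_false_eq_true, zero_pow, mul_zero,
      map_one] at h1
    rw [h1]
    congr 1; ring
  obtain ⟨c, hc⟩ := (hS.pow_mul_eq_zero_iff (m - k) (by omega) s).mp hs0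
  rw [show m - (m - k) = k by omega] at hc
  have key : ∀ b, w ^ k ∣ b → χ (1 + b + h * b ^ 2) = θ (-(-c * b)) := by
    rintro _ ⟨y, rfl⟩
    rw [hs', hc]
    congr 1; ring
  refine ⟨-c, ?_, key⟩
  -- Were the element divisible by `w`, `χ` would be trivial on `1 + w ^ (m - 1) S`.
  rw [hS.isUnit_iff]
  intro h0
  rw [hS.map_eq_zero_iff] at h0
  obtain ⟨z, hz⟩ := hχ
  apply hz
  have hd : w ^ (m - 1) ∣ w ^ (m - 1) * z := dvd_mul_right _ _
  have h1 := key (w ^ (m - 1) * z) ((pow_dvd_pow w (by omega)).trans hd)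
  have h2 : (w ^ (m - 1) * z) ^ 2 = 0 := by
    rw [sq]; exact hS.mul_eq_zero_of_dvd (by omega) hd hd
  have h3 : -c * (w ^ (m - 1) * z) = 0 :=
    hS.mul_eq_zero_of_dvd (i := 1) (by omega) (by rwa [pow_one]) hd
  rw [h2, h3] at h1
  simpa using h1

/-- Stationary phase for Gauss sums over a truncated discrete valuation ring. -/
theorem gaussSum_eq (hS : IsTruncatedDVR π w m) (hm : 2 ≤ m) (hθ : θ.IsPrimitive)
    {χ : MulChar S ℂ} {c : S} (hc : IsUnit c)
    (hχ : ∀ b, w ^ (m / 2) ∣ b → χ (1 + b + h * b ^ 2) = θ (-(c * b))) :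
    gaussSum χ θ = χ c * θ c * ∑ b ∈ multiples w (m / 2), θ (h * c * b ^ 2) := by
  classical
  set k := m / 2
  have hcard : (Fintype.card S : ℂ) ≠ 0 := by
    have : 0 < Fintype.card S := Fintype.card_pos
    exact_mod_cast this.ne'
  -- Substitute `a (1 + w ^ (m - k) y)` for `a`; the square of the increment vanishes, so `χ` of the
  -- new factor is a value of `θ`.
  have hshift : ∀ y : S, gaussSum χ θ =
      ∑ a : S, χ a * θ a * θ (y * ((a - c) * w ^ (m - k))) := by
    intro y
    have hd : w ^ (m - k) ∣ w ^ (m - k) * y := dvd_mul_right _ _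
    have h0 : (w ^ (m - k) * y) ^ 2 = 0 := by
      rw [sq]; exact hS.mul_eq_zero_of_dvd (by omega) hd hd
    have h1 := hχ (w ^ (m - k) * y) ((pow_dvd_pow w (by omega)).trans hd)
    rw [h0, mul_zero, add_zero] at h1
    have hu : IsUnit (1 + w ^ (m - k) * y) :=
      hS.isUnit_one_add ((dvd_pow_self w (by omega)).trans hd)
    rw [gaussSum, ← Equiv.sum_comp (Units.mulRight hu.unit)]
    refine sum_congr rfl fun a _ => ?_
    have e1 : θ (a * (1 + w ^ (m - k) * y)) * θ (-(c * (w ^ (m - k) * y))) =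
        θ a * θ (y * ((a - c) * w ^ (m - k))) := by
      rw [← AddChar.map_add_eq_mul, ← AddChar.map_add_eq_mul]
      congr 1; ring
    have e2 : Units.mulRight hu.unit a = a * (1 + w ^ (m - k) * y) := rfl
    rw [e2, map_mul, h1]
    linear_combination χ a * e1
  -- Averaging over `y`, orthogonality keeps only the `a` congruent to `c` modulo `w ^ k`.
  have hsum : (Fintype.card S : ℂ) * gaussSum χ θ =
      Fintype.card S * ∑ a : S with w ^ k ∣ a - c, χ a * θ a := by
    calc (Fintype.card S : ℂ) * gaussSum χ θ = ∑ _y : S, gaussSum χ θ := by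
          rw [sum_const, nsmul_eq_mul, card_univ]
      _ = ∑ a : S, χ a * θ a * ∑ y : S, θ (y * ((a - c) * w ^ (m - k))) := by
          rw [sum_congr rfl fun y _ => hshift y, sum_comm]
          exact sum_congr rfl fun a _ => by rw [mul_sum]
      _ = _ := by
          rw [mul_sum, sum_filter]
          refine sum_congr rfl fun a _ => ?_
          rw [AddChar.sum_mulShift _ hθ]
          have : (a - c) * w ^ (m - k) = 0 ↔ w ^ k ∣ a - c := by
            rw [mul_comm, hS.pow_mul_eq_zero_iff _ (by omega), show m - (m - k) = k by omega]
          simp only [this]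
          split_ifs <;> simp [mul_comm]
  rw [mul_left_cancel₀ hcard hsum, mul_sum]
  symm
  -- With the surviving `a` written as `c (1 + b + b²/2)`, the terms of the phase linear in `b`
  -- cancel.
  have hinj : Set.InjOn (fun b => c * (1 + b + h * b ^ 2)) (multiples w k : Set S) := by
    intro a ha b hb hab
    rw [mem_coe, mem_multiples] at ha hb
    have h1 := hc.mul_left_cancel hab
    have hk : w ∣ w ^ k := dvd_pow_self w (by omega)
    have h2 : IsUnit (1 + h * (a + b)) :=
      hS.isUnit_one_add (dvd_mul_of_dvd_right (dvd_add (hk.trans ha) (hk.trans hb)) h)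
    have h3 : (1 + h * (a + b)) * (a - b) = 0 := by linear_combination h1
    exact sub_eq_zero.mp ((h2.mul_right_eq_zero).mp h3)
  have himg : (multiples w k).image (fun b => c * (1 + b + h * b ^ 2)) =
      univ.filter fun a => w ^ k ∣ a - c := by
    apply eq_of_subset_of_card_le
    · intro x hx
      obtain ⟨b, hb, rfl⟩ := mem_image.mp hx
      rw [mem_multiples] at hb
      refine mem_filter.mpr ⟨mem_univ _, ?_⟩
      rw [show c * (1 + b + h * b ^ 2) - c = b * (c * (1 + h * b)) by ring]
      exact dvd_mul_of_dvd_left hb _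
    · rw [card_image_of_injOn hinj]
      refine card_le_card_of_injOn (fun a => a - c) ?_ ?_
      · intro a ha
        simp only [coe_filter, mem_univ, true_and, Set.mem_ofPred_eq] at ha
        exact mem_multiples.mpr ha
      · intro a _ b _ hab
        exact sub_left_inj.mp hab
  rw [← himg, sum_image hinj]
  refine sum_congr rfl fun b hb => ?_
  rw [mem_multiples] at hb
  have e1 : θ (-(c * b)) * θ (c * (1 + b + h * b ^ 2)) = θ c * θ (h * c * b ^ 2) := by
    rw [← AddChar.map_add_eq_mul, ← AddChar.map_add_eq_mul]
    congr 1; ring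
  rw [map_mul χ, hχ b hb]
  linear_combination -χ c * e1

lemma sum_multiples_sq_of_even (hS : IsTruncatedDVR π w m) [Fintype K] {k : ℕ} (hk : m = 2 * k)
    (c : S) : ∑ b ∈ multiples w k, θ (c * b ^ 2) = (Fintype.card K : ℂ) ^ k := by
  rw [sum_congr rfl (g := fun _ => (1 : ℂ)), sum_const, hS.card_multiples (by omega),
    show m - k = k by omega]
  · simp
  · intro b hb
    rw [mem_multiples] at hb
    rw [sq, hS.mul_eq_zero_of_dvd (by omega) hb hb, mul_zero, AddChar.map_zero_eq_one]

/-- For `b = w ^ k x` the phase is `w ^ (m - 1) c x²`, which depends only on the residue of `x`; a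
quadratic Gauss sum over `K` results. -/
lemma sum_multiples_sq_of_odd (hS : IsTruncatedDVR π w m) [Fintype K] [DecidableEq K]
    (hK : ringChar K ≠ 2) {k : ℕ} (hk : m = 2 * k + 1) {φ : AddChar K ℂ} (hφ1 : φ ≠ 1)
    (hφ : ∀ x, φ (π x) = θ (w ^ (m - 1) * x)) {c : S} (hc : IsUnit c) :
    ∑ b ∈ multiples w k, θ (c * b ^ 2) =
      (Fintype.card K : ℂ) ^ k * (quadraticCharC K (π c) * gaussSum (quadraticCharC K) φ) := by
  have hq : (Fintype.card K : ℂ) ≠ 0 := by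
    have : 0 < Fintype.card K := Fintype.card_pos
    exact_mod_cast this.ne'
  have h1 := hS.sum_multiples_pow_mul (i := k) (j := 0) (by omega) fun b => θ (c * b ^ 2)
  have huniv : (multiples w 0 : Finset S) = univ := by
    ext; simp [mem_multiples]
  rw [huniv, add_zero, hS.card_multiples (by omega), show m - (m - k) = k by omega] at h1
  have h2 : ∑ x : S, θ (c * (w ^ k * x) ^ 2) = ∑ x : S, φ (π c * π x ^ 2) := by
    refine sum_congr rfl fun x _ => ?_
    rw [← map_pow, ← map_mul, hφ, show m - 1 = k * 2 by omega]
    congr 1; ring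
  rw [h2, hS.sum_comp_residue fun y => φ (π c * y ^ 2), hS.card_multiples (by omega),
    sum_addChar_mul_sq hK hφ1 (hS.isUnit_iff.mp hc), show m - 1 = k + k by omega] at h1
  push_cast at h1
  apply mul_left_cancel₀ (pow_ne_zero k hq)
  rw [← h1, pow_add, mul_assoc]

end IsTruncatedDVR

/-! ### The product formula over a truncated discrete valuation ring -/

/-- The pull-back of a multiplicative character along a ring homomorphism, extended by zero from
the units. -/
noncomputable def MulChar.pullback {S K : Type*} [CommRing S] [CommRing K] (π : S →+* K)
    (η : MulChar K ℂ) : MulChar S ℂ :=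
  MulChar.ofUnitHom (η.toUnitHom.comp (Units.map (π : S →* K)))

lemma MulChar.pullback_apply {S K : Type*} [CommRing S] [CommRing K] (π : S →+* K)
    (η : MulChar K ℂ) {x : S} (hx : IsUnit x) : MulChar.pullback π η x = η (π x) := by
  obtain ⟨u, rfl⟩ := hx
  simp [MulChar.pullback]

namespace IsTruncatedDVR

open Finset

variable {S K : Type*} [CommRing S] [Fintype S] [Field K] [Fintype K] {π : S →+* K} {w : S}
  {m : ℕ} {θ : AddChar S ℂ} {h : S}

omit [Fintype K] in
-- The pull-back of `η` is trivial on `1 + wS`, so the twist has the same stationary point and only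
-- the value at `c` changes.
lemma gaussSum_mul_pullback (hS : IsTruncatedDVR π w m) (hm : 2 ≤ m) (hθ : θ.IsPrimitive)
    {χ : MulChar S ℂ} {c : S} (hc : IsUnit c)
    (hχ : ∀ b, w ^ (m / 2) ∣ b → χ (1 + b + h * b ^ 2) = θ (-(c * b))) (η : MulChar K ℂ) :
    gaussSum (χ * MulChar.pullback π η) θ =
      η (π c) * (χ c * θ c * ∑ b ∈ multiples w (m / 2), θ (h * c * b ^ 2)) := by
  rw [hS.gaussSum_eq (h := h) hm hθ hc, MulChar.mul_apply, MulChar.pullback_apply π η hc]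
  · ring
  · intro b hb
    have hwb : w ∣ b := (dvd_pow_self w (by omega)).trans hb
    have hwb2 : w ∣ b + h * b ^ 2 :=
      dvd_add hwb (dvd_mul_of_dvd_right (dvd_pow hwb two_ne_zero) h)
    have hu := hS.isUnit_one_add hwb2
    rw [← add_assoc] at hu
    rw [MulChar.mul_apply, hχ b hb, MulChar.pullback_apply π η hu]
    have : π (1 + b + h * b ^ 2) = 1 := by
      rw [add_assoc, map_add, (hS.map_eq_zero_iff _).mpr hwb2, map_one, add_zero]
    rw [this, map_one, mul_one]

omit [Fintype K] in
-- Raising the relation that characterizes `c` to the `d`-th power shows that `χ ^ d` has the same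
-- `c` relative to `θ_d`.
lemma gaussSum_pow (hS : IsTruncatedDVR π w m) (hm : 2 ≤ m) (hθ : θ.IsPrimitive)
    {χ : MulChar S ℂ} {c : S} (hc : IsUnit c)
    (hχ : ∀ b, w ^ (m / 2) ∣ b → χ (1 + b + h * b ^ 2) = θ (-(c * b))) {d : ℕ}
    (hd : (d : K) ≠ 0) :
    gaussSum (χ ^ d) (θ.mulShift d) =
      (χ c * θ c) ^ d * ∑ b ∈ multiples w (m / 2), θ (d * (h * c) * b ^ 2) := by
  have hd0 : d ≠ 0 := by rintro rfl; simp at hd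
  have hdu : IsUnit (d : S) := hS.isUnit_iff.mpr (by rwa [map_natCast])
  have hprim : (θ.mulShift (d : S)).IsPrimitive := by
    intro a ha hone
    apply ha
    have h1 : (d : S) * a = 0 := by
      refine hθ.eq_zero fun y => ?_
      have := DFunLike.congr_fun hone y
      rw [AddChar.mulShift_apply, AddChar.mulShift_apply, AddChar.one_apply] at this
      rw [← this]; congr 1; ring
    exact (hdu.mul_right_eq_zero).mp h1
  have hdθ : ∀ x, θ.mulShift (d : S) x = θ x ^ d := fun x => by
    rw [AddChar.mulShift_apply, ← nsmul_eq_mul, AddChar.map_nsmul_eq_pow]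
  rw [hS.gaussSum_eq (h := h) hm hprim hc, MulChar.pow_apply' _ hd0, hdθ, mul_pow]
  · congr 1
    refine sum_congr rfl fun b _ => ?_
    rw [AddChar.mulShift_apply]; congr 1; ring
  · intro b hb
    rw [MulChar.pow_apply' _ hd0, hχ b hb, hdθ]

omit [Fintype S] [Fintype K] in
lemma residue_eq_of_forall_apply (hS : IsTruncatedDVR π w m) (hm : 2 ≤ m) (hθ : θ.IsPrimitive)
    {χ : MulChar S ℂ} {c c' : S}
    (hc : ∀ b, w ^ (m - m / 2) ∣ b → χ (1 + b) = θ (-(c * b)))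
    (hc' : ∀ b, w ^ (m - m / 2) ∣ b → χ (1 + b) = θ (-(c' * b))) : π c = π c' := by
  have h1 : w ^ (m - m / 2) * (c - c') = 0 := by
    refine hθ.eq_zero fun y => ?_
    have hd : w ^ (m - m / 2) ∣ w ^ (m - m / 2) * y := dvd_mul_right _ _
    have h2 := (hc _ hd).symm.trans (hc' _ hd)
    have h3 : θ (c' * (w ^ (m - m / 2) * y)) * θ (-(c' * (w ^ (m - m / 2) * y))) = 1 := by
      rw [← AddChar.map_add_eq_mul, add_neg_cancel, AddChar.map_zero_eq_one]
    have h4 : θ (c * (w ^ (m - m / 2) * y)) * θ (-(c * (w ^ (m - m / 2) * y))) = 1 := by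
      rw [← AddChar.map_add_eq_mul, add_neg_cancel, AddChar.map_zero_eq_one]
    have h5 : w ^ (m - m / 2) * (c - c') * y =
        c * (w ^ (m - m / 2) * y) + -(c' * (w ^ (m - m / 2) * y)) := by ring
    rw [h5, AddChar.map_add_eq_mul, ← h2, h4]
  have h2 : w ∣ c - c' := (dvd_pow_self w (by omega)).trans
    ((hS.pow_mul_eq_zero_iff _ (by omega) _).mp h1)
  rw [← hS.map_eq_zero_iff, map_sub, sub_eq_zero] at h2
  exact h2

omit [Fintype S] [Fintype K] in
lemma apply_one_add_eq (hS : IsTruncatedDVR π w m) {χ : MulChar S ℂ} {c : S}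
    (hχ : ∀ b, w ^ (m / 2) ∣ b → χ (1 + b + h * b ^ 2) = θ (-(c * b))) {b : S}
    (hb : w ^ (m - m / 2) ∣ b) : χ (1 + b) = θ (-(c * b)) := by
  have h1 := hχ b ((pow_dvd_pow w (by omega)).trans hb)
  rwa [sq, hS.mul_eq_zero_of_dvd (by omega) hb hb, mul_zero, add_zero] at h1

omit [Fintype S] [Fintype K] in
lemma exists_two_mul_eq_one (hS : IsTruncatedDVR π w m) (hK : ringChar K ≠ 2) :
    ∃ h : S, 2 * h = 1 := by
  have : IsUnit (2 : S) := hS.isUnit_iff.mpr (by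
    rw [map_ofNat]; exact Ring.two_ne_zero hK)
  exact this.exists_right_inv

variable [DecidableEq K] {d : ℕ} {ζ : K} {r : ℂ}

omit [Fintype S] [DecidableEq K] in
lemma prod_normalized_eq {g : MulChar K ℂ → ℂ} {A : ℂ} {x : K} (hζ : IsPrimitiveRoot ζ d)
    (hd : d ≠ 0) (hg : ∀ η, g η = η x * A) :
    ∏ η ∈ torsionChars K d, g η = (∏ η ∈ torsionChars K d, η x) * A ^ d := by
  rw [prod_congr rfl fun η _ => hg η, prod_mul_distrib, prod_const, card_torsionChars hζ hd]

omit [DecidableEq K] in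
theorem prod_gaussSum_of_even (hS : IsTruncatedDVR π w m) (hm : 2 ≤ m) (heven : Even m)
    (hK : ringChar K ≠ 2) (hθ : θ.IsPrimitive) {χ : MulChar S ℂ}
    (hχ : ∃ z, χ (1 + w ^ (m - 1) * z) ≠ 1) (hζ : IsPrimitiveRoot ζ d) (hd : (d : K) ≠ 0)
    (hr : r ^ 2 * Fintype.card K = 1) {c : S}
    (hc : ∀ b, w ^ (m - m / 2) ∣ b → χ (1 + b) = θ (-(c * b))) :
    ∏ η ∈ torsionChars K d, (r ^ m * gaussSum (χ * MulChar.pullback π η) θ) =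
      (r ^ m * gaussSum (χ ^ d) (θ.mulShift d)) * ∏ η ∈ torsionChars K d, η (π c) := by
  have hd0 : d ≠ 0 := by rintro rfl; simp at hd
  obtain ⟨h, hh⟩ := hS.exists_two_mul_eq_one hK
  obtain ⟨c', hcu, hc'⟩ := hS.exists_isUnit_apply_exp_eq hm hθ hh hχ
  have hcc : π c = π c' :=
    hS.residue_eq_of_forall_apply hm hθ hc fun b hb => hS.apply_one_add_eq hc' hb
  obtain ⟨k, hk⟩ : ∃ k, m = 2 * k := by
    obtain ⟨k, hk⟩ := heven; exact ⟨k, by omega⟩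
  have hmk : m / 2 = k := by omega
  have hrk : r ^ m * (Fintype.card K : ℂ) ^ k = 1 := by
    rw [hk, pow_mul, ← mul_pow, hr, one_pow]
  rw [prod_normalized_eq (x := π c) (A := χ c' * θ c') hζ hd0, hS.gaussSum_pow hm hθ hcu hc' hd,
    hmk, hS.sum_multiples_sq_of_even hk]
  · linear_combination (-(χ c' * θ c') ^ d * ∏ η ∈ torsionChars K d, η (π c)) * hrk
  · intro η
    rw [hS.gaussSum_mul_pullback hm hθ hcu hc', hmk, hS.sum_multiples_sq_of_even hk, hcc]
    linear_combination (η (π c') * (χ c' * θ c')) * hrk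

/-- With `u = η_K(c/2)`, each normalized sum is `η(c) χ(c) θ(c) r u G`, and the one for `χ ^ d` is
`(χ(c) θ(c)) ^ d r u η_K(d) G`. The ratio of the two sides, `∏ η(c) · (r u G) ^ (d - 1) η_K(d)`,
follows from the powers of `G` computed for each parity of `d`. -/
theorem prod_gaussSum_of_odd (hS : IsTruncatedDVR π w m) (hm : 2 ≤ m) (hodd : Odd m)
    (hK : ringChar K ≠ 2) (hθ : θ.IsPrimitive) {φ : AddChar K ℂ} (hφ1 : φ ≠ 1)
    (hφ : ∀ x, φ (π x) = θ (w ^ (m - 1) * x)) {χ : MulChar S ℂ}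
    (hχ : ∃ z, χ (1 + w ^ (m - 1) * z) ≠ 1) (hζ : IsPrimitiveRoot ζ d) (hd : (d : K) ≠ 0)
    (hr : r ^ 2 * Fintype.card K = 1) :
    ∏ η ∈ torsionChars K d, (r ^ m * gaussSum (χ * MulChar.pullback π η) θ) =
      (r ^ m * gaussSum (χ ^ d) (θ.mulShift d)) *
        if Odd d then 1 else quadraticCharC K ((2 * d : ℕ) : K) * r *
          gaussSum (quadraticCharC K) φ := by
  have hd0 : d ≠ 0 := by rintro rfl; simp at hd
  obtain ⟨h, hh⟩ := hS.exists_two_mul_eq_one hK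
  obtain ⟨c, hcu, hc⟩ := hS.exists_isUnit_apply_exp_eq hm hθ hh hχ
  obtain ⟨k, hk⟩ := hodd
  have hmk : m / 2 = k := by omega
  have hrk : r ^ m * (Fintype.card K : ℂ) ^ k = r := by
    rw [hk, pow_succ, pow_mul, mul_right_comm, ← mul_pow, hr, one_pow, one_mul]
  have hπh : π h ≠ 0 := by
    intro h0
    have := congrArg π hh
    rw [map_mul, h0, mul_zero, map_one] at this
    exact zero_ne_one this
  have hhu : IsUnit h := hS.isUnit_iff.mpr hπh
  have hdu : IsUnit (d : S) := hS.isUnit_iff.mpr (by rwa [map_natCast])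
  have hπc : π c ≠ 0 := hS.isUnit_iff.mp hcu
  set G := gaussSum (quadraticCharC K) φ
  set u := quadraticCharC K (π (h * c)) with hu
  set v := quadraticCharC K (d : K) with hv
  have hu2 : u ^ 2 = 1 := quadraticCharC_sq (by rw [map_mul]; exact mul_ne_zero hπh hπc)
  have hv2 : v ^ 2 = 1 := quadraticCharC_sq hd
  rw [prod_normalized_eq (x := π c) (A := χ c * θ c * (r * (u * G))) hζ hd0,
    hS.gaussSum_pow hm hθ hcu hc hd, hmk,
    hS.sum_multiples_sq_of_odd hK hk hφ1 hφ (hdu.mul (hhu.mul hcu)), map_mul π, map_natCast,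
    map_mul (quadraticCharC K), ← hu, ← hv]
  · split_ifs with hdo
    · rw [prod_torsionChars_apply_of_odd hdo hζ hπc]
      obtain ⟨n, rfl⟩ := hdo
      have hG := gaussSum_quadraticCharC_pow_odd hK hζ hφ1
      rw [← hv] at hG
      have e1 : (r * (u * G)) ^ (2 * n + 1) = r * u * v * G := by
        calc (r * (u * G)) ^ (2 * n + 1)
            = (r ^ 2) ^ n * (u ^ 2) ^ n * (r * u * G) * G ^ (2 * n) := by ring
          _ = (r ^ 2 * Fintype.card K) ^ n * (r * u * v * G) := by
              rw [hG, hu2, one_pow, mul_pow]; ring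
          _ = _ := by rw [hr, one_pow, one_mul]
      rw [mul_pow (χ c * θ c), e1]
      linear_combination (-(χ c * θ c) ^ (2 * n + 1) * (u * v * G)) * hrk
    · rw [Nat.not_odd_iff_even] at hdo
      rw [prod_torsionChars_apply_of_even hK hdo hd0 hζ hπc]
      obtain ⟨n, hn⟩ : ∃ n, d = 2 * n + 2 := by
        obtain ⟨n, rfl⟩ := hdo; exact ⟨n - 1, by omega⟩
      have hG := gaussSum_quadraticCharC_pow_even hK (hn ▸ hζ) hφ1
      have e1 : (r * (u * G)) ^ d = r ^ 2 * G ^ 2 := by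
        calc (r * (u * G)) ^ d
            = (r ^ 2) ^ n * (u ^ 2) ^ (n + 1) * (r ^ 2 * G ^ 2) * G ^ (2 * n) := by rw [hn]; ring
          _ = (r ^ 2 * Fintype.card K) ^ n * (r ^ 2 * G ^ 2) := by
              rw [hG, hu2, one_pow, mul_pow]; ring
          _ = _ := by rw [hr, one_pow, one_mul]
      have e2 : quadraticCharC K ((2 * d : ℕ) : K) * u * v = quadraticCharC K (π c) := by
        rw [Nat.cast_mul, map_mul, ← hv, hu, map_mul, map_mul]
        have e3 : quadraticCharC K ((2 : ℕ) : K) * quadraticCharC K (π h) = 1 := by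
          rw [← map_mul, Nat.cast_ofNat, ← map_ofNat π 2, ← map_mul, hh, map_one, map_one]
        linear_combination (v ^ 2 * quadraticCharC K (π c)) * e3 + quadraticCharC K (π c) * hv2
      rw [mul_pow (χ c * θ c), e1]
      linear_combination (-(χ c * θ c) ^ d * (r * G ^ 2) * quadraticCharC K ((2 * d : ℕ) : K) *
        u * v) * hrk - (χ c * θ c) ^ d * (r ^ 2 * G ^ 2) * e2
  · intro η
    rw [hS.gaussSum_mul_pullback hm hθ hcu hc, hmk,
      hS.sum_multiples_sq_of_odd hK hk hφ1 hφ (hhu.mul hcu), ← hu]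
    linear_combination (η (π c) * (χ c * θ c) * (u * G)) * hrk

/-- Here `π` is an isomorphism, and the claim is Hasse–Davenport with the product of the nontrivial
torsion Gauss sums evaluated. -/
theorem prod_gaussSum_of_eq_one (hS : IsTruncatedDVR π w 1)
    (hK : ringChar K ≠ 2) {φ : AddChar K ℂ} (hφ1 : φ ≠ 1)
    (hφ : ∀ x, φ (π x) = θ x) (χ : MulChar S ℂ) (hζ : IsPrimitiveRoot ζ d) (hd : (d : K) ≠ 0)
    (hr : r ^ 2 * Fintype.card K = 1) :
    ∏ η ∈ torsionChars K d, (r * gaussSum (χ * MulChar.pullback π η) θ) =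
      (r * gaussSum (χ ^ d) (θ.mulShift d)) *
        if Odd d then 1 else quadraticCharC K ((2 * d : ℕ) : K) * r *
          gaussSum (quadraticCharC K) φ := by
  classical
  have hd0 : d ≠ 0 := by rintro rfl; simp at hd
  have hw : w = 0 := by simpa using hS.pow_eq_zero le_rfl
  have hbij : Function.Bijective π := by
    refine ⟨(injective_iff_map_eq_zero π).mpr fun x hx => ?_, hS.surjective⟩
    rwa [hS.map_eq_zero_iff, hw, zero_dvd_iff] at hx
  let e : S ≃+* K := RingEquiv.ofBijective π hbij
  let X : MulChar K ℂ := MulChar.pullback (e.symm : K →+* S) χ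
  have hX : ∀ x : S, X (π x) = χ x := by
    intro x
    by_cases hx : IsUnit x
    · have : (e.symm : K →+* S) (π x) = x := e.symm_apply_apply x
      rw [MulChar.pullback_apply _ _ (hx.map π), this]
    · have h1 : π x = 0 := by rwa [hS.isUnit_iff, not_not] at hx
      rw [h1, MulChar.map_zero, MulChar.map_nonunit χ hx]
  have hpb : ∀ (η : MulChar K ℂ) (x : S), MulChar.pullback π η x = η (π x) := by
    intro η x
    by_cases hx : IsUnit x
    · exact MulChar.pullback_apply _ _ hx
    · have h1 : π x = 0 := by rwa [hS.isUnit_iff, not_not] at hx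
      rw [h1, MulChar.map_zero, MulChar.map_nonunit _ hx]
  have h1 : ∀ η, gaussSum (χ * MulChar.pullback π η) θ = gaussSum (X * η) φ := by
    intro η
    refine Fintype.sum_equiv e.toEquiv _ _ fun x => ?_
    change _ = (X * η) (π x) * φ (π x)
    rw [MulChar.mul_apply, MulChar.mul_apply, hX, hpb, hφ]
  have h2 : gaussSum (χ ^ d) (θ.mulShift d) = gaussSum (X ^ d) (φ.mulShift d) := by
    refine Fintype.sum_equiv e.toEquiv _ _ fun x => ?_
    change _ = (X ^ d) (π x) * φ.mulShift d (π x)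
    rw [MulChar.pow_apply' _ hd0, MulChar.pow_apply' _ hd0, hX, AddChar.mulShift_apply,
      AddChar.mulShift_apply, ← hφ, map_mul, map_natCast]
  rw [h2, prod_congr rfl fun η _ => by rw [h1 η], prod_mul_distrib, prod_const,
    card_torsionChars hζ hd0, prod_gaussSum_mul_torsionChars hζ hd hφ1]
  split_ifs with hdo
  · obtain ⟨n, rfl⟩ := hdo
    rw [prod_gaussSum_torsionChars_odd hζ hφ1]
    have e1 : r ^ (2 * n + 1) * (Fintype.card K : ℂ) ^ n = r := by
      rw [pow_succ, pow_mul, mul_right_comm, ← mul_pow, hr, one_pow, one_mul]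
    linear_combination gaussSum (X ^ (2 * n + 1)) (φ.mulShift ((2 * n + 1 : ℕ) : K)) * e1
  · rw [Nat.not_odd_iff_even] at hdo
    obtain ⟨n, rfl⟩ : ∃ n, d = 2 * n + 2 := by
      obtain ⟨n, rfl⟩ := hdo; exact ⟨n - 1, by omega⟩
    rw [prod_gaussSum_torsionChars_even hK hζ hφ1]
    have e1 : r ^ (2 * n + 2) * (Fintype.card K : ℂ) ^ n = r ^ 2 := by
      rw [pow_add, pow_mul, mul_right_comm, ← mul_pow, hr, one_pow, one_mul]
    linear_combination (gaussSum (X ^ (2 * n + 2)) (φ.mulShift ((2 * n + 2 : ℕ) : K)) *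
      quadraticCharC K ((2 * (2 * n + 2) : ℕ) : K) * gaussSum (quadraticCharC K) φ) * e1

end IsTruncatedDVR

/-! ### No small subgroups in the multiplicative group of `ℂ` -/

section NoSmallSubgroups

/-- While `z ^ (2 ^ k)` stays within `1/2` of `1`, the factor `z ^ (2 ^ k) + 1` has norm at least
`3/2`, so repeated squaring would increase the distance to `1` geometrically. -/
lemma eq_one_of_forall_norm_pow_sub_one_lt {z : ℂ} (h : ∀ n : ℕ, ‖z ^ n - 1‖ < 1 / 2) : z = 1 := by
  by_contra hz
  have hpos : 0 < ‖z - 1‖ := norm_pos_iff.mpr (sub_ne_zero.mpr hz)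
  have hgrow : ∀ k : ℕ, (3 / 2 : ℝ) ^ k * ‖z - 1‖ ≤ ‖z ^ 2 ^ k - 1‖ := by
    intro k
    induction k with
    | zero => simp
    | succ k ih =>
      have h1 : z ^ 2 ^ (k + 1) - 1 = (z ^ 2 ^ k - 1) * (z ^ 2 ^ k + 1) := by ring
      have h2 : (3 / 2 : ℝ) ≤ ‖z ^ 2 ^ k + 1‖ := by
        have h3 : z ^ 2 ^ k + 1 = 2 + (z ^ 2 ^ k - 1) := by ring
        have h4 : ‖(2 : ℂ)‖ - ‖z ^ 2 ^ k - 1‖ ≤ ‖2 + (z ^ 2 ^ k - 1)‖ := norm_sub_le_norm_add _ _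
        rw [h3]
        have h5 : ‖(2 : ℂ)‖ = 2 := by simp
        linarith [h (2 ^ k)]
      rw [h1, norm_mul, pow_succ]
      calc (3 / 2 : ℝ) ^ k * (3 / 2) * ‖z - 1‖ = ((3 / 2 : ℝ) ^ k * ‖z - 1‖) * (3 / 2) := by ring
        _ ≤ _ := mul_le_mul ih h2 (by norm_num) (norm_nonneg _)
  obtain ⟨k, hk⟩ := pow_unbounded_of_one_lt (1 / 2 / ‖z - 1‖) (by norm_num : (1 : ℝ) < 3 / 2)
  have h1 := hgrow k
  have h2 := h (2 ^ k)
  rw [div_lt_iff₀ hpos] at hk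
  linarith

end NoSmallSubgroups

/-! ### Fractional ideals and conductors -/

namespace PadicHD

section LocalField

open ValuativeRel

variable {F : Type*} [Field F] [ValuativeRel F] [TopologicalSpace F]
  [IsNonarchimedeanLocalField F] {ϖ : 𝒪[F]}

lemma irreducible_of_maximalIdeal_eq (hϖ : 𝓂[F] = Ideal.span {ϖ}) : Irreducible ϖ :=
  (IsDiscreteValuationRing.irreducible_iff_uniformizer ϖ).mpr hϖ

lemma uniformizer_ne_zero (hϖ : 𝓂[F] = Ideal.span {ϖ}) : (ϖ : F) ≠ 0 := by
  have := (irreducible_of_maximalIdeal_eq hϖ).ne_zero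
  exact fun h => this (Subtype.ext h)

lemma exists_eq_zpow_mul (hϖ : 𝓂[F] = Ideal.span {ϖ}) (x : F) :
    ∃ (n : ℤ) (y : 𝒪[F]), x = (ϖ : F) ^ n * (y : F) := by
  have h0 := uniformizer_ne_zero hϖ
  rcases le_total (valuation F x) 1 with h | h
  · exact ⟨0, ⟨x, h⟩, by simp⟩
  · have hx0 : x ≠ 0 := by
      rintro rfl; simp at h
    have hinv : valuation F x⁻¹ ≤ 1 := by
      rw [map_inv₀]; exact inv_le_one_of_one_le₀ h
    have hne : (⟨x⁻¹, hinv⟩ : 𝒪[F]) ≠ 0 := fun h' =>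
      inv_ne_zero hx0 (congrArg Subtype.val h')
    obtain ⟨n, u, hu⟩ := IsDiscreteValuationRing.eq_unit_mul_pow_irreducible hne
      (irreducible_of_maximalIdeal_eq hϖ)
    have hu' : x⁻¹ = ((u : 𝒪[F]) : F) * (ϖ : F) ^ n := by
      have := congrArg Subtype.val hu
      simpa using this
    have huu : ((u : 𝒪[F]) : F) * (((u⁻¹ : 𝒪[F]ˣ) : 𝒪[F]) : F) = 1 := by
      exact congrArg Subtype.val u.mul_inv
    refine ⟨-n, ((u⁻¹ : 𝒪[F]ˣ) : 𝒪[F]), ?_⟩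
    rw [← inv_inj, hu', mul_inv, zpow_neg, zpow_natCast, inv_inv, mul_comm]
    congr 1
    exact eq_inv_of_mul_eq_one_left huu

lemma fracIdeal_antitone (hϖ : 𝓂[F] = Ideal.span {ϖ}) {m n : ℤ} (h : m ≤ n) :
    fracIdeal ϖ n ⊆ fracIdeal ϖ m := by
  rintro _ ⟨y, rfl⟩
  obtain ⟨k, rfl⟩ := Int.le.dest h
  refine ⟨ϖ ^ k * y, ?_⟩
  rw [zpow_add₀ (uniformizer_ne_zero hϖ), zpow_natCast]
  push_cast
  ring

lemma exists_fracIdeal_subset (hϖ : 𝓂[F] = Ideal.span {ϖ}) {U : Set F} (hU : U ∈ nhds (0 : F)) :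
    ∃ n : ℕ, fracIdeal ϖ n ⊆ U := by
  obtain ⟨γ, hγ, hsub⟩ := (IsValuativeTopology.hasBasis_nhds_zero' F).mem_iff.mp hU
  obtain ⟨x, rfl⟩ := ValuativeRel.valuation_surjective γ
  have hx0 : x ≠ 0 := by rintro rfl; simp at hγ
  obtain ⟨k, y, hy⟩ := exists_eq_zpow_mul hϖ x⁻¹
  have hϖ0 := uniformizer_ne_zero hϖ
  have hlt : valuation F (ϖ : F) < 1 := by
    have h1 : ¬ IsUnit ϖ := (irreducible_of_maximalIdeal_eq hϖ).not_isUnit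
    have h2 : valuation F (ϖ : F) ≤ 1 := ϖ.2
    refine lt_of_le_of_ne h2 fun h3 => h1 ?_
    exact (Valuation.integer.integers (valuation F)).isUnit_of_one
      (IsUnit.mk0 _ hϖ0) h3
  -- As `x⁻¹ = ϖ ^ k y`, the exponent `1 - k` leaves one spare factor `ϖ`, which makes the
  -- inequality strict.
  refine ⟨(1 - k).toNat, fun z hz => hsub ?_⟩
  have hz' := fracIdeal_antitone hϖ (Int.self_le_toNat (1 - k)) hz
  obtain ⟨t, rfl⟩ := hz'
  change valuation F _ < valuation F x
  have hvx : 0 < valuation F x := zero_lt_iff.mpr hγ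
  have hmul : valuation F ((ϖ : F) ^ (1 - k) * t) * valuation F x⁻¹ < 1 := by
    rw [hy, ← map_mul]
    have : (ϖ : F) ^ (1 - k) * t * ((ϖ : F) ^ k * y) = ϖ * (t * y : 𝒪[F]) := by
      rw [zpow_sub₀ hϖ0, zpow_one]
      push_cast
      field_simp
    rw [this, map_mul]
    exact mul_lt_one_of_lt_of_le hlt (t * y).2
  rwa [map_inv₀, ← div_eq_mul_inv, div_lt_one₀ hvx] at hmul

lemma exists_addChar_eq_one (hϖ : 𝓂[F] = Ideal.span {ϖ}) {ψ : AddChar F ℂ} (hψ : Continuous ψ) :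
    ∃ n : ℤ, ∀ x ∈ fracIdeal ϖ n, ψ x = 1 := by
  have hU : {x : F | ‖ψ x - 1‖ < 1 / 2} ∈ nhds (0 : F) := by
    refine IsOpen.mem_nhds ?_ (by simp)
    exact isOpen_lt (by fun_prop) continuous_const
  obtain ⟨n, hn⟩ := exists_fracIdeal_subset hϖ hU
  refine ⟨n, fun x hx => eq_one_of_forall_norm_pow_sub_one_lt fun k => ?_⟩
  rw [← AddChar.map_nsmul_eq_pow]
  apply hn
  obtain ⟨y, rfl⟩ := hx
  exact ⟨k • y, by simp; ring⟩

/-- The infimum in `ℤ` is attained since the set is nonempty, by continuity and the absence of small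
subgroups, and bounded below, by nontriviality. -/
lemma addCond_spec (hϖ : 𝓂[F] = Ideal.span {ϖ}) {ψ : AddChar F ℂ} (hψ : Continuous ψ)
    (hψ1 : ψ ≠ 1) :
    (∀ x ∈ fracIdeal ϖ (addCond ϖ ψ), ψ x = 1) ∧
      ∃ x ∈ fracIdeal ϖ (addCond ϖ ψ - 1), ψ x ≠ 1 := by
  have hne : {n : ℤ | ∀ x ∈ fracIdeal ϖ n, ψ x = 1}.Nonempty := exists_addChar_eq_one hϖ hψ
  obtain ⟨x, hx⟩ : ∃ x, ψ x ≠ 1 := by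
    by_contra! h
    exact hψ1 (by ext x; simp [h x])
  obtain ⟨k, y, hy⟩ := exists_eq_zpow_mul hϖ x
  have hbdd : BddBelow {n : ℤ | ∀ x ∈ fracIdeal ϖ n, ψ x = 1} := by
    refine ⟨k, fun n hn => ?_⟩
    by_contra! hlt
    exact hx (hn x (fracIdeal_antitone hϖ hlt.le ⟨y, hy⟩))
  refine ⟨Int.csInf_mem hne hbdd, ?_⟩
  by_contra! h
  have : addCond ϖ ψ ≤ addCond ϖ ψ - 1 := csInf_le hbdd h
  omega

lemma addCond_eq (hϖ : 𝓂[F] = Ideal.span {ϖ}) {ψ : AddChar F ℂ} {n : ℤ}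
    (h1 : ∀ x ∈ fracIdeal ϖ n, ψ x = 1) (h2 : ∃ x ∈ fracIdeal ϖ (n - 1), ψ x ≠ 1) :
    addCond ϖ ψ = n := by
  refine IsLeast.csInf_eq ⟨h1, fun k hk => ?_⟩
  by_contra! hlt
  obtain ⟨x, hx, hx1⟩ := h2
  exact hx1 (hk x (fracIdeal_antitone hϖ (by omega) hx))

omit [TopologicalSpace F] [IsNonarchimedeanLocalField F] in
lemma coe_unitIncl (u : 𝒪[F]ˣ) : ((unitIncl F u : Fˣ) : F) = ((u : 𝒪[F]) : F) := rfl

lemma mem_principalUnits {n : ℕ} {u : 𝒪[F]ˣ} :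
    u ∈ principalUnits F n ↔ (u : 𝒪[F]) - 1 ∈ 𝓂[F] ^ n := by
  rw [principalUnits, MonoidHom.mem_ker, ← Ideal.Quotient.mk_eq_mk_iff_sub_mem, Units.ext_iff]
  simp

lemma mem_maximalIdeal_pow (hϖ : 𝓂[F] = Ideal.span {ϖ}) {n : ℕ} {x : 𝒪[F]} :
    x ∈ 𝓂[F] ^ n ↔ ϖ ^ n ∣ x := by
  rw [hϖ, Ideal.span_singleton_pow, Ideal.mem_span_singleton]

lemma principalUnits_antitone {m n : ℕ} (h : m ≤ n) :
    principalUnits F n ≤ principalUnits F m := fun _ hu =>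
  mem_principalUnits.mpr (Ideal.pow_le_pow_right h (mem_principalUnits.mp hu))

lemma exists_mulChar_eq_one (hϖ : 𝓂[F] = Ideal.span {ϖ}) (χ : Fˣ →ₜ* ℂˣ) :
    ∃ n : ℕ, 1 ≤ n ∧ ∀ u ∈ principalUnits F n, χ (unitIncl F u) = 1 := by
  have hU : {x : Fˣ | ‖(χ x : ℂ) - 1‖ < 1 / 2} ∈ nhds (1 : Fˣ) := by
    refine IsOpen.mem_nhds ?_ (by simp)
    refine isOpen_lt ?_ continuous_const
    have h1 : Continuous fun x : Fˣ => ((χ x : ℂˣ) : ℂ) :=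
      Units.continuous_val.comp χ.continuous_toFun
    fun_prop
  rw [Units.isEmbedding_val₀.isInducing.nhds_eq_comap, Filter.mem_comap] at hU
  obtain ⟨V, hV, hVU⟩ := hU
  have hV' : (fun x : F => 1 + x) ⁻¹' V ∈ nhds (0 : F) := by
    have hc : ContinuousAt (fun x : F => 1 + x) 0 := by fun_prop
    exact hc.preimage_mem_nhds (by simpa using hV)
  obtain ⟨n, hn⟩ := exists_fracIdeal_subset hϖ hV'
  -- The shift only secures a level of at least `1`.
  refine ⟨n + 1, by omega, fun u hu => ?_⟩
  have hu' := principalUnits_antitone (Nat.le_succ n) hu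
  apply Units.ext
  refine eq_one_of_forall_norm_pow_sub_one_lt fun k => ?_
  have hk := Subgroup.pow_mem _ hu' k
  rw [mem_principalUnits, mem_maximalIdeal_pow hϖ] at hk
  obtain ⟨y, hy⟩ := hk
  have hmem : unitIncl F (u ^ k) ∈ (Units.val : Fˣ → F) ⁻¹' V := by
    have h1 : (ϖ : F) ^ (n : ℤ) * (y : F) ∈ (fun x : F => 1 + x) ⁻¹' V := hn ⟨y, rfl⟩
    have h2 : ((unitIncl F (u ^ k) : Fˣ) : F) = 1 + (ϖ : F) ^ (n : ℤ) * (y : F) := by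
      have := congrArg Subtype.val hy
      rw [coe_unitIncl, zpow_natCast]
      push_cast at this ⊢
      rw [← this]; ring
    rw [Set.mem_preimage, h2]
    exact h1
  have h3 := hVU hmem
  rw [Set.mem_ofPred_eq, map_pow, map_pow, Units.val_pow_eq_pow_val] at h3
  exact h3

lemma mulCond_spec (hϖ : 𝓂[F] = Ideal.span {ϖ}) {χ : Fˣ →ₜ* ℂˣ} (hχ : ¬ IsUnramified χ) :
    1 ≤ mulCond χ ∧ (∀ u ∈ principalUnits F (mulCond χ), χ (unitIncl F u) = 1) ∧
      (2 ≤ mulCond χ → ∃ u ∈ principalUnits F (mulCond χ - 1), χ (unitIncl F u) ≠ 1) := by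
  have hne : {m : ℕ | 1 ≤ m ∧ ∀ u ∈ principalUnits F m, χ (unitIncl F u) = 1}.Nonempty :=
    exists_mulChar_eq_one hϖ χ
  have hmem := Nat.sInf_mem hne
  have heq : mulCond χ = sInf {m : ℕ | 1 ≤ m ∧ ∀ u ∈ principalUnits F m, χ (unitIncl F u) = 1} := by
    rw [mulCond, if_neg hχ]
  rw [← heq] at hmem
  refine ⟨hmem.1, hmem.2, fun h2 => ?_⟩
  by_contra! h
  have := Nat.sInf_le (s := {m : ℕ | 1 ≤ m ∧ ∀ u ∈ principalUnits F m, χ (unitIncl F u) = 1})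
    (m := mulCond χ - 1) ⟨by omega, h⟩
  omega

lemma mulCond_eq {χ : Fˣ →ₜ* ℂˣ} (hχ : ¬ IsUnramified χ) {m : ℕ} (hm : 1 ≤ m)
    (h1 : ∀ u ∈ principalUnits F m, χ (unitIncl F u) = 1)
    (h2 : 2 ≤ m → ∃ u ∈ principalUnits F (m - 1), χ (unitIncl F u) ≠ 1) : mulCond χ = m := by
  rw [mulCond, if_neg hχ]
  refine IsLeast.csInf_eq ⟨⟨hm, h1⟩, fun k hk => ?_⟩
  by_contra! hlt
  obtain ⟨u, hu, hu1⟩ := h2 (by have := hk.1; omega)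
  exact hu1 (hk.2 u (principalUnits_antitone (by omega) hu))

end LocalField

end PadicHD

/-! ### Passage to the finite ring `𝒪 / 𝔭 ^ m` -/

namespace PadicHD

section Truncation

open ValuativeRel

variable {F : Type*} [Field F] [ValuativeRel F] [TopologicalSpace F]
  [IsNonarchimedeanLocalField F] {ϖ : 𝒪[F]} {m : ℕ}

variable (F m) in
/-- The quotient of the ring of integers by the `m`-th power of the maximal ideal. -/
abbrev Trunc : Type _ := 𝒪[F] ⧸ 𝓂[F] ^ m

instance finite_trunc : Finite (Trunc F m) :=
  haveI : Finite (𝒪[F] ⧸ 𝓂[F]) := inferInstanceAs (Finite 𝓀[F])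
  Ideal.finite_quotient_pow (IsNoetherian.noetherian _) m

/-- The quotient map `𝒪 → 𝒪 / 𝔭 ^ m`. -/
noncomputable abbrev toTrunc (F : Type*) [Field F] [ValuativeRel F] [TopologicalSpace F]
    [IsNonarchimedeanLocalField F] (m : ℕ) : 𝒪[F] →+* Trunc F m :=
  Ideal.Quotient.mk (𝓂[F] ^ m)

/-- The reduction map `𝒪 / 𝔭 ^ m → 𝓀` for `m ≥ 1`. -/
noncomputable def truncRes (hm : 1 ≤ m) : Trunc F m →+* 𝓀[F] :=
  Ideal.Quotient.factor (Ideal.pow_le_self (by omega))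

lemma truncRes_toTrunc (hm : 1 ≤ m) (x : 𝒪[F]) :
    truncRes hm (toTrunc F m x) = IsLocalRing.residue 𝒪[F] x := rfl

lemma toTrunc_dvd_iff (hϖ : 𝓂[F] = Ideal.span {ϖ}) {i : ℕ} (hi : i ≤ m) {x : 𝒪[F]} :
    toTrunc F m ϖ ^ i ∣ toTrunc F m x ↔ ϖ ^ i ∣ x := by
  constructor
  · rintro ⟨y, hy⟩
    obtain ⟨y, rfl⟩ := Ideal.Quotient.mk_surjective y
    rw [← map_pow, ← map_mul, Ideal.Quotient.mk_eq_mk_iff_sub_mem, mem_maximalIdeal_pow hϖ] at hy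
    have h1 := (pow_dvd_pow ϖ hi).trans hy
    exact (dvd_sub_left (dvd_mul_right _ _)).mp h1
  · intro h
    rw [← map_pow]
    exact map_dvd _ h

lemma toTrunc_eq_zero_iff (hϖ : 𝓂[F] = Ideal.span {ϖ}) {x : 𝒪[F]} :
    toTrunc F m x = 0 ↔ ϖ ^ m ∣ x := by
  rw [Ideal.Quotient.eq_zero_iff_mem, mem_maximalIdeal_pow hϖ]

lemma isTruncatedDVR (hϖ : 𝓂[F] = Ideal.span {ϖ}) (hm : 1 ≤ m) :
    IsTruncatedDVR (truncRes (F := F) hm) (toTrunc F m ϖ) m where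
  surjective := by
    intro x
    obtain ⟨y, rfl⟩ := IsLocalRing.residue_surjective x
    exact ⟨toTrunc F m y, truncRes_toTrunc hm y⟩
  map_eq_zero_iff x := by
    obtain ⟨x, rfl⟩ := Ideal.Quotient.mk_surjective x
    rw [truncRes_toTrunc, IsLocalRing.residue_eq_zero_iff, ← pow_one (toTrunc F m ϖ),
      toTrunc_dvd_iff hϖ hm, pow_one, hϖ, Ideal.mem_span_singleton]
  pow_mul_eq_zero_iff i hi x := by
    obtain ⟨x, rfl⟩ := Ideal.Quotient.mk_surjective x
    have h0 : ϖ ^ i ≠ 0 := pow_ne_zero i (irreducible_of_maximalIdeal_eq hϖ).ne_zero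
    rw [← map_pow, ← map_mul, toTrunc_eq_zero_iff hϖ, toTrunc_dvd_iff hϖ (Nat.sub_le _ _)]
    conv_lhs => rw [← Nat.add_sub_cancel' hi, pow_add]
    exact mul_dvd_mul_iff_left h0

/-! ### Characters of the truncated ring -/

lemma exists_addChar_trunc (hϖ : 𝓂[F] = Ideal.span {ϖ}) {ψ : AddChar F ℂ} (t : F)
    (h : ∀ y : 𝒪[F], ψ (t * ((ϖ : F) ^ m * y)) = 1) :
    ∃ θ : AddChar (Trunc F m) ℂ, ∀ x : 𝒪[F], θ (toTrunc F m x) = ψ (t * x) := by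
  have hwd : ∀ x y : 𝒪[F], toTrunc F m x = toTrunc F m y → ψ (t * x) = ψ (t * y) := by
    intro x y hxy
    rw [Ideal.Quotient.mk_eq_mk_iff_sub_mem, mem_maximalIdeal_pow hϖ] at hxy
    obtain ⟨z, hz⟩ := hxy
    have hx : (x : F) = y + (ϖ : F) ^ m * z := by
      have := congrArg Subtype.val hz
      push_cast at this
      linear_combination this
    rw [hx, mul_add, AddChar.map_add_eq_mul, h, mul_one]
  have hsurj : Function.Surjective (toTrunc F m) := Ideal.Quotient.mk_surjective
  have hspec : ∀ x : 𝒪[F], ψ (t * (Function.surjInv hsurj (toTrunc F m x) : 𝒪[F])) = ψ (t * x) :=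
    fun x => hwd _ _ (Function.surjInv_eq hsurj _)
  refine ⟨{ toFun := fun s => ψ (t * (Function.surjInv hsurj s : 𝒪[F]))
            map_zero_eq_one' := ?_
            map_add_eq_mul' := ?_ }, hspec⟩
  · have := hspec 0
    rw [map_zero] at this
    simpa using this
  · intro a b
    obtain ⟨a, rfl⟩ := hsurj a
    obtain ⟨b, rfl⟩ := hsurj b
    rw [← map_add, hspec, hspec, hspec]
    push_cast
    rw [mul_add, AddChar.map_add_eq_mul]

/-- Every nonzero ideal of the quotient contains the multiples of `ϖ ^ (m - 1)`, so nontriviality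
there is nontriviality of every nonzero shift. -/
lemma isPrimitive_of_apply_ne_one (hϖ : 𝓂[F] = Ideal.span {ϖ}) (hm : 1 ≤ m)
    {θ : AddChar (Trunc F m) ℂ} {z : Trunc F m} (hz : θ (toTrunc F m ϖ ^ (m - 1) * z) ≠ 1) :
    θ.IsPrimitive := by
  intro a ha hone
  obtain ⟨x, rfl⟩ := Ideal.Quotient.mk_surjective a
  have hx0 : x ≠ 0 := by rintro rfl; exact ha (map_zero _)
  obtain ⟨n, u, rfl⟩ := IsDiscreteValuationRing.eq_unit_mul_pow_irreducible hx0
    (irreducible_of_maximalIdeal_eq hϖ)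
  have hn : n < m := by
    by_contra! h
    exact ha ((toTrunc_eq_zero_iff hϖ).mpr (dvd_mul_of_dvd_right (pow_dvd_pow ϖ h) _))
  apply hz
  have := DFunLike.congr_fun hone (toTrunc F m ((u⁻¹ : 𝒪[F]ˣ) * ϖ ^ (m - 1 - n)) * z)
  rw [AddChar.mulShift_apply, AddChar.one_apply, ← mul_assoc, ← map_mul] at this
  rw [← this, ← map_pow]
  congr 3
  calc ϖ ^ (m - 1) = (u * ((u⁻¹ : 𝒪[F]ˣ) : 𝒪[F])) * (ϖ ^ n * ϖ ^ (m - 1 - n)) := by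
        rw [Units.mul_inv, one_mul, ← pow_add]
        congr 1; omega
    _ = _ := by ring

lemma units_map_toTrunc_surjective (hm : 1 ≤ m) :
    Function.Surjective (Units.map (toTrunc F m : 𝒪[F] →* Trunc F m)) := by
  have : Nontrivial (Trunc F m) := Ideal.Quotient.nontrivial_iff.mpr fun h =>
    (IsLocalRing.maximalIdeal.isMaximal 𝒪[F]).ne_top
      (top_le_iff.mp (h ▸ Ideal.pow_le_self (by omega)))
  have : IsLocalHom (toTrunc F m) := IsLocalHom.of_surjective _ Ideal.Quotient.mk_surjective
  intro s
  obtain ⟨x, hx⟩ := Ideal.Quotient.mk_surjective (s : Trunc F m)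
  have hu : IsUnit x := isUnit_of_map_unit (toTrunc F m) x (by
    change IsUnit (Ideal.Quotient.mk _ x)
    rw [hx]; exact s.isUnit)
  exact ⟨hu.unit, Units.ext hx⟩

lemma exists_mulChar_trunc (hm : 1 ≤ m) {χ : Fˣ →ₜ* ℂˣ}
    (h : ∀ u ∈ principalUnits F m, χ (unitIncl F u) = 1) :
    ∃ X : MulChar (Trunc F m) ℂ, ∀ u : 𝒪[F]ˣ, X (toTrunc F m u) = (χ (unitIncl F u) : ℂˣ) := by
  let f : 𝒪[F]ˣ →* ℂˣ := (χ : Fˣ →* ℂˣ).comp (unitIncl F)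
  have hsurj := units_map_toTrunc_surjective (F := F) hm
  let g : (Trunc F m)ˣ →* ℂˣ :=
    (Units.map (toTrunc F m : 𝒪[F] →* Trunc F m)).liftOfSurjective hsurj ⟨f, fun u hu => h u hu⟩
  refine ⟨MulChar.ofUnitHom g, fun u => ?_⟩
  have h1 : g (Units.map (toTrunc F m : 𝒪[F] →* Trunc F m) u) = f u :=
    MonoidHom.liftOfRightInverse_comp_apply _ _ _ _ u
  have h2 : toTrunc F m u = (Units.map (toTrunc F m : 𝒪[F] →* Trunc F m) u : Trunc F m) := rfl
  rw [h2, MulChar.ofUnitHom_coe, h1]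
  rfl

omit [TopologicalSpace F] [IsNonarchimedeanLocalField F] in
variable (F) in
lemma resCard_rpow (m : ℕ) : (((resCard F : ℝ) ^ (-(m : ℝ) / 2) : ℝ) : ℂ) =
    (((resCard F : ℝ) ^ (-(1 : ℝ) / 2) : ℝ) : ℂ) ^ m := by
  rw [← Complex.ofReal_pow, ← Real.rpow_natCast, ← Real.rpow_mul (Nat.cast_nonneg _)]
  congr 2; ring

/-- The normalized Gauss sum of a ramified character as a Gauss sum over a finite ring. -/
lemma tau_eq [Fintype (Trunc F m)] (hm : 1 ≤ m) {χ : Fˣ →ₜ* ℂˣ} (hχ : ¬ IsUnramified χ)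
    (hχm : mulCond χ = m) {ψ : AddChar F ℂ} {X : MulChar (Trunc F m) ℂ}
    {θ : AddChar (Trunc F m) ℂ}
    (hX : ∀ u : 𝒪[F]ˣ, X (toTrunc F m u) = (χ (unitIncl F u) : ℂˣ))
    (hθ : ∀ x : 𝒪[F], θ (toTrunc F m x) = ψ ((ϖ : F) ^ (addCond ϖ ψ - m) * x)) :
    tau ϖ χ ψ = (((resCard F : ℝ) ^ (-(1 : ℝ) / 2) : ℝ) : ℂ) ^ m * gaussSum X θ := by
  classical
  rw [tau, if_neg hχ, hχm, resCard_rpow]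
  congr 1
  let f := Units.map (toTrunc F m : 𝒪[F] →* Trunc F m)
  let e : (𝒪[F]ˣ ⧸ principalUnits F m) ≃ (Trunc F m)ˣ :=
    (QuotientGroup.quotientKerEquivOfSurjective f (units_map_toTrunc_surjective hm)).toEquiv
  have he : ∀ u : 𝒪[F]ˣ, e (QuotientGroup.mk u) = f u := fun u => rfl
  have h1 : ∀ a : 𝒪[F]ˣ ⧸ principalUnits F m,
      ((χ (unitIncl F a.out) : ℂˣ) : ℂ) *
        ψ ((ϖ : F) ^ (addCond ϖ ψ - (m : ℤ)) * ((unitIncl F a.out : Fˣ) : F)) =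
      X (e a : Trunc F m) * θ (e a : Trunc F m) := by
    intro a
    have h2 : ((e a : (Trunc F m)ˣ) : Trunc F m) = toTrunc F m (a.out : 𝒪[F]ˣ) := by
      conv_lhs => rw [← QuotientGroup.out_eq' a, he]
      rfl
    rw [h2, hX, hθ, coe_unitIncl]
  rw [finsum_congr h1, finsum_comp_equiv e (f := fun s : (Trunc F m)ˣ => X (s : Trunc F m) *
    θ (s : Trunc F m)), finsum_eq_sum_of_fintype, gaussSum]
  have h3 : ∑ s : (Trunc F m)ˣ, X (s : Trunc F m) * θ (s : Trunc F m) =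
      ∑ x ∈ Finset.univ.filter (fun x : Trunc F m => IsUnit x), X x * θ x := by
    refine Finset.sum_bij (fun s _ => (s : Trunc F m)) ?_ ?_ ?_ ?_
    · intro s _; simp
    · intro a _ b _ h; exact Units.ext h
    · intro x hx
      rw [Finset.mem_filter] at hx
      exact ⟨hx.2.unit, Finset.mem_univ _, rfl⟩
    · intro s _; rfl
  rw [h3]
  refine Finset.sum_subset (Finset.filter_subset _ _) fun x _ hx => ?_
  have : ¬ IsUnit x := by simpa using hx
  rw [MulChar.map_nonunit X this, zero_mul]

end Truncation

end PadicHD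

/-! ### Residue characteristic and roots of unity -/

namespace PadicHD

section ResidueField

open ValuativeRel

lemma residue_prime_eq_zero {p : ℕ} [Fact p.Prime] {F : Type*} [Field F] [Algebra ℚ_[p] F]
    [ValuativeRel F] [ValuativeExtension ℚ_[p] F] : (p : 𝓀[F]) = 0 := by
  have h1 : (p : ℚ_[p]) <ᵥ 1 :=
    (Valuation.vlt_one_iff (valuation ℚ_[p])).mpr (Padic.valuation_p_lt_one _)
  have h2 : (p : F) <ᵥ 1 := by
    have := (ValuativeExtension.vlt_iff_vlt (B := F)).mpr h1
    rwa [map_natCast, map_one] at this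
  rw [Valuation.vlt_one_iff (valuation F)] at h2
  rw [← map_natCast (IsLocalRing.residue 𝒪[F]), IsLocalRing.residue_eq_zero_iff,
    IsLocalRing.mem_maximalIdeal, mem_nonunits_iff]
  intro h3
  have h4 := (Valuation.integer.integers (valuation F)).one_of_isUnit h3
  exact h2.ne h4

variable {F : Type*} [Field F] [ValuativeRel F] {d : ℕ}

lemma isUnit_natCast_integer (hd : (d : 𝓀[F]) ≠ 0) : IsUnit (d : 𝒪[F]) := by
  rw [← IsLocalRing.residue_ne_zero_iff_isUnit, map_natCast]
  exact hd

/-- If `z ^ l` reduces to `1`, then `∑ (z ^ l) ^ i` reduces to `d` and is a unit; it annihilates `z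
^ l - 1`, so `z ^ l = 1` already in `𝒪`. -/
lemma exists_isPrimitiveRoot_residue {ζ : F} (hζ : IsPrimitiveRoot ζ d) (hd : (d : 𝓀[F]) ≠ 0) :
    ∃ ξ : 𝓀[F], IsPrimitiveRoot ξ d := by
  have hd0 : d ≠ 0 := by rintro rfl; simp at hd
  have hv : valuation F ζ ≤ 1 := by
    have h1 : valuation F ζ ^ d = 1 := by rw [← map_pow, hζ.pow_eq_one, map_one]
    exact (pow_le_one_iff hd0).mp h1.le
  let z : 𝒪[F] := ⟨ζ, hv⟩
  have hz : IsPrimitiveRoot z d :=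
    IsPrimitiveRoot.of_map_of_injective (f := 𝒪[F].subtype) hζ Subtype.val_injective
  refine ⟨IsLocalRing.residue 𝒪[F] z, IsPrimitiveRoot.mk_of_lt _ (Nat.pos_of_ne_zero hd0)
    (by rw [← map_pow, hz.pow_eq_one, map_one]) fun l hl hld h => ?_⟩
  refine hz.pow_ne_one_of_pos_of_lt hl.ne' hld ?_
  have h1 : (∑ i ∈ Finset.range d, (z ^ l) ^ i) * (z ^ l - 1) = 0 := by
    rw [geom_sum_mul, ← pow_mul, mul_comm, pow_mul, hz.pow_eq_one, one_pow, sub_self]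
  have h2 : IsUnit (∑ i ∈ Finset.range d, (z ^ l) ^ i) := by
    rw [← IsLocalRing.residue_ne_zero_iff_isUnit, map_sum]
    simpa [h] using hd
  exact sub_eq_zero.mp ((h2.mul_right_eq_zero).mp h1)

end ResidueField

/-! ### Conductors of twists and powers -/

section Conductors

variable {F : Type*} [Field F] [ValuativeRel F] [TopologicalSpace F]

lemma not_isUnramified_of_pow {χ : Fˣ →ₜ* ℂˣ} {d : ℕ} (hχ : ¬ IsUnramified (χ ^ d)) :
    ¬ IsUnramified χ := fun h => hχ fun u => by
  rw [ContinuousMonoidHom.pow_apply, h u, one_pow]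

lemma not_isUnramified_mul {χ η : Fˣ →ₜ* ℂˣ} {d : ℕ} (hχ : ¬ IsUnramified (χ ^ d))
    (hη : ∀ x, η (x ^ d) = 1) : ¬ IsUnramified (χ * η) := by
  refine not_isUnramified_of_pow (d := d) fun h => hχ fun u => ?_
  have h1 := h u
  rwa [mul_pow, ContinuousMonoidHom.mul_apply, ContinuousMonoidHom.pow_apply η, ← map_pow, hη,
    mul_one] at h1

variable [IsNonarchimedeanLocalField F] {ϖ : 𝒪[F]}

lemma mulCond_mul (hϖ : 𝓂[F] = Ideal.span {ϖ}) {χ η : Fˣ →ₜ* ℂˣ} (hχ : ¬ IsUnramified χ)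
    (hχη : ¬ IsUnramified (χ * η)) (hη : ∀ u ∈ principalUnits F 1, η (unitIncl F u) = 1) :
    mulCond (χ * η) = mulCond χ := by
  obtain ⟨h1, h2, h3⟩ := mulCond_spec hϖ hχ
  refine mulCond_eq hχη h1 (fun u hu => ?_) fun hm => ?_
  · rw [ContinuousMonoidHom.mul_apply, h2 u hu, hη u (principalUnits_antitone h1 hu), one_mul]
  · obtain ⟨u, hu, hu1⟩ := h3 hm
    refine ⟨u, hu, ?_⟩
    rwa [ContinuousMonoidHom.mul_apply, hη u (principalUnits_antitone (by omega) hu), mul_one]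

/-- For `m ≥ 2` the `d`-th power map acts on `(1 + 𝔭 ^ (m - 1)) / (1 + 𝔭 ^ m)` as multiplication by
the unit `d`, so `χ` stays nontrivial there. -/
lemma mulCond_pow (hϖ : 𝓂[F] = Ideal.span {ϖ}) {χ : Fˣ →ₜ* ℂˣ} {d : ℕ} (hd : (d : 𝓀[F]) ≠ 0)
    (hχ : ¬ IsUnramified (χ ^ d)) : mulCond (χ ^ d) = mulCond χ := by
  obtain ⟨h1, h2, h3⟩ := mulCond_spec hϖ (not_isUnramified_of_pow hχ)
  set m := mulCond χ
  refine mulCond_eq hχ h1 (fun u hu => ?_) fun hm => ?_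
  · rw [ContinuousMonoidHom.pow_apply, h2 u hu, one_pow]
  · obtain ⟨u, hu, hu1⟩ := h3 hm
    obtain ⟨D, hD⟩ := isUnit_natCast_integer hd
    rw [mem_principalUnits] at hu
    -- The witness is `v = 1 + (u - 1) / d`: since `2 (m - 1) ≥ m`, `v ^ d` agrees with `u` modulo
    -- `𝔭 ^ m`.
    obtain ⟨x, hx⟩ : ∃ x : 𝒪[F], x = ((D⁻¹ : 𝒪[F]ˣ) : 𝒪[F]) * (u - 1) := ⟨_, rfl⟩
    have hxm : x ∈ 𝓂[F] ^ (m - 1) := hx ▸ Ideal.mul_mem_left _ _ hu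
    have hxu : IsUnit (1 + x) := by
      rw [← IsLocalRing.residue_ne_zero_iff_isUnit, map_add, map_one,
        (IsLocalRing.residue_eq_zero_iff x).mpr (Ideal.pow_le_self (by omega) hxm), add_zero]
      exact one_ne_zero
    obtain ⟨v, hv⟩ := hxu
    refine ⟨v, mem_principalUnits.mpr (by rwa [hv, add_sub_cancel_left]), ?_⟩
    obtain ⟨k, hk⟩ := Polynomial.powAddExpansion 1 x d
    have hx2 : x ^ 2 ∈ 𝓂[F] ^ m := by
      have := Ideal.pow_mem_pow hxm 2
      rw [← pow_mul] at this
      exact Ideal.pow_le_pow_right (by omega) this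
    have hdx : (d : 𝒪[F]) * x = u - 1 := by
      rw [hx, ← hD, ← mul_assoc, Units.mul_inv, one_mul]
    have hvu : v ^ d * u⁻¹ ∈ principalUnits F m := by
      rw [mem_principalUnits]
      have h4 : ((v ^ d * u⁻¹ : 𝒪[F]ˣ) : 𝒪[F]) - 1 = ((u⁻¹ : 𝒪[F]ˣ) : 𝒪[F]) * (k * x ^ 2) := by
        have h5 : ((u : 𝒪[F]ˣ) : 𝒪[F]) * ((u⁻¹ : 𝒪[F]ˣ) : 𝒪[F]) = 1 := u.mul_inv
        rw [Units.val_mul, Units.val_pow_eq_pow_val, hv, hk, one_pow, one_pow, mul_one, hdx]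
        linear_combination h5
      rw [h4]
      exact Ideal.mul_mem_left _ _ (Ideal.mul_mem_left _ _ hx2)
    have h6 := h2 _ hvu
    rw [map_mul, map_mul, map_inv, map_inv, mul_inv_eq_one, map_pow, map_pow] at h6
    rwa [ContinuousMonoidHom.pow_apply, h6]

lemma addCond_mulShift (hϖ : 𝓂[F] = Ideal.span {ϖ}) {ψ : AddChar F ℂ} (hψ : Continuous ψ)
    (hψ1 : ψ ≠ 1) {u : 𝒪[F]} (hu : IsUnit u) :
    addCond ϖ (ψ.mulShift (u : F)) = addCond ϖ ψ := by
  obtain ⟨h1, x, ⟨y, rfl⟩, hx⟩ := addCond_spec hϖ hψ hψ1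
  obtain ⟨u, rfl⟩ := hu
  refine addCond_eq hϖ ?_ ⟨_, ⟨(u⁻¹ : 𝒪[F]ˣ) * y, rfl⟩, ?_⟩
  · rintro _ ⟨z, rfl⟩
    rw [AddChar.mulShift_apply]
    exact h1 _ ⟨u * z, by push_cast; ring⟩
  · rw [AddChar.mulShift_apply]
    have h2 : ((u : 𝒪[F]) : F) * (((u⁻¹ : 𝒪[F]ˣ) : 𝒪[F]) : F) = 1 :=
      congrArg Subtype.val u.mul_inv
    convert hx using 2
    push_cast
    linear_combination ((ϖ : F) ^ (addCond ϖ ψ - 1) * y) * h2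

lemma exists_addChar_residue (hϖ : 𝓂[F] = Ideal.span {ϖ}) {ψ : AddChar F ℂ} (hψ : Continuous ψ)
    (hψ1 : ψ ≠ 1) :
    ∃ φ : AddChar 𝓀[F] ℂ, φ ≠ 1 ∧ ∀ x : 𝒪[F],
      φ (IsLocalRing.residue 𝒪[F] x) = ψ ((ϖ : F) ^ (addCond ϖ ψ - 1) * x) := by
  obtain ⟨h1, x, ⟨y, rfl⟩, hx⟩ := addCond_spec hϖ hψ hψ1
  obtain ⟨θ, hθ⟩ := exists_addChar_trunc (m := 1) hϖ (ψ := ψ) ((ϖ : F) ^ (addCond ϖ ψ - 1))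
    fun z => by
      refine h1 _ ⟨z, ?_⟩
      rw [zpow_sub_one₀ (uniformizer_ne_zero hϖ)]
      field_simp [uniformizer_ne_zero hϖ]
  have e : 𝓂[F] ^ 1 = 𝓂[F] := pow_one _
  let f : 𝓀[F] →+* Trunc F 1 := Ideal.Quotient.factor e.ge
  have hf : ∀ x : 𝒪[F], θ.compAddMonoidHom (f : 𝓀[F] →+ Trunc F 1) (IsLocalRing.residue 𝒪[F] x) =
    ψ ((ϖ : F) ^ (addCond ϖ ψ - 1) * x) := hθ
  refine ⟨θ.compAddMonoidHom (f : 𝓀[F] →+ Trunc F 1), fun h => hx ?_, hf⟩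
  rw [← hf, h, AddChar.one_apply]

end Conductors

end PadicHD

/-! ### Translation of the local data into finite sums -/

namespace PadicHD

section ResidueSums

open ValuativeRel

variable {F : Type*} [Field F] [ValuativeRel F]

lemma etaK_eq [Fintype 𝓀[F]] [DecidableEq 𝓀[F]] (x : 𝓀[F]) : etaK F x = quadraticCharC 𝓀[F] x := by
  rw [quadraticCharC_apply, etaK]
  congr!

lemma quadGauss_eq [Fintype 𝓀[F]] [DecidableEq 𝓀[F]] (hK : ringChar 𝓀[F] ≠ 2) {ϖ : 𝒪[F]}
    {ψ : AddChar F ℂ} {φ : AddChar 𝓀[F] ℂ} (hφ1 : φ ≠ 1) (hφ : ∀ x : 𝒪[F],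
      φ (IsLocalRing.residue 𝒪[F] x) = ψ ((ϖ : F) ^ (addCond ϖ ψ - 1) * x)) :
    quadGauss ϖ ψ = gaussSum (quadraticCharC 𝓀[F]) φ := by
  have h1 : ∀ x : 𝓀[F], resAddChar ϖ ψ (x ^ 2) = φ (1 * x ^ 2) := fun x => by
    rw [resAddChar, mul_comm, ← hφ, Function.surjInv_eq IsLocalRing.residue_surjective, one_mul]
  rw [quadGauss, finsum_congr h1, finsum_eq_sum_of_fintype,
    sum_addChar_mul_sq hK hφ1 one_ne_zero, map_one, one_mul]

variable (F) in
lemma resCard_rpow_sq_mul_card [Fintype 𝓀[F]] :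
    (((resCard F : ℝ) ^ (-(1 : ℝ) / 2) : ℝ) : ℂ) ^ 2 * Fintype.card 𝓀[F] = 1 := by
  have h0 : (0 : ℝ) < resCard F := by
    rw [resCard, Nat.card_eq_fintype_card]
    exact_mod_cast Fintype.card_pos
  rw [← Nat.card_eq_fintype_card, ← resCard, ← Complex.ofReal_pow, ← Real.rpow_natCast,
    ← Real.rpow_mul h0.le]
  norm_num
  rw [Real.rpow_neg_one, Complex.ofReal_inv, Complex.ofReal_natCast, inv_mul_cancel₀]
  exact_mod_cast h0.ne'

end ResidueSums

section Reduction

lemma inv_apply {G : Type*} [Group G] [TopologicalSpace G] (χ : G →ₜ* ℂˣ) (x : G) :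
    χ⁻¹ x = (χ x)⁻¹ := rfl

variable {F : Type*} [Field F] [ValuativeRel F] [TopologicalSpace F]
  [IsNonarchimedeanLocalField F] {ϖ : 𝒪[F]} {ψ : AddChar F ℂ} {m : ℕ}

/-- Since `τ` of a ramified character only sees its restriction to `𝒪ˣ`, this lets the product over
`J` be replaced by one over `torsionChars`. -/
lemma IsLift.bijective {d : ℕ} {J : Subgroup (Fˣ →ₜ* ℂˣ)} (hJ : IsLift d J) [Fintype 𝓀[F]] :
    ∃ e : J → {η // η ∈ torsionChars 𝓀[F] d}, Function.Bijective e ∧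
      ∀ (η : J) (u : 𝒪[F]ˣ), ((η : Fˣ →ₜ* ℂˣ) (unitIncl F u) : ℂ) =
        (e η : MulChar 𝓀[F] ℂ) (IsLocalRing.residue 𝒪[F] u) := by
  obtain ⟨-, r, hr⟩ := hJ
  have hpow : ∀ f : 𝓀[F]ˣ →* ℂˣ,
      MulChar.ofUnitHom f ∈ torsionChars 𝓀[F] d ↔ f ∈ resPowChars F d := by
    intro f
    rw [mem_torsionChars, MulChar.ext_iff]
    refine forall_congr' fun x => ?_
    rw [MulChar.pow_apply_coe, MulChar.ofUnitHom_coe, MulChar.one_apply_coe, map_pow, Units.ext_iff]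
    simp
  refine ⟨fun η => ⟨MulChar.ofUnitHom (r η : 𝓀[F]ˣ →* ℂˣ), (hpow _).mpr (r η).2⟩,
    ⟨fun a b h => ?_, fun η => ?_⟩, fun η u => ?_⟩
  · refine r.injective (Subtype.ext (MulChar.equivToUnitHom.symm.injective ?_))
    exact congrArg Subtype.val h
  · obtain ⟨f, hf⟩ := MulChar.equivToUnitHom.symm.surjective η.1
    have hf' : MulChar.ofUnitHom f = η.1 := hf
    have hmem := (hpow f).mp (hf' ▸ η.2)
    refine ⟨r.symm ⟨f, hmem⟩, Subtype.ext ?_⟩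
    simp only [MulEquiv.apply_symm_apply, hf']
  · rw [hr]
    exact (MulChar.ofUnitHom_coe (r η : 𝓀[F]ˣ →* ℂˣ) (unitRed F u)).symm

lemma IsLift.apply_eq_one {d : ℕ} {J : Subgroup (Fˣ →ₜ* ℂˣ)} (hJ : IsLift d J)
    {η : Fˣ →ₜ* ℂˣ} (hη : η ∈ J) {u : 𝒪[F]ˣ} (hu : u ∈ principalUnits F 1) :
    η (unitIncl F u) = 1 := by
  obtain ⟨-, r, hr⟩ := hJ
  have h1 : unitRed F u = 1 := by
    rw [mem_principalUnits, pow_one, ← IsLocalRing.residue_eq_zero_iff, map_sub, sub_eq_zero,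
      map_one] at hu
    exact Units.ext hu
  rw [hr ⟨η, hη⟩, h1, map_one]

lemma exists_addChar_trunc_addCond (hϖ : 𝓂[F] = Ideal.span {ϖ}) (hψ : Continuous ψ) (hψ1 : ψ ≠ 1)
    (m : ℕ) : ∃ θ : AddChar (Trunc F m) ℂ,
      ∀ x : 𝒪[F], θ (toTrunc F m x) = ψ ((ϖ : F) ^ (addCond ϖ ψ - m) * x) := by
  refine exists_addChar_trunc hϖ _ fun y => (addCond_spec hϖ hψ hψ1).1 _ ⟨y, ?_⟩
  rw [← mul_assoc, ← zpow_natCast, ← zpow_add₀ (uniformizer_ne_zero hϖ), sub_add_cancel]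

lemma apply_truncRes (hϖ : 𝓂[F] = Ideal.span {ϖ}) (hm : 1 ≤ m) {φ : AddChar 𝓀[F] ℂ}
    (hφ : ∀ x : 𝒪[F], φ (IsLocalRing.residue 𝒪[F] x) = ψ ((ϖ : F) ^ (addCond ϖ ψ - 1) * x))
    {θ : AddChar (Trunc F m) ℂ}
    (hθ : ∀ x : 𝒪[F], θ (toTrunc F m x) = ψ ((ϖ : F) ^ (addCond ϖ ψ - m) * x)) (s : Trunc F m) :
    φ (truncRes hm s) = θ (toTrunc F m ϖ ^ (m - 1) * s) := by
  obtain ⟨x, rfl⟩ := Ideal.Quotient.mk_surjective s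
  rw [truncRes_toTrunc, hφ, ← map_pow, ← map_mul, hθ]
  push_cast
  rw [← mul_assoc, ← zpow_natCast, ← zpow_add₀ (uniformizer_ne_zero hϖ)]
  congr 3
  omega

lemma isPrimitive_trunc (hϖ : 𝓂[F] = Ideal.span {ϖ}) (hm : 1 ≤ m) {φ : AddChar 𝓀[F] ℂ}
    (hφ1 : φ ≠ 1) {θ : AddChar (Trunc F m) ℂ}
    (hφθ : ∀ s, φ (truncRes hm s) = θ (toTrunc F m ϖ ^ (m - 1) * s)) : θ.IsPrimitive := by
  obtain ⟨x, hx⟩ := DFunLike.ne_iff.mp hφ1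
  obtain ⟨s, rfl⟩ := (isTruncatedDVR hϖ hm).surjective x
  exact isPrimitive_of_apply_ne_one hϖ hm (z := s) (by rwa [← hφθ])

lemma finprod_tau_eq [Fintype (Trunc F m)] [Fintype 𝓀[F]] (hϖ : 𝓂[F] = Ideal.span {ϖ})
    (hm : 1 ≤ m) {d : ℕ} {J : Subgroup (Fˣ →ₜ* ℂˣ)} (hJ : IsLift d J) {χ : Fˣ →ₜ* ℂˣ}
    (hχ : ¬ IsUnramified (χ ^ d)) (hχm : mulCond χ = m) {X : MulChar (Trunc F m) ℂ}
    {θ : AddChar (Trunc F m) ℂ}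
    (hX : ∀ u : 𝒪[F]ˣ, X (toTrunc F m u) = (χ (unitIncl F u) : ℂˣ))
    (hθ : ∀ x : 𝒪[F], θ (toTrunc F m x) = ψ ((ϖ : F) ^ (addCond ϖ ψ - m) * x)) :
    ∏ᶠ η : J, tau ϖ (χ * (η : Fˣ →ₜ* ℂˣ)) ψ = ∏ η ∈ torsionChars 𝓀[F] d,
      ((((resCard F : ℝ) ^ (-(1 : ℝ) / 2) : ℝ) : ℂ) ^ m *
        gaussSum (X * MulChar.pullback (truncRes hm) η) θ) := by
  obtain ⟨e, he, heη⟩ := hJ.bijective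
  rw [← Finset.prod_coe_sort, ← finprod_eq_prod_of_fintype]
  refine finprod_eq_of_bijective e he fun η => ?_
  have hr : ¬ IsUnramified (χ * (η : Fˣ →ₜ* ℂˣ)) := not_isUnramified_mul hχ (hJ.1 η η.2)
  refine tau_eq hm hr ?_ (fun u => ?_) hθ
  · rw [mulCond_mul hϖ (not_isUnramified_of_pow hχ) hr fun u hu => hJ.apply_eq_one η.2 hu, hχm]
  · rw [MulChar.mul_apply, hX, MulChar.pullback_apply _ _ (u.isUnit.map _), truncRes_toTrunc,
      ← heη, ContinuousMonoidHom.mul_apply, Units.val_mul]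

lemma tau_pow_eq [Fintype (Trunc F m)] (hϖ : 𝓂[F] = Ideal.span {ϖ}) (hψ : Continuous ψ)
    (hψ1 : ψ ≠ 1) (hm : 1 ≤ m) {d : ℕ} (hd : (d : 𝓀[F]) ≠ 0) {χ : Fˣ →ₜ* ℂˣ}
    (hχ : ¬ IsUnramified (χ ^ d)) (hχm : mulCond χ = m) {X : MulChar (Trunc F m) ℂ}
    {θ : AddChar (Trunc F m) ℂ}
    (hX : ∀ u : 𝒪[F]ˣ, X (toTrunc F m u) = (χ (unitIncl F u) : ℂˣ))
    (hθ : ∀ x : 𝒪[F], θ (toTrunc F m x) = ψ ((ϖ : F) ^ (addCond ϖ ψ - m) * x)) :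
    tau ϖ (χ ^ d) (ψ.mulShift (d : F)) = (((resCard F : ℝ) ^ (-(1 : ℝ) / 2) : ℝ) : ℂ) ^ m *
      gaussSum (X ^ d) (θ.mulShift d) := by
  refine tau_eq hm hχ ((mulCond_pow hϖ hd hχ).trans hχm) (fun u => ?_) fun x => ?_
  · have hu : IsUnit (toTrunc F m u) := u.isUnit.map _
    rw [← hu.unit_spec, MulChar.pow_apply_coe, hu.unit_spec, hX, ContinuousMonoidHom.pow_apply,
      Units.val_pow_eq_pow_val]
  · have h1 := addCond_mulShift hϖ hψ hψ1 (isUnit_natCast_integer hd)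
    have h2 : (((d : 𝒪[F]) : 𝒪[F]) : F) = d := by push_cast; rfl
    rw [h2] at h1
    rw [h1, AddChar.mulShift_apply, AddChar.mulShift_apply, ← map_natCast (toTrunc F m), ← map_mul,
      hθ]
    push_cast
    congr 1
    ring

lemma exists_apply_one_add_ne_one (hϖ : 𝓂[F] = Ideal.span {ϖ}) {χ : Fˣ →ₜ* ℂˣ}
    (hχ : ¬ IsUnramified χ) (hm : 2 ≤ m) (hχm : mulCond χ = m) {X : MulChar (Trunc F m) ℂ}
    (hX : ∀ u : 𝒪[F]ˣ, X (toTrunc F m u) = (χ (unitIncl F u) : ℂˣ)) :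
    ∃ z, X (1 + toTrunc F m ϖ ^ (m - 1) * z) ≠ 1 := by
  obtain ⟨u, hu, hu1⟩ := (mulCond_spec hϖ hχ).2.2 (hχm ▸ hm)
  rw [hχm, mem_principalUnits, mem_maximalIdeal_pow hϖ] at hu
  obtain ⟨y, hy⟩ := hu
  refine ⟨toTrunc F m y, fun h => hu1 (Units.ext ?_)⟩
  rw [← map_pow, ← map_mul, ← map_one (toTrunc F m), ← map_add, ← hy, add_sub_cancel, hX] at h
  exact h

/-- Changing `a` modulo `𝔭 ^ ⌊m/2⌋` changes `a (x - 1)` by an element of `𝔭 ^ m`, so one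
representative suffices. -/
lemma isCElt_mk_iff (hϖ : 𝓂[F] = Ideal.span {ϖ}) {χ : Fˣ →ₜ* ℂˣ} {θ : AddChar (Trunc F m) ℂ}
    (hχm : mulCond χ = m)
    (hθ : ∀ x : 𝒪[F], θ (toTrunc F m x) = ψ ((ϖ : F) ^ (addCond ϖ ψ - m) * x)) (a : 𝒪[F]ˣ) :
    IsCElt ϖ χ (ψ.mulShift ((ϖ : F) ^ addCond ϖ ψ)) (QuotientGroup.mk a) ↔
      ∀ x ∈ principalUnits F (m - m / 2),
        θ (toTrunc F m (a * (x - 1))) = ((χ⁻¹ (unitIncl F x) : ℂˣ) : ℂ) := by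
  have h1 : ∀ a x : 𝒪[F]ˣ, ψ.mulShift ((ϖ : F) ^ addCond ϖ ψ) (((unitIncl F a : Fˣ) : F) *
      ((ϖ : F) ^ (-(m : ℤ)) * (((unitIncl F x : Fˣ) : F) - 1))) =
      θ (toTrunc F m (a * (x - 1))) := by
    intro a x
    rw [hθ, AddChar.mulShift_apply, sub_eq_add_neg (addCond ϖ ψ),
      zpow_add₀ (uniformizer_ne_zero hϖ), coe_unitIncl, coe_unitIncl]
    push_cast
    congr 1
    ring
  subst hχm
  unfold IsCElt
  simp only [h1]
  refine ⟨fun h => h a rfl, fun h b hb x hx => ?_⟩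
  rw [← h x hx]
  congr 1
  rw [Ideal.Quotient.mk_eq_mk_iff_sub_mem, ← sub_mul]
  rw [QuotientGroup.eq, mem_principalUnits] at hb
  rw [mem_principalUnits] at hx
  have h2 : (b : 𝒪[F]) - a ∈ 𝓂[F] ^ (mulCond χ / 2) := by
    have h3 := Ideal.mul_mem_left _ (-(b : 𝒪[F])) hb
    have h4 : (b : 𝒪[F]) * ((b⁻¹ : 𝒪[F]ˣ) : 𝒪[F]) = 1 := b.mul_inv
    have h5 : -(b : 𝒪[F]) * (((b⁻¹ * a : 𝒪[F]ˣ) : 𝒪[F]) - 1) = b - a := by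
      rw [Units.val_mul]
      linear_combination (-(a : 𝒪[F])) * h4
    rwa [h5] at h3
  have h6 := Ideal.mul_mem_mul h2 hx
  rwa [← pow_add, Nat.add_sub_cancel' (Nat.div_le_self _ _)] at h6

lemma exists_unit_eq_one_add {n : ℕ} (hn : 1 ≤ n) {b : 𝒪[F]} (hb : b ∈ 𝓂[F] ^ n) :
    ∃ x ∈ principalUnits F n, (x : 𝒪[F]) = 1 + b := by
  have hu : IsUnit (1 + b) := by
    rw [← IsLocalRing.residue_ne_zero_iff_isUnit, map_add, map_one,
      (IsLocalRing.residue_eq_zero_iff b).mpr (Ideal.pow_le_self (by omega) hb), add_zero]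
    exact one_ne_zero
  exact ⟨hu.unit, mem_principalUnits.mpr (by rwa [hu.unit_spec, add_sub_cancel_left]),
    hu.unit_spec⟩

/-- The class `c_{χ,ψ}` describes `χ` on `1 + 𝔭 ^ (m - m / 2)`. -/
lemma apply_one_add_eq_cElt [Fintype (Trunc F m)] [Fintype 𝓀[F]]
    (hϖ : 𝓂[F] = Ideal.span {ϖ}) (hK : ringChar 𝓀[F] ≠ 2)
    {χ : Fˣ →ₜ* ℂˣ} (hχ : ¬ IsUnramified χ) (hm : 2 ≤ m) (hχm : mulCond χ = m)
    {X : MulChar (Trunc F m) ℂ} {θ : AddChar (Trunc F m) ℂ} (hprim : θ.IsPrimitive)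
    (hX : ∀ u : 𝒪[F]ˣ, X (toTrunc F m u) = (χ (unitIncl F u) : ℂˣ))
    (hθ : ∀ x : 𝒪[F], θ (toTrunc F m x) = ψ ((ϖ : F) ^ (addCond ϖ ψ - m) * x))
    (b : Trunc F m) (hb : toTrunc F m ϖ ^ (m - m / 2) ∣ b) :
    X (1 + b) = θ (-(toTrunc F m
      ((cElt ϖ χ (ψ.mulShift ((ϖ : F) ^ addCond ϖ ψ))).out : 𝒪[F]ˣ) * b)) := by
  classical
  have hm1 : 1 ≤ m := by omega
  have hS := isTruncatedDVR (F := F) hϖ hm1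
  -- The stationary point gives existence and primitivity of `θ` gives uniqueness, so `cElt` is not
  -- its default value `1`.
  have hex : ∃! c, IsCElt ϖ χ (ψ.mulShift ((ϖ : F) ^ addCond ϖ ψ)) c := by
    obtain ⟨h, hh⟩ := hS.exists_two_mul_eq_one hK
    obtain ⟨c, hcu, hc⟩ := hS.exists_isUnit_apply_exp_eq hm hprim hh
      (exists_apply_one_add_ne_one hϖ hχ hm hχm hX)
    obtain ⟨a, ha⟩ := units_map_toTrunc_surjective hm1 hcu.unit
    have ha' : toTrunc F m a = c := congrArg Units.val ha
    have ha0 : IsCElt ϖ χ (ψ.mulShift ((ϖ : F) ^ addCond ϖ ψ)) (QuotientGroup.mk a) := by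
      rw [isCElt_mk_iff hϖ hχm hθ]
      intro x hx
      rw [mem_principalUnits, mem_maximalIdeal_pow hϖ] at hx
      have h1 := hS.apply_one_add_eq hc ((toTrunc_dvd_iff hϖ (Nat.sub_le _ _)).mpr hx)
      rw [← map_one (toTrunc F m), ← map_add, add_sub_cancel, hX, ← ha', ← map_mul,
        AddChar.map_neg_eq_inv] at h1
      rw [inv_apply, Units.val_inv_eq_inv_val, h1, inv_inv]
    refine ⟨_, ha0, fun c' hc' => ?_⟩
    obtain ⟨a', rfl⟩ := QuotientGroup.mk_surjective c'
    rw [isCElt_mk_iff hϖ hχm hθ] at hc' ha0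
    have h1 : toTrunc F m ϖ ^ (m - m / 2) * (toTrunc F m a' - toTrunc F m a) = 0 := by
      refine hprim.eq_zero fun y => ?_
      obtain ⟨y, rfl⟩ := Ideal.Quotient.mk_surjective y
      obtain ⟨x, hx, hxe⟩ := exists_unit_eq_one_add (F := F) (n := m - m / 2) (by omega)
        ((mem_maximalIdeal_pow hϖ).mpr (dvd_mul_right _ y))
      have h2 := (hc' x hx).trans (ha0 x hx).symm
      rw [hxe, add_sub_cancel_left] at h2
      have h3 : toTrunc F m ϖ ^ (m - m / 2) * (toTrunc F m a' - toTrunc F m a) * toTrunc F m y =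
          toTrunc F m (a' * (ϖ ^ (m - m / 2) * y)) - toTrunc F m (a * (ϖ ^ (m - m / 2) * y)) := by
        simp only [map_mul, map_pow]
        ring
      rw [h3, AddChar.map_sub_eq_div, h2, div_self (AddChar.val_isUnit θ _).ne_zero]
    rw [hS.pow_mul_eq_zero_iff _ (Nat.sub_le _ _), ← map_sub, toTrunc_dvd_iff hϖ (Nat.sub_le _ _)]
      at h1
    rw [QuotientGroup.eq, mem_principalUnits, mem_maximalIdeal_pow hϖ, hχm]
    have h4 : ((a'⁻¹ * a : 𝒪[F]ˣ) : 𝒪[F]) - 1 = -((a'⁻¹ : 𝒪[F]ˣ) : 𝒪[F]) * (a' - a) := by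
      have h5 : ((a' : 𝒪[F]ˣ) : 𝒪[F]) * ((a'⁻¹ : 𝒪[F]ˣ) : 𝒪[F]) = 1 := a'.mul_inv
      rw [Units.val_mul]
      linear_combination h5
    rw [h4]
    exact dvd_mul_of_dvd_right ((pow_dvd_pow ϖ (by omega)).trans h1) _
  have hspec : IsCElt ϖ χ (ψ.mulShift ((ϖ : F) ^ addCond ϖ ψ))
      (cElt ϖ χ (ψ.mulShift ((ϖ : F) ^ addCond ϖ ψ))) := by
    rw [cElt, dif_pos hex]
    exact hex.choose_spec.1
  rw [← QuotientGroup.out_eq' (cElt ϖ χ (ψ.mulShift ((ϖ : F) ^ addCond ϖ ψ))),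
    isCElt_mk_iff hϖ hχm hθ] at hspec
  obtain ⟨b, rfl⟩ := Ideal.Quotient.mk_surjective b
  rw [toTrunc_dvd_iff hϖ (Nat.sub_le _ _), ← mem_maximalIdeal_pow hϖ] at hb
  obtain ⟨x, hx, hxe⟩ := exists_unit_eq_one_add (by omega) hb
  have h1 := hspec x hx
  rw [hxe, add_sub_cancel_left, inv_apply, Units.val_inv_eq_inv_val, ← hX,
    hxe] at h1
  rw [← map_mul, AddChar.map_neg_eq_inv, h1, inv_inv, map_add (toTrunc F m), map_one (toTrunc F m)]

end Reduction

end PadicHD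

/-! ### The product formula for `τ` -/

namespace PadicHD

section ProductFormula

open ValuativeRel

variable {F : Type*} [Field F] [ValuativeRel F] [TopologicalSpace F]
  [IsNonarchimedeanLocalField F] {ϖ : 𝒪[F]} {ψ : AddChar F ℂ} {d : ℕ} {ζ : 𝓀[F]}
  {J : Subgroup (Fˣ →ₜ* ℂˣ)} {χ : Fˣ →ₜ* ℂˣ}

theorem finprod_tau_of_even [Fintype 𝓀[F]] [DecidableEq 𝓀[F]] (hϖ : 𝓂[F] = Ideal.span {ϖ})
    (hK : ringChar 𝓀[F] ≠ 2) (hd : (d : 𝓀[F]) ≠ 0) (hζ : IsPrimitiveRoot ζ d) (hJ : IsLift d J)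
    (hψ : Continuous ψ) (hψ1 : ψ ≠ 1) (hχ : ¬ IsUnramified (χ ^ d)) (hm : Even (mulCond χ)) :
    ∏ᶠ η : J, tau ϖ (χ * (η : Fˣ →ₜ* ℂˣ)) ψ = tau ϖ (χ ^ d) (ψ.mulShift (d : F)) *
      ∏ η ∈ torsionChars 𝓀[F] d, η (unitRed F
        (cElt ϖ χ (ψ.mulShift ((ϖ : F) ^ addCond ϖ ψ))).out : 𝓀[F]ˣ) := by
  have hχ0 := not_isUnramified_of_pow hχ
  obtain ⟨h1, h2, -⟩ := mulCond_spec hϖ hχ0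
  obtain ⟨m, hχm⟩ : ∃ m, mulCond χ = m := ⟨_, rfl⟩
  rw [hχm] at h1 h2 hm
  have hm2 : 2 ≤ m := by
    obtain ⟨k, rfl⟩ := hm; omega
  have : Fintype (Trunc F m) := Fintype.ofFinite _
  obtain ⟨X, hX⟩ := exists_mulChar_trunc h1 h2
  obtain ⟨θ, hθ⟩ := exists_addChar_trunc_addCond hϖ hψ hψ1 m
  obtain ⟨φ, hφ1, hφ⟩ := exists_addChar_residue hϖ hψ hψ1
  have hφθ := apply_truncRes hϖ h1 hφ hθ
  have hprim := isPrimitive_trunc hϖ h1 hφ1 hφθ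
  rw [finprod_tau_eq hϖ h1 hJ hχ hχm hX hθ, tau_pow_eq hϖ hψ hψ1 h1 hd hχ hχm hX hθ]
  exact (isTruncatedDVR hϖ h1).prod_gaussSum_of_even hm2 hm hK hprim
    (exists_apply_one_add_ne_one hϖ hχ0 hm2 hχm hX) hζ hd (resCard_rpow_sq_mul_card F)
    (apply_one_add_eq_cElt hϖ hK hχ0 hm2 hχm hprim hX hθ)

theorem finprod_tau_of_odd [Fintype 𝓀[F]] [DecidableEq 𝓀[F]] (hϖ : 𝓂[F] = Ideal.span {ϖ})
    (hK : ringChar 𝓀[F] ≠ 2) (hd : (d : 𝓀[F]) ≠ 0) (hζ : IsPrimitiveRoot ζ d) (hJ : IsLift d J)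
    (hψ : Continuous ψ) (hψ1 : ψ ≠ 1) (hχ : ¬ IsUnramified (χ ^ d)) (hm : Odd (mulCond χ)) :
    ∏ᶠ η : J, tau ϖ (χ * (η : Fˣ →ₜ* ℂˣ)) ψ = tau ϖ (χ ^ d) (ψ.mulShift (d : F)) *
      if Odd d then 1 else etaK F ((2 * d : ℕ) : 𝓀[F]) *
        (((resCard F : ℝ) ^ (-(1 : ℝ) / 2) : ℝ) : ℂ) * quadGauss ϖ ψ := by
  have hχ0 := not_isUnramified_of_pow hχ
  obtain ⟨h1, h2, -⟩ := mulCond_spec hϖ hχ0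
  obtain ⟨m, hχm⟩ : ∃ m, mulCond χ = m := ⟨_, rfl⟩
  rw [hχm] at h1 h2 hm
  have : Fintype (Trunc F m) := Fintype.ofFinite _
  obtain ⟨X, hX⟩ := exists_mulChar_trunc h1 h2
  obtain ⟨θ, hθ⟩ := exists_addChar_trunc_addCond hϖ hψ hψ1 m
  obtain ⟨φ, hφ1, hφ⟩ := exists_addChar_residue hϖ hψ hψ1
  have hφθ := apply_truncRes hϖ h1 hφ hθ
  have hS := isTruncatedDVR (F := F) hϖ h1
  rw [finprod_tau_eq hϖ h1 hJ hχ hχm hX hθ, tau_pow_eq hϖ hψ hψ1 h1 hd hχ hχm hX hθ, etaK_eq,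
    quadGauss_eq hK hφ1 hφ]
  -- Conductor one is the Hasse–Davenport case; stationary phase needs conductor at least two.
  rcases h1.eq_or_lt with rfl | hm2
  · simp only [pow_one]
    exact hS.prod_gaussSum_of_eq_one hK hφ1 (fun x => by simpa using hφθ x) X hζ hd
      (resCard_rpow_sq_mul_card F)
  · exact hS.prod_gaussSum_of_odd hm2 hm hK (isPrimitive_trunc hϖ h1 hφ1 hφθ) hφ1 hφθ
      (exists_apply_one_add_ne_one hϖ hχ0 hm2 hχm hX) hζ hd (resCard_rpow_sq_mul_card F)

end ProductFormula

end PadicHD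

/-! ### The main theorem -/

/-- `F` is a finite extension of `ℚ_[p]` with its `p`-adic valuation and topology, `p` is odd,
`ϖ` is a uniformizer, `μ_d ⊆ F`, `J` is a lift of the characters of `𝓀ˣ / 𝓀ˣ ^ d` and `χ ^ d` is
ramified. -/
theorem theorem1 {p : ℕ} [Fact p.Prime] (hp : p ≠ 2)
    {F : Type*} [Field F] [Algebra ℚ_[p] F] [FiniteDimensional ℚ_[p] F]
    [ValuativeRel F] [ValuativeExtension ℚ_[p] F]
    [TopologicalSpace F] [IsNonarchimedeanLocalField F]
    (ϖ : 𝒪[F]) (hϖ : 𝓂[F] = Ideal.span {ϖ})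
    (d : ℕ) (hd : Nat.Coprime d p) (hμ : ∃ ζ : F, IsPrimitiveRoot ζ d)
    (J : Subgroup (Fˣ →ₜ* ℂˣ)) (hJ : PadicHD.IsLift d J)
    (ψ : AddChar F ℂ) (hψc : Continuous ψ) (hψ : ψ ≠ 1)
    (χ : Fˣ →ₜ* ℂˣ) (hχ : ¬ PadicHD.IsUnramified (χ ^ d)) :
    (Odd d →
      ∏ᶠ η : J, PadicHD.tau ϖ ((η : Fˣ →ₜ* ℂˣ) * χ) ψ =
        PadicHD.tau ϖ (χ ^ d) (ψ.mulShift (d : F))) ∧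
    (Even d → Even (PadicHD.mulCond χ) →
      ∏ᶠ η : J, PadicHD.tau ϖ (χ * (η : Fˣ →ₜ* ℂˣ)) ψ =
        PadicHD.tau ϖ (χ ^ d) (ψ.mulShift (d : F)) *
          PadicHD.etaClass
            (PadicHD.cElt ϖ χ (ψ.mulShift ((ϖ : F) ^ PadicHD.addCond ϖ ψ)))) ∧
    (Even d → Odd (PadicHD.mulCond χ) →
      ∏ᶠ η : J, PadicHD.tau ϖ (χ * (η : Fˣ →ₜ* ℂˣ)) ψ =
        PadicHD.tau ϖ (χ ^ d) (ψ.mulShift (d : F)) *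
          (PadicHD.etaK F ((2 * d : ℕ) : 𝓀[F]) *
            (((PadicHD.resCard F : ℝ) ^ (-(1 : ℝ) / 2) : ℝ) : ℂ) *
            PadicHD.quadGauss ϖ ψ)) := by
  classical
  have : Fintype 𝓀[F] := Fintype.ofFinite _
  have hp0 := PadicHD.residue_prime_eq_zero (p := p) (F := F)
  have hchar : ringChar 𝓀[F] = p := CharP.ringChar_of_prime_eq_zero Fact.out hp0
  have hK : ringChar 𝓀[F] ≠ 2 := hchar ▸ hp
  have hdK : (d : 𝓀[F]) ≠ 0 := fun h => by
    have h1 : p ∣ d := hchar ▸ ringChar.dvd h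
    exact (Nat.Prime.coprime_iff_not_dvd Fact.out).mp hd.symm h1
  have hd0 : d ≠ 0 := by rintro rfl; simp at hdK
  obtain ⟨ζ, hζ⟩ := hμ
  obtain ⟨ξ, hξ⟩ := PadicHD.exists_isPrimitiveRoot_residue hζ hdK
  have hunit : ∀ u : 𝓀[F]ˣ, (u : 𝓀[F]) ≠ 0 := fun u => u.ne_zero
  refine ⟨fun hodd => ?_, fun heven hm => ?_, fun heven hm => ?_⟩
  · simp only [mul_comm _ χ]
    rcases Nat.even_or_odd (PadicHD.mulCond χ) with hm | hm
    -- For odd `d` the torsion characters cancel in inverse pairs, so `c` drops out.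
    · rw [PadicHD.finprod_tau_of_even hϖ hK hdK hξ hJ hψc hψ hχ hm,
        prod_torsionChars_apply_of_odd hodd hξ (hunit _), mul_one]
    · rw [PadicHD.finprod_tau_of_odd hϖ hK hdK hξ hJ hψc hψ hχ hm, if_pos hodd, mul_one]
  · rw [PadicHD.finprod_tau_of_even hϖ hK hdK hξ hJ hψc hψ hχ hm,
      prod_torsionChars_apply_of_even hK heven hd0 hξ (hunit _), PadicHD.etaClass,
      PadicHD.etaK_eq]
  · rw [PadicHD.finprod_tau_of_odd hϖ hK hdK hξ hJ hψc hψ hχ hm,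
      if_neg (Nat.not_odd_iff_even.mpr heven)]
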